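/- Let $X$ be a complex manifold of dimension $3$ and $m\ge 0$ an integer. For $x\in X$, let $E_{3,m}T_{X,x}^*$ be the vector space of the functions $Q$ on germs of holomorphic curves $f:(\mathbb C,0)\to (X,x)$ that are given in local coordinates by a polynomial $Q(f',f'',f''')$ in the components of the derivatives of $f$ at $0$ and satisfy $$Q\big((f\circ\varphi)',(f\circ\varphi)'',(f\circ\varphi)'''\big)=\varphi'(0)^m\,Q(f',f'',f''')$$ for every germ of biholomorphism $\varphi$ of $(\mathbb C,0)$. These spaces are the fibres of the bundle $E_{3,m}T_X^*$ of invariant jet differentials of order $3$ and degree $m$. It is filtered by the multidegree $l=(l_1,l_2,l_3)$ of the monomials of $Q$, where $l_j$ is the degree in $f^{(j)}$ and multidegrees are compared lexicographically, first by $l_3$, then by $l_2$, then by $l_1$. Let $Gr^\bullet E_{3,m}T_X^*=\bigoplus_{l_1+2l_2+3l_3=m}Gr^l E_{3,m}T_X^*$ be the associated graded bundle. For integers $\lambda_1\ge\lambda_2\ge\lambda_3\ge 0$ let $\Gamma^{(\lambda_1,\lambda_2,\lambda_3)}$ be the Schur functor. Then there is an isomorphism of holomorphic vector bundles $$Gr^{\bullet}E_{3,m}T_X^*\;\cong\;\bigoplus_{0\le\gamma\le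 m/5}\ \Big(\bigoplus_{\substack{\lambda_1+2\lambda_2+3\lambda_3=m-\gamma\\ \lambda_i-\lambda_j\ge\gamma\ (i<j)}}\Gamma^{(\lambda_1,\lambda_2,\lambda_3)}T_X^*\Big),$$ where $\gamma$ and the $\lambda_i$ are integers and $\lambda_3\ge 0$. It can be chosen compatible with pullback by germs of biholomorphic maps between open subsets of $X$; in particular it is, in each fibre, an isomorphism of representations of $GL(T_{X,x})$. Each triple $(\lambda_1,\lambda_2,\lambda_3)$ occurs for at most one value of $\gamma$, so that each Schur functor $\Gamma^{(\lambda_1,\lambda_2,\lambda_3)}$ that occurs does so exactly once. -/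

import Mathlib

open scoped Manifold ContDiff Topology DirectSum

noncomputable section

/-! ### The Schur functor on a dual space

For a finite-dimensional vector space `V`, the tensor power `(V^*)^{⊗ d}` is the space of
`d`-linear forms on `V`. The `d` factors are indexed by the cells of the diagram of `lam`. -/

/-- The cells `(i, j)`, `j < lam i`, of the diagram with rows of lengths `lam 0, lam 1, …`. -/
abbrev Cells {r : ℕ} (lam : Fin r → ℕ) : Type := (i : Fin r) × Fin (lam i)

section Schur

variable {r : ℕ} (lam : Fin r → ℕ) (V : Type*) [AddCommGroup V] [Module ℂ V]

/-- The permutations of the cells that preserve every row. -/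
def rowPerms : Finset (Equiv.Perm (Cells lam)) :=
  Finset.univ.filter fun σ => ∀ c, (σ c).1 = c.1

/-- The permutations of the cells that preserve every column. -/
def colPerms : Finset (Equiv.Perm (Cells lam)) :=
  Finset.univ.filter fun σ => ∀ c, ((σ c).2 : ℕ) = (c.2 : ℕ)

/-- Multilinear forms on `V` with one argument for each cell: `(V^*)^{⊗ |lam|}`. -/
abbrev CellForms : Type _ := MultilinearMap ℂ (fun _ : Cells lam => V) ℂ

/-- Permutation of the arguments. -/
def permForm (σ : Equiv.Perm (Cells lam)) : CellForms lam V →ₗ[ℂ] CellForms lam V :=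
  (MultilinearMap.domDomCongrLinearEquiv ℂ ℂ V ℂ σ).toLinearMap

/-- The Young symmetrizer: alternate along the columns, then symmetrize along the rows. -/
def youngSymmetrizer : CellForms lam V →ₗ[ℂ] CellForms lam V :=
  (∑ σ ∈ rowPerms lam, permForm lam V σ) ∘ₗ
    (∑ σ ∈ colPerms lam, ((Equiv.Perm.sign σ : ℤ) : ℂ) • permForm lam V σ)

/-- The Schur functor `Γ^lam` applied to the dual `V^*` of `V`: the image of the Young
symmetrizer in `(V^*)^{⊗ |lam|}`. -/
def SchurDual : Submodule ℂ (CellForms lam V) := LinearMap.range (youngSymmetrizer lam V)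

variable {V} {W : Type*} [AddCommGroup W] [Module ℂ W]

lemma youngSymmetrizer_comp (A : V →ₗ[ℂ] W) (M : CellForms lam W) :
    (youngSymmetrizer lam W M).compLinearMap (fun _ => A) =
      youngSymmetrizer lam V (M.compLinearMap fun _ => A) := by
  ext v
  simp [youngSymmetrizer, permForm]

/-- `Γ^lam` of the transpose `W^* → V^*` of a linear map `A : V → W`: pullback of forms. -/
def schurPullback (A : V →ₗ[ℂ] W) : SchurDual lam W →ₗ[ℂ] SchurDual lam V :=
  (MultilinearMap.compLinearMapₗ (fun _ : Cells lam => A)).restrict (by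
    rintro _ ⟨M, rfl⟩
    exact ⟨M.compLinearMap fun _ => A, (youngSymmetrizer_comp lam A M).symm⟩)

end Schur

/-! ### Germs of holomorphic curves in a complex manifold and their jets -/

/-- The model space `ℂⁿ`. -/
abbrev Cn (n : ℕ) : Type := Fin n → ℂ

section Jets

variable (n : ℕ) {X : Type*} [TopologicalSpace X] [ChartedSpace (Cn n) X]

/-- A curve `f : (ℂ, 0) → (X, x)` that is holomorphic near `0`. -/
structure HolCurve (x : X) where
  toFun : ℂ → X
  map_zero : toFun 0 = x
  hol : ContMDiffAt 𝓘(ℂ, ℂ) 𝓘(ℂ, Cn n) ω toFun 0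

/-- A change of parameter: `φ : (ℂ, 0) → (ℂ, 0)` holomorphic near `0` with `φ'(0) ≠ 0`. -/
structure Reparam where
  toFun : ℂ → ℂ
  map_zero : toFun 0 = 0
  hol : AnalyticAt ℂ toFun 0
  deriv_ne : deriv toFun 0 ≠ 0

/-- The dilation `t ↦ a t`. -/
def dilation (a : ℂˣ) : Reparam where
  toFun t := a * t
  map_zero := by simp
  hol := by fun_prop
  deriv_ne := by simp [deriv_const_mul_id']

variable {n}

/-- `f ∘ φ`. -/
def HolCurve.reparam {x : X} (f : HolCurve n x) (φ : Reparam) : HolCurve n x where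
  toFun t := f.toFun (φ.toFun t)
  map_zero := by rw [φ.map_zero, f.map_zero]
  hol := ContMDiffAt.comp_of_eq f.hol φ.hol.contDiffAt.contMDiffAt φ.map_zero

/-- `ψ ∘ f`, for a map `ψ` that is holomorphic near the point `x`. -/
def HolCurve.map {x : X} (f : HolCurve n x) (ψ : X → X)
    (hψ : ContMDiffAt 𝓘(ℂ, Cn n) 𝓘(ℂ, Cn n) ω ψ x) : HolCurve n (ψ x) where
  toFun t := ψ (f.toFun t)
  map_zero := by rw [f.map_zero]
  hol := ContMDiffAt.comp_of_eq hψ f.hol f.map_zero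

/-- The coordinates `f_i^{(j+1)}(0)`, `j < k`, of the `k`-jet of `f` in the chart `e`. -/
def jetCoord (k : ℕ) (e : OpenPartialHomeomorph X (Cn n)) {x : X} (f : HolCurve n x) :
    Fin k × Fin n → ℂ :=
  fun ji => iteratedDeriv (ji.1 + 1) (fun t => e (f.toFun t) ji.2) 0

/-- The functions of the `k`-jet of a curve through `x` that are given, in every chart at `x`, by
a polynomial in `f', …, f^{(k)}` belonging to `S`. -/
def polyJets (k : ℕ) (S : Submodule ℂ (MvPolynomial (Fin k × Fin n) ℂ)) (x : X) :
    Submodule ℂ (HolCurve n x → ℂ) where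
  carrier := {Q | ∀ e ∈ atlas (Cn n) X, x ∈ e.source →
    ∃ p ∈ S, ∀ f, Q f = MvPolynomial.eval (jetCoord k e f) p}
  zero_mem' := fun _ _ _ => ⟨0, S.zero_mem, by simp⟩
  add_mem' := by
    intro Q R hQ hR e he hx
    obtain ⟨p, hp, h⟩ := hQ e he hx
    obtain ⟨q, hq, h'⟩ := hR e he hx
    exact ⟨p + q, S.add_mem hp hq, fun f => by simp [h, h']⟩
  smul_mem' := by
    intro a Q hQ e he hx
    obtain ⟨p, hp, h⟩ := hQ e he hx
    exact ⟨a • p, S.smul_mem a hp, fun f => by simp [h, MvPolynomial.smul_eval]⟩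

/-- The fibre at `x` of the Green–Griffiths bundle `E_{k,m}^{GG} T_X^*`: polynomials
`Q(f', …, f^{(k)})` with `Q(a f', …, a^k f^{(k)}) = a^m Q(f', …, f^{(k)})`. -/
def greenGriffiths (k m : ℕ) (x : X) : Submodule ℂ (HolCurve n x → ℂ) where
  carrier := {Q | Q ∈ polyJets k ⊤ x ∧
    ∀ (a : ℂˣ) (f : HolCurve n x), Q (f.reparam (dilation a)) = (a : ℂ) ^ m * Q f}
  zero_mem' := ⟨Submodule.zero_mem _, by simp⟩
  add_mem' := fun hQ hR => ⟨Submodule.add_mem _ hQ.1 hR.1, fun a f => by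
    simp only [Pi.add_apply, hQ.2 a f, hR.2 a f]; ring⟩
  smul_mem' := fun b _ hQ => ⟨Submodule.smul_mem _ b hQ.1, fun a f => by
    simp only [Pi.smul_apply, smul_eq_mul, hQ.2 a f]; ring⟩

/-- The fibre at `x` of the bundle `E_{k,m} T_X^*` of invariant jet differentials:
`Q((f ∘ φ)', …, (f ∘ φ)^{(k)}) = φ'(0)^m Q(f', …, f^{(k)})`. -/
def invJets (k m : ℕ) (x : X) : Submodule ℂ (HolCurve n x → ℂ) where
  carrier := {Q | Q ∈ greenGriffiths k m x ∧
    ∀ (φ : Reparam) (f : HolCurve n x), Q (f.reparam φ) = deriv φ.toFun 0 ^ m * Q f}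
  zero_mem' := ⟨Submodule.zero_mem _, by simp⟩
  add_mem' := fun hQ hR => ⟨Submodule.add_mem _ hQ.1 hR.1, fun a f => by
    simp only [Pi.add_apply, hQ.2 a f, hR.2 a f]; ring⟩
  smul_mem' := fun b _ hQ => ⟨Submodule.smul_mem _ b hQ.1, fun a f => by
    simp only [Pi.smul_apply, smul_eq_mul, hQ.2 a f]; ring⟩

/-! ### The canonical filtration and its graded pieces -/

/-- The multidegree `(l_1, …, l_k)` of a monomial, `l_j` being its degree in `f^{(j)}`. It is
compared by the degree in `f^{(k)}` first, then by the degree in `f^{(k-1)}`, and so on. -/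
def multidegree {k : ℕ} (s : Fin k × Fin n →₀ ℕ) : Colex (Fin k → ℕ) :=
  toColex fun j => ∑ i, s (j, i)

/-- The step of index `l` of the filtration of `E_{k,m} T_X^*` at `x`: invariant jet differentials
all of whose monomials have multidegree at most `l`. -/
def filLE (k m : ℕ) (l : Fin k → ℕ) (x : X) : Submodule ℂ (HolCurve n x → ℂ) :=
  invJets k m x ⊓
    polyJets k (MvPolynomial.restrictSupport ℂ {s | multidegree s ≤ toColex l}) x

/-- The step just below `l`: all monomials have multidegree less than `l`. -/
def filLT (k m : ℕ) (l : Fin k → ℕ) (x : X) : Submodule ℂ (HolCurve n x → ℂ) :=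
  invJets k m x ⊓
    polyJets k (MvPolynomial.restrictSupport ℂ {s | multidegree s < toColex l}) x

/-- The graded piece `Gr^l E_{k,m} T_X^*` at `x`. -/
abbrev GrPiece (k m : ℕ) (l : Fin k → ℕ) (x : X) : Type _ :=
  filLE (n := n) k m l x ⧸ (filLT (n := n) k m l x).submoduleOf (filLE k m l x)

/-- The multi-indices with `l_1 + 2 l_2 + ⋯ + k l_k = m`. -/
abbrev WeightIndex (k m : ℕ) : Type := {l : Fin k → ℕ // ∑ j : Fin k, ((j : ℕ) + 1) * l j = m}

variable (n) in
/-- The fibre at `x` of the graded bundle `Gr^• E_{k,m} T_X^*`. -/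
abbrev GrJets (k m : ℕ) (x : X) : Type _ := ⨁ l : WeightIndex k m, GrPiece (n := n) k m l.1 x

/-- The class in `Gr^l` of an element of the step of index `l`, seen in `Gr^•`. -/
def grClass {k m : ℕ} (l : WeightIndex k m) {x : X} (Q : filLE (n := n) k m l.1 x) :
    GrJets n k m x :=
  DirectSum.of (fun l : WeightIndex k m => GrPiece (n := n) k m l.1 x) l (Submodule.Quotient.mk Q)

/-! ### Holomorphic sections -/

/-- A family `Q_x` of functions of jets is holomorphic on `U` if `x ↦ Q_x(c_x)` is holomorphic
for every local family of curves `c_x` through `x` such that `c_x(t)` is holomorphic in `(x, t)`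
near `t = 0`. -/
def IsHolJets (U : Set X) (Q : ∀ x : X, HolCurve n x → ℂ) : Prop :=
  ∀ W ⊆ U, IsOpen W → ∀ c : ∀ x : X, HolCurve n x,
    (∀ x ∈ W, ContMDiffAt (𝓘(ℂ, Cn n).prod 𝓘(ℂ, ℂ)) 𝓘(ℂ, Cn n) ω
      (fun p : X × ℂ => (c p.1).toFun p.2) (x, 0)) →
    ContMDiffOn 𝓘(ℂ, Cn n) 𝓘(ℂ, ℂ) ω (fun x => Q x (c x)) W

/-- A section of `Gr^• E_{k,m} T_X^*` is holomorphic on `U` if each of its components is, locally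
on `U`, the class of a holomorphic section of the corresponding step of the filtration. -/
def IsHolGr {k m : ℕ} (U : Set X) (s : ∀ x : X, GrJets n k m x) : Prop :=
  ∀ l : WeightIndex k m, ∀ x₀ ∈ U, ∃ W ⊆ U, IsOpen W ∧ x₀ ∈ W ∧
    ∃ Q : ∀ x : X, filLE (n := n) k m l.1 x,
      IsHolJets W (fun x => (Q x : HolCurve n x → ℂ)) ∧
        ∀ x ∈ W, s x l = Submodule.Quotient.mk (Q x)

/-- The fibre of the Schur bundle `Γ^lam T_X^*` at `x`. -/
abbrev SchurCotangent {r : ℕ} (lam : Fin r → ℕ) (x : X) : Type _ :=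
  SchurDual lam (TangentSpace 𝓘(ℂ, Cn n) x)

/-- A section of `Γ^lam T_X^*` is holomorphic on `U` if its value on local holomorphic vector
fields is holomorphic. -/
def IsHolSchur [IsManifold 𝓘(ℂ, Cn n) ω X] {r : ℕ} {lam : Fin r → ℕ} (U : Set X)
    (s : ∀ x : X, SchurCotangent (n := n) lam x) : Prop :=
  ∀ W ⊆ U, IsOpen W → ∀ v : Cells lam → ∀ x : X, TangentSpace 𝓘(ℂ, Cn n) x,
    (∀ c, ContMDiffOn 𝓘(ℂ, Cn n) 𝓘(ℂ, Cn n).tangent ω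
      (fun x => (⟨x, v c x⟩ : TangentBundle 𝓘(ℂ, Cn n) X)) W) →
    ContMDiffOn 𝓘(ℂ, Cn n) 𝓘(ℂ, ℂ) ω (fun x => (s x).1 fun c => v c x) W

end Jets

/-- The pairs `(γ, lam)` with `0 ≤ γ ≤ m / 5`, `lam_1 + 2 lam_2 + 3 lam_3 = m - γ` and
`lam_i - lam_j ≥ γ` for `i < j`. -/
abbrev SchurIndex (m : ℕ) : Type :=
  {p : ℕ × (Fin 3 → ℕ) // (p.1 : ℚ) ≤ m / 5 ∧
    (p.2 0 : ℤ) + 2 * p.2 1 + 3 * p.2 2 = m - p.1 ∧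
    ∀ i j : Fin 3, i < j → (p.1 : ℤ) ≤ p.2 i - p.2 j}

end

/-! Write E_ab for `polar a b`, with a, b = 0, 1, 2 standing for f', f'', f'''. These operators
satisfy the relations of gl₃ and commute with linear substitutions in ℂ³. Differentiating the
invariance of p along changes of parameter tangent to the identity gives E_02 p = 0 and E_01 p = -3
E_12 p.

Let P be the leading form of p, of multidegree l. Then E_02 P = 0. Also E_01 P = 0, since the other
side of the relation comes from a component of larger degree in f''', which is absent. Hence the
last nonzero iterate T = E_12^c P is killed by all raising operators: it is a highest weight
polynomial of weight λ = (l₁, l₂ + c, l₃ - c). Degrees give c ≤ l₃ and `sl₂`-theory for E_12 gives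
l₃ ≤ l₂ + c. Comparing components of p along E_01 p = -3 E_12 p shows that T is proportional to
E_01^c of the component of multidegree (l₁ - c, l₂ + 2c, l₃ - c), and injectivity of E_01^(c+1)
there would force T = 0 unless l₂ + 2c ≤ l₁. With γ = c these bounds read λ₃ ≥ 0, λ₁ - λ₂ ≥ γ, λ₂ -
λ₃ ≥ γ (`admissible_of_pow_ne_zero`).

Conversely, Capelli's identities show that highest weight polynomials are combinations of products
of coordinates of f', of f' ∧ f'' and of the Wronskian (`mem_flagSpan_of_isHighest`). The operator
E_21^c turns c factors f' ∧ f'' into f' ∧ f'''. Each of these, multiplied by a coordinate of f', is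
the leading form of an invariant of degree 5 (`spanU_mul_spanN_le_leadForms`), and λ₁ - λ₂ ≥ γ
provides enough factors f'. So the leading forms of multidegree l are the direct sum over admissible
c of the images under E_21^c of highest weight polynomials (`exists_decomposition`,
`eq_zero_of_sum_polar_eq_zero`), and each such space of highest weight polynomials is a Schur
functor (`map_diag_schurDual`).

A holomorphic map acts on leading forms through its Jacobian matrix alone (`leadsTo_jetPull`), and
every construction above commutes with linear substitutions. The isomorphisms obtained in charts are
therefore compatible with changes of chart and with pullback, and they preserve holomorphy. -/

noncomputable section

open MvPolynomial

/-! ### A lemma on `sl₂`-triples of endomorphisms -/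

section Sl2

variable {M : Type*} [AddCommGroup M] [Module ℂ M] {e f h : Module.End ℂ M}

/-- Moving `f` to the left leaves k + 1 commutators `h`, acting with eigenvalues μ, μ + 2, …, μ +
2k, whose sum is (k + 1)(μ + k). -/
lemma sl2_pow_e_f (hef : ∀ x, e (f x) = f (e x) + h x) (hhe : ∀ x, h (e x) = e (h x) + (2 : ℂ) • e x)
    {μ : ℂ} {x : M} (hx : h x = μ • x) (k : ℕ) :
    (e ^ (k + 1)) (f x) = f ((e ^ (k + 1)) x) + ((k + 1 : ℂ) * (μ + k)) • (e ^ k) x := by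
  have hw : ∀ k : ℕ, h ((e ^ k) x) = (μ + 2 * k) • (e ^ k) x := by
    intro k
    induction k with
    | zero => simp [hx]
    | succ k ih =>
      rw [pow_succ', Module.End.mul_apply, hhe, ih, map_smul, ← add_smul]
      congr 1
      push_cast
      ring
  induction k with
  | zero => simp [hef, hx]
  | succ k ih =>
    rw [pow_succ', Module.End.mul_apply, ih, map_add, hef, hw, map_smul,
      ← Module.End.mul_apply e (e ^ k), ← pow_succ', ← Module.End.mul_apply e (e ^ (k + 1)),
      ← pow_succ', add_assoc, ← add_smul]
    congr 2
    push_cast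
    ring

/-- On vectors of weight `-n`, the operator `e ^ n` is injective. -/
lemma sl2_pow_e_injective (hef : ∀ x, e (f x) = f (e x) + h x)
    (hhe : ∀ x, h (e x) = e (h x) + (2 : ℂ) • e x)
    (hhf : ∀ x, h (f x) = f (h x) - (2 : ℂ) • f x) (r : ℕ) :
    ∀ (n : ℕ) (x : M), h x = (-(n : ℂ)) • x → (e ^ n) x = 0 → (f ^ r) x = 0 → x = 0 := by
  induction r with
  | zero => intro n x _ _ hf; simpa using hf
  | succ r ih =>
    intro n x hx he hf
    have hfx : f x = 0 := by
      -- `f x` has weight -(n + 2) and is killed by one power of `f` fewer, so induction on the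
      -- nilpotency order makes `x` a lowest weight vector.
      refine ih (n + 2) (f x) ?_ ?_ ?_
      · rw [hhf, hx, map_smul, ← sub_smul]
        congr 1
        push_cast
        ring
      · rw [sl2_pow_e_f hef hhe hx (n + 1)]
        simp [pow_succ', he]
      · rwa [pow_succ, Module.End.mul_apply] at hf
    -- With `f x = 0` the commutation formula reads 0 = f (e^(j+1) x) + (j + 1)(j - n) e^j x. The
    -- scalar is nonzero for j < n, so vanishing descends from e^n x to x.
    have hdown : ∀ k ≤ n, (e ^ (n - k)) x = 0 := by
      intro k
      induction k with
      | zero => intro _; simpa using he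
      | succ k ihk =>
        intro hk
        have h1 := sl2_pow_e_f hef hhe hx (n - (k + 1))
        have h2 : n - (k + 1) + 1 = n - k := by omega
        rw [h2, ihk (by omega), hfx, map_zero, map_zero, zero_add] at h1
        refine (smul_eq_zero.1 h1.symm).resolve_left ?_
        rw [Nat.cast_sub hk]
        push_cast
        refine mul_ne_zero ?_ ?_
        · intro h0
          have : ((n - k : ℕ) : ℂ) = 0 := by
            rw [Nat.cast_sub (by omega)]; linear_combination h0
          rw [Nat.cast_eq_zero] at this
          omega
        · intro h0
          have : ((k + 1 : ℕ) : ℂ) = 0 := by push_cast; linear_combination -h0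
          rw [Nat.cast_eq_zero] at this
          omega
    simpa using hdown n le_rfl

/-- On a vector of weight `q` killed by `e`, `e ^ c * f ^ c` is a nonzero scalar for `c ≤ q`. -/
lemma sl2_pow_e_pow_f (hef : ∀ x, e (f x) = f (e x) + h x)
    (hhf : ∀ x, h (f x) = f (h x) - (2 : ℂ) • f x) {q : ℕ} {x : M}
    (hx : h x = (q : ℂ) • x) (he : e x = 0) :
    ∀ c ≤ q, ∃ a : ℂ, a ≠ 0 ∧ (e ^ c) ((f ^ c) x) = a • x := by
  have hw : ∀ k : ℕ, h ((f ^ k) x) = ((q : ℂ) - 2 * k) • (f ^ k) x := by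
    intro k
    induction k with
    | zero => simp [hx]
    | succ k ih =>
      rw [pow_succ', Module.End.mul_apply, hhf, ih, map_smul, ← sub_smul]
      congr 1
      push_cast
      ring
  -- The scalar (k + 1)(q - k) first vanishes at k = q, which is the reason for the bound c ≤ q.
  have hstep : ∀ k : ℕ, e ((f ^ (k + 1)) x) = ((k + 1 : ℂ) * (q - k)) • (f ^ k) x := by
    intro k
    induction k with
    | zero => simp [hef, hx, he]
    | succ k ih =>
      rw [pow_succ', Module.End.mul_apply, hef, ih, map_smul, hw,
        ← Module.End.mul_apply f (f ^ k), ← pow_succ', ← add_smul]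
      congr 1
      push_cast
      ring
  intro c
  induction c with
  | zero => exact fun _ => ⟨1, one_ne_zero, by simp⟩
  | succ c ih =>
    intro hc
    obtain ⟨a, ha, h1⟩ := ih (by omega)
    refine ⟨((c + 1 : ℂ) * (q - c)) * a, mul_ne_zero (mul_ne_zero ?_ ?_) ha, ?_⟩
    · exact_mod_cast Nat.succ_ne_zero c
    · rw [sub_ne_zero, Ne, Nat.cast_inj]
      omega
    · rw [pow_succ, Module.End.mul_apply, hstep, map_smul, h1, smul_smul]

end Sl2

/-! ### Polarization operators on polynomials in three vectors of `ℂ³` -/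

/-- Polynomials in the coordinates `X (j, i)` of `f', f'', f'''`. -/
abbrev JetPoly : Type := MvPolynomial (Fin 3 × Fin 3) ℂ

/-- The polarization operator `∑ i, X (a, i) ∂ / ∂ X (b, i)`. -/
def polar (a b : Fin 3) : Derivation ℂ JetPoly JetPoly :=
  ∑ i, (X (a, i) : JetPoly) • pderiv (b, i)

lemma polar_apply (a b : Fin 3) (P : JetPoly) :
    polar a b P = ∑ i, X (a, i) * pderiv (b, i) P := by
  simp [polar, Fin.sum_univ_three]

@[simp]
lemma polar_X (a b j i : Fin 3) :
    polar a b (X (j, i)) = if j = b then X (a, i) else 0 := by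
  rw [polar_apply]
  by_cases hj : j = b
  · subst hj
    simp [pderiv_X, Pi.single_apply]
  · simp [pderiv_X, hj]

/-- These are the commutation relations of gl₃. Both sides are derivations, so it is enough to
compare them on the variables. -/
lemma polar_comm (a b c d : Fin 3) (P : JetPoly) :
    polar a b (polar c d P) = polar c d (polar a b P) + (if b = c then polar a d P else 0)
      - (if d = a then polar c b P else 0) := by
  have h : ⁅polar a b, polar c d⁆ = (if b = c then polar a d else 0)
      - (if d = a then polar c b else 0) := by
    apply MvPolynomial.derivation_ext
    rintro ⟨j, i⟩
    rw [Derivation.commutator_apply]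
    split_ifs <;> simp <;> (try subst_vars) <;> split_ifs <;> simp_all [eq_comm]
  have h1 := DFunLike.congr_fun h P
  rw [Derivation.commutator_apply] at h1
  rw [sub_eq_iff_eq_add'] at h1
  rw [h1]
  split_ifs <;> simp [sub_eq_add_neg, add_assoc]

lemma polar_pderiv (a b c i : Fin 3) (P : JetPoly) :
    polar a b (pderiv (c, i) P) = pderiv (c, i) (polar a b P)
      - if a = c then pderiv (b, i) P else 0 := by
  have h : ⁅polar a b, (pderiv (c, i) : Derivation ℂ JetPoly JetPoly)⁆ =
      - if a = c then pderiv (b, i) else 0 := by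
    apply MvPolynomial.derivation_ext
    rintro ⟨j, k⟩
    rw [Derivation.commutator_apply]
    split_ifs <;> simp [pderiv_X, Pi.single_apply] <;> split_ifs <;>
      simp_all [pderiv_X]
  have h1 := DFunLike.congr_fun h P
  rw [Derivation.commutator_apply] at h1
  rw [sub_eq_iff_eq_add'] at h1
  rw [h1]
  split_ifs <;> simp [sub_eq_add_neg]

/-! ### Capelli identities and the highest weight polynomials -/

/-- `P` is multihomogeneous of multidegree `l`, expressed by Euler's identities. -/
def HasWeight (l : Fin 3 → ℤ) (P : JetPoly) : Prop := ∀ j, polar j j P = (l j : ℂ) • P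

/-- `P` is invariant under adding to each of the three vectors multiples of the previous ones. -/
def IsHighest (P : JetPoly) : Prop := polar 0 1 P = 0 ∧ polar 0 2 P = 0 ∧ polar 1 2 P = 0

/-- The normally ordered product of two polarization operators. -/
def normalTwo (a b c d : Fin 3) (P : JetPoly) : JetPoly :=
  ∑ i, ∑ j, X (a, i) * X (c, j) * pderiv (b, i) (pderiv (d, j) P)

/-- The normally ordered product of three polarization operators. -/
def normalThree (a b c d e f : Fin 3) (P : JetPoly) : JetPoly :=
  ∑ i, ∑ j, ∑ k, X (a, i) * X (c, j) * X (e, k) *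
    pderiv (b, i) (pderiv (d, j) (pderiv (f, k) P))

lemma polar_polar (a b c d : Fin 3) (P : JetPoly) :
    polar a b (polar c d P) = normalTwo a b c d P + if c = b then polar a d P else 0 := by
  rw [polar_apply c d, map_sum]
  simp only [Derivation.leibniz, polar_X, smul_eq_mul, Finset.sum_add_distrib]
  congr 1
  · rw [normalTwo, Finset.sum_comm]
    refine Finset.sum_congr rfl fun j _ => ?_
    rw [polar_apply, Finset.mul_sum]
    exact Finset.sum_congr rfl fun i _ => by ring
  · split_ifs
    · rw [polar_apply]
      exact Finset.sum_congr rfl fun i _ => by ring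
    · simp

lemma polar_normalTwo (a b c d e f : Fin 3) (P : JetPoly) :
    polar a b (normalTwo c d e f P) = normalThree a b c d e f P
      + (if c = b then normalTwo a d e f P else 0) + if e = b then normalTwo c d a f P else 0 := by
  have h : ∀ i j, polar a b (X (c, i) * X (e, j) * pderiv (d, i) (pderiv (f, j) P)) =
      (∑ k, X (a, k) * X (c, i) * X (e, j) * pderiv (b, k) (pderiv (d, i) (pderiv (f, j) P)))
      + (if c = b then X (a, i) * X (e, j) * pderiv (d, i) (pderiv (f, j) P) else 0)
      + (if e = b then X (c, i) * X (a, j) * pderiv (d, i) (pderiv (f, j) P) else 0) := by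
    intro i j
    have hs : (∑ k, X (a, k) * X (c, i) * X (e, j) *
        pderiv (b, k) (pderiv (d, i) (pderiv (f, j) P))) =
          X (c, i) * X (e, j) * polar a b (pderiv (d, i) (pderiv (f, j) P)) := by
      rw [polar_apply, Finset.mul_sum]
      exact Finset.sum_congr rfl fun k _ => by ring
    rw [hs, Derivation.leibniz, Derivation.leibniz, polar_X, polar_X]
    simp only [smul_eq_mul]
    generalize polar a b (pderiv (d, i) (pderiv (f, j) P)) = T
    generalize pderiv (d, i) (pderiv (f, j) P) = S
    split_ifs <;> ring
  simp only [normalTwo, normalThree, map_sum, h, Finset.sum_add_distrib]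
  refine congrArg₂ (· + ·) (congrArg₂ (· + ·) ?_ ?_) ?_
  · rw [Finset.sum_comm_cycle]
  · split_ifs <;> simp
  · split_ifs <;> simp

/-- Cayley's operator in the first two vectors. -/
def omegaTwo (i j : Fin 3) (P : JetPoly) : JetPoly :=
  pderiv (0, i) (pderiv (1, j) P) - pderiv (0, j) (pderiv (1, i) P)

/-- Cayley's operator `det (∂ / ∂ X (a, i))`. -/
def omegaThree (P : JetPoly) : JetPoly :=
  pderiv (0, 0) (pderiv (1, 1) (pderiv (2, 2) P)) - pderiv (0, 0) (pderiv (1, 2) (pderiv (2, 1) P))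
  + pderiv (0, 1) (pderiv (1, 2) (pderiv (2, 0) P)) - pderiv (0, 1) (pderiv (1, 0) (pderiv (2, 2) P))
  + pderiv (0, 2) (pderiv (1, 0) (pderiv (2, 1) P)) - pderiv (0, 2) (pderiv (1, 1) (pderiv (2, 0) P))

/-- The coordinate `i, j` of `f' ∧ f''`. -/
def minorTwo (i j : Fin 3) : JetPoly := X (0, i) * X (1, j) - X (0, j) * X (1, i)

/-- The coordinate `i, j` of `f' ∧ f'''`. -/
def minorTwo' (i j : Fin 3) : JetPoly := X (0, i) * X (2, j) - X (0, j) * X (2, i)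

/-- The Wronskian `f' ∧ f'' ∧ f'''`. -/
def minorThree : JetPoly := X (2, 2) * minorTwo 0 1 - X (2, 1) * minorTwo 0 2
  + X (2, 0) * minorTwo 1 2

/-- Cauchy–Binet: in normally ordered products the variables and the derivatives behave as commuting
symbols. -/
lemma minorTwo_mul_omegaTwo (P : JetPoly) :
    minorTwo 0 1 * omegaTwo 0 1 P + minorTwo 0 2 * omegaTwo 0 2 P
      + minorTwo 1 2 * omegaTwo 1 2 P = normalTwo 0 0 1 1 P - normalTwo 1 0 0 1 P := by
  simp only [minorTwo, omegaTwo, normalTwo, Fin.sum_univ_three]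
  ring

lemma minorThree_mul_omegaThree (P : JetPoly) :
    minorThree * omegaThree P = normalThree 0 0 1 1 2 2 P - normalThree 0 0 2 1 1 2 P
      - normalThree 1 0 0 1 2 2 P - normalThree 2 0 1 1 0 2 P
      + normalThree 1 0 2 1 0 2 P + normalThree 2 0 0 1 1 2 P := by
  simp only [minorThree, minorTwo, omegaThree, normalThree, Fin.sum_univ_three]
  ring

lemma normalTwo_eq (a b c d : Fin 3) (P : JetPoly) :
    normalTwo a b c d P = polar a b (polar c d P) - if c = b then polar a d P else 0 := by
  rw [polar_polar, add_sub_cancel_right]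

lemma normalThree_eq (a b c d e f : Fin 3) (P : JetPoly) :
    normalThree a b c d e f P = polar a b (normalTwo c d e f P)
      - (if c = b then normalTwo a d e f P else 0) - if e = b then normalTwo c d a f P else 0 := by
  rw [polar_normalTwo]
  ring

/-- When the normal products are rewritten as compositions, the off-diagonal one ends with `polar 0
1` and dies on P. Its ordering correction adds l₁ to the diagonal value l₀ l₁ (indices from 0). -/
lemma capelliTwo {l : Fin 3 → ℤ} {P : JetPoly} (hl : HasWeight l P) (h : polar 0 1 P = 0) :
    minorTwo 0 1 * omegaTwo 0 1 P + minorTwo 0 2 * omegaTwo 0 2 P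
      + minorTwo 1 2 * omegaTwo 1 2 P = ((l 1 : ℂ) * (l 0 + 1)) • P := by
  rw [minorTwo_mul_omegaTwo, normalTwo_eq, normalTwo_eq]
  simp [h, hl 0, hl 1, smul_smul]
  module

/-- The same cancellation for three vectors: all compositions ending in a raising operator vanish,
and the ordering corrections produce the shifts +1 and +2. The scalar is nonzero when l₂ > 0, l₁ ≥ 0
and l₀ ≥ 0 (indices from 0), which makes P divisible by the Wronskian. -/
lemma capelliThree {l : Fin 3 → ℤ} {P : JetPoly} (hl : HasWeight l P) (h : IsHighest P) :
    minorThree * omegaThree P = ((l 2 : ℂ) * (l 1 + 1) * (l 0 + 2)) • P := by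
  obtain ⟨h01, h02, h12⟩ := h
  rw [minorThree_mul_omegaThree]
  simp only [normalThree_eq, normalTwo_eq]
  simp [h01, h02, h12, hl 0, hl 1, hl 2, smul_smul]
  module

/-! ### Multihomogeneous components -/

/-- The weights of the variables for the multidegree. -/
def varWeight (a : Fin 3 × Fin 3) : Fin 3 → ℤ := Pi.single a.1 1

lemma weight_varWeight (s : Fin 3 × Fin 3 →₀ ℕ) (j : Fin 3) :
    Finsupp.weight varWeight s j = ∑ i, (s (j, i) : ℤ) := by
  rw [Finsupp.weight_apply, Finsupp.sum_fintype _ _ (by simp), Finset.sum_apply,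
    Fintype.sum_prod_type]
  simp only [varWeight, Pi.smul_apply, nsmul_eq_mul, Pi.single_apply, mul_ite, mul_one, mul_zero]
  rw [Finset.sum_comm]
  simp

lemma polar_self_monomial (j : Fin 3) (s : Fin 3 × Fin 3 →₀ ℕ) (a : ℂ) :
    polar j j (monomial s a) = ((∑ i, s (j, i) : ℕ) : ℂ) • monomial s a := by
  rw [polar_apply]
  simp only [X_mul_pderiv_monomial]
  rw [← Finset.sum_smul, Nat.cast_smul_eq_nsmul]

lemma coeff_polar_self (j : Fin 3) (s : Fin 3 × Fin 3 →₀ ℕ) (P : JetPoly) :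
    coeff s (polar j j P) = (∑ i, s (j, i) : ℕ) * coeff s P := by
  induction P using MvPolynomial.induction_on' with
  | monomial t a =>
    rw [polar_self_monomial, coeff_smul, coeff_monomial]
    split_ifs with h
    · rw [h, smul_eq_mul]
    · simp
  | add P Q hP hQ => rw [map_add, coeff_add, hP, hQ, coeff_add, mul_add]

lemma HasWeight.degree_eq {l : Fin 3 → ℤ} {P : JetPoly} (h : HasWeight l P)
    {s : Fin 3 × Fin 3 →₀ ℕ} (hs : coeff s P ≠ 0) (j : Fin 3) : ∑ i, (s (j, i) : ℤ) = l j := by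
  have h1 := congrArg (coeff s) (h j)
  rw [coeff_polar_self, coeff_smul, smul_eq_mul] at h1
  exact_mod_cast mul_right_cancel₀ hs h1

lemma hasWeight_of_isWeightedHomogeneous {l : Fin 3 → ℤ} {P : JetPoly}
    (h : IsWeightedHomogeneous varWeight P l) : HasWeight l P := by
  intro j
  ext s
  rw [coeff_polar_self, coeff_smul, smul_eq_mul]
  by_cases hs : coeff s P = 0
  · simp [hs]
  · rw [← h hs, weight_varWeight]
    push_cast
    rfl

lemma HasWeight.isWeightedHomogeneous {l : Fin 3 → ℤ} {P : JetPoly} (h : HasWeight l P) :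
    IsWeightedHomogeneous varWeight P l := fun s hs => by
  ext j
  rw [weight_varWeight, h.degree_eq hs]

/-- The component of multidegree `l`. -/
def comp (l : Fin 3 → ℤ) : JetPoly →ₗ[ℂ] JetPoly := weightedHomogeneousComponent varWeight l

lemma coeff_comp (l : Fin 3 → ℤ) (P : JetPoly) (s : Fin 3 × Fin 3 →₀ ℕ) [Decidable
    (∀ j, ∑ i, (s (j, i) : ℤ) = l j)] :
    coeff s (comp l P) = if ∀ j, ∑ i, (s (j, i) : ℤ) = l j then coeff s P else 0 := by
  classical
  rw [comp, coeff_weightedHomogeneousComponent]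
  simp only [funext_iff, weight_varWeight]

lemma hasWeight_comp (l : Fin 3 → ℤ) (P : JetPoly) : HasWeight l (comp l P) :=
  hasWeight_of_isWeightedHomogeneous (weightedHomogeneousComponent_isWeightedHomogeneous ..)

lemma HasWeight.comp_same {l : Fin 3 → ℤ} {P : JetPoly} (h : HasWeight l P) : comp l P = P :=
  h.isWeightedHomogeneous.weightedHomogeneousComponent_same

/-- Integer multidegrees make the shift caused by a polarization meaningful without side conditions.
The vanishing in negative degree is then what makes off-diagonal polarizations locally nilpotent. -/
lemma comp_eq_zero_of_neg {l : Fin 3 → ℤ} {j : Fin 3} (hj : l j < 0) (P : JetPoly) :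
    comp l P = 0 := by
  classical
  ext s
  rw [coeff_comp, coeff_zero, if_neg]
  intro h
  have : 0 ≤ ∑ i, (s (j, i) : ℤ) := Finset.sum_nonneg fun i _ => by positivity
  have := h j
  omega

lemma polar_isWeightedHomogeneous {l : Fin 3 → ℤ} {P : JetPoly}
    (h : IsWeightedHomogeneous varWeight P l) (a b : Fin 3) :
    IsWeightedHomogeneous varWeight (polar a b P) (l + Pi.single a 1 - Pi.single b 1) := by
  rw [polar_apply]
  refine IsWeightedHomogeneous.sum _ _ _ fun i _ => ?_
  have h1 : IsWeightedHomogeneous varWeight (pderiv (b, i) P) (l - Pi.single b 1) :=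
    h.pderiv (by simp [varWeight])
  convert (isWeightedHomogeneous_X ℂ varWeight (a, i)).mul h1 using 1
  simp only [varWeight]
  abel

lemma polar_comp (a b : Fin 3) (l : Fin 3 → ℤ) (P : JetPoly) :
    polar a b (comp l P) = comp (l + Pi.single a 1 - Pi.single b 1) (polar a b P) := by
  induction P using MvPolynomial.induction_on' with
  | monomial t r =>
    have h := isWeightedHomogeneous_monomial varWeight t r (m := Finsupp.weight varWeight t) rfl
    by_cases hl : l = Finsupp.weight varWeight t
    · subst hl
      rw [comp, comp, h.weightedHomogeneousComponent_same,
        (polar_isWeightedHomogeneous h a b).weightedHomogeneousComponent_same]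
    · rw [comp, comp, h.weightedHomogeneousComponent_ne _ hl,
        (polar_isWeightedHomogeneous h a b).weightedHomogeneousComponent_ne, map_zero]
      intro h1
      exact hl (by simpa using h1)
  | add P Q hP hQ => simp only [map_add, hP, hQ]

/-! ### Highest weight polynomials are generated by minors -/

lemma jetPoly_pderiv_comm (a b : Fin 3 × Fin 3) (P : JetPoly) :
    pderiv a (pderiv b P) = pderiv b (pderiv a P) := by
  have h : ⁅(pderiv a : Derivation ℂ JetPoly JetPoly),
      (pderiv b : Derivation ℂ JetPoly JetPoly)⁆ = 0 := by
    apply MvPolynomial.derivation_ext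
    intro c
    rw [Derivation.commutator_apply]
    by_cases h1 : c = a <;> by_cases h2 : c = b <;> simp_all [pderiv_X]
  have h1 := DFunLike.congr_fun h P
  rwa [Derivation.commutator_apply, Derivation.zero_apply, sub_eq_zero] at h1

lemma IsHighest.omegaThree {P : JetPoly} (h : IsHighest P) : IsHighest (omegaThree P) := by
  obtain ⟨h01, h02, h12⟩ := h
  refine ⟨?_, ?_, ?_⟩ <;>
    simp [_root_.omegaThree, polar_pderiv, h01, h02, h12] <;>
    simp only [jetPoly_pderiv_comm] <;> ring

lemma HasWeight.omegaThree {l : Fin 3 → ℤ} {P : JetPoly} (h : HasWeight l P) :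
    HasWeight (fun j => l j - 1) (omegaThree P) := by
  intro j
  have h0 := h 0
  have h1 := h 1
  have h2 := h 2
  fin_cases j <;> simp [_root_.omegaThree, polar_pderiv, h0, h1, h2] <;> module

lemma polar_omegaTwo {P : JetPoly} (h : polar 0 1 P = 0) (i j : Fin 3) :
    polar 0 1 (omegaTwo i j P) = 0 := by
  simp [omegaTwo, polar_pderiv, h]
  simp only [jetPoly_pderiv_comm]
  ring

lemma HasWeight.omegaTwo {l : Fin 3 → ℤ} {P : JetPoly} (h : HasWeight l P) (i j : Fin 3) :
    HasWeight ![l 0 - 1, l 1 - 1, l 2] (omegaTwo i j P) := by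
  intro k
  have h0 := h 0
  have h1 := h 1
  have h2 := h 2
  fin_cases k <;> simp [_root_.omegaTwo, polar_pderiv, h0, h1, h2] <;> module

lemma HasWeight.pderiv_zero {l : Fin 3 → ℤ} {P : JetPoly} (h : HasWeight l P) (i : Fin 3) :
    HasWeight ![l 0 - 1, l 1, l 2] (pderiv (0, i) P) := by
  intro k
  have h0 := h 0
  have h1 := h 1
  have h2 := h 2
  fin_cases k <;> simp [polar_pderiv, h0, h1, h2]
  module

/-- The span of the coordinates of `f'`. -/
def spanU : Submodule ℂ JetPoly := Submodule.span ℂ (Set.range fun i : Fin 3 => X (0, i))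

/-- The span of the coordinates of `f' ∧ f''`. -/
def spanM : Submodule ℂ JetPoly :=
  Submodule.span ℂ (Set.range fun a : Fin 3 × Fin 3 => minorTwo a.1 a.2)

/-- The span of the coordinates of `f' ∧ f'''`. -/
def spanN : Submodule ℂ JetPoly :=
  Submodule.span ℂ (Set.range fun a : Fin 3 × Fin 3 => minorTwo' a.1 a.2)

/-- The span of the Wronskian. -/
def spanD : Submodule ℂ JetPoly := Submodule.span ℂ {minorThree}

/-- The span of the products of `p` coordinates of `f'`, `q` coordinates of `f' ∧ f''` and the
`d`-th power of the Wronskian. -/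
def flagSpan (p q d : ℕ) : Submodule ℂ JetPoly := spanU ^ p * spanM ^ q * spanD ^ d

/-- Euler's identity writes (p + 1) P as the sum of X (0, i) times derivatives of P, which have
degree p. -/
lemma mem_flagSpan_zero_zero : ∀ (p : ℕ) {P : JetPoly}, HasWeight ![(p : ℤ), 0, 0] P →
    P ∈ flagSpan p 0 0 := by
  intro p
  induction p with
  | zero =>
    intro P hP
    have h : P = C (coeff 0 P) := by
      ext s
      rw [coeff_C]
      split_ifs with hs
      · rw [hs]
      · by_contra hc
        refine hs (Eq.symm (Finsupp.ext ?_))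
        rintro ⟨j, i⟩
        have h1 := hP.degree_eq hc j
        have h2 : ∑ i, s (j, i) = 0 := by
          have h3 : (![((0 : ℕ) : ℤ), 0, 0] : Fin 3 → ℤ) j = 0 := by fin_cases j <;> simp
          rw [h3] at h1
          exact_mod_cast h1
        simpa using Finset.sum_eq_zero_iff.1 h2 i (Finset.mem_univ i)
    rw [h]
    simp only [flagSpan, pow_zero, mul_one]
    exact Submodule.mem_one.2 ⟨coeff 0 P, rfl⟩
  | succ p ih =>
    intro P hP
    have h1 : P = ((p : ℂ) + 1)⁻¹ • ∑ i, X (0, i) * pderiv (0, i) P := by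
      rw [← polar_apply, hP 0, smul_smul]
      have : (p : ℂ) + 1 ≠ 0 := by exact_mod_cast Nat.succ_ne_zero p
      simp [this]
    rw [h1]
    refine Submodule.smul_mem _ _ (Submodule.sum_mem _ fun i _ => ?_)
    have h2 := ih (P := pderiv (0, i) P) (by simpa using hP.pderiv_zero i)
    simp only [flagSpan, pow_zero, mul_one] at h2 ⊢
    rw [pow_succ']
    exact Submodule.mul_mem_mul (Submodule.subset_span ⟨i, rfl⟩) h2

/-- Capelli's identity takes the place of Euler's: P is a multiple of the sum of minors times
`omegaTwo i j P`, and Cayley's operator preserves the equation `polar 0 1 P = 0` while lowering q by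
one. -/
lemma mem_flagSpan_zero (q : ℕ) : ∀ (p : ℕ) {P : JetPoly}, HasWeight ![(p + q : ℤ), q, 0] P →
    polar 0 1 P = 0 → P ∈ flagSpan p q 0 := by
  induction q with
  | zero =>
    intro p P hP _
    exact mem_flagSpan_zero_zero p (by simpa using hP)
  | succ q ih =>
    intro p P hP h
    have hne : ((q : ℂ) + 1) * ((p : ℂ) + (q + 1) + 1) ≠ 0 :=
      mul_ne_zero (by exact_mod_cast Nat.succ_ne_zero q)
        (by exact_mod_cast (by omega : p + (q + 1) + 1 ≠ 0))
    have h1 := capelliTwo hP h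
    simp at h1
    have h2 : P = (((q : ℂ) + 1) * ((p : ℂ) + (q + 1) + 1))⁻¹ •
      (minorTwo 0 1 * omegaTwo 0 1 P + minorTwo 0 2 * omegaTwo 0 2 P
      + minorTwo 1 2 * omegaTwo 1 2 P) := by
      rw [h1, smul_smul, inv_mul_cancel₀ hne, one_smul]
    have h3 : ∀ i j, minorTwo i j * omegaTwo i j P ∈ flagSpan p (q + 1) 0 := by
      intro i j
      have h4 := ih p (P := omegaTwo i j P) (by
        convert hP.omegaTwo i j using 2
        · simp; ring
        · simp) (polar_omegaTwo h i j)
      simp only [flagSpan, pow_zero, mul_one] at h4 ⊢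
      rw [pow_succ', mul_left_comm]
      exact Submodule.mul_mem_mul (Submodule.subset_span ⟨(i, j), rfl⟩) h4
    rw [h2]
    exact Submodule.smul_mem _ _ (add_mem (add_mem (h3 _ _) (h3 _ _)) (h3 _ _))

/-- A highest weight polynomial is a combination of products of minors. -/
lemma mem_flagSpan_of_isHighest (p q d : ℕ) : ∀ {P : JetPoly},
    HasWeight ![(p + q + d : ℤ), q + d, d] P → IsHighest P → P ∈ flagSpan p q d := by
  induction d with
  | zero =>
    intro P hP h
    exact mem_flagSpan_zero q p (by simpa using hP) h.1
  | succ d ih =>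
    intro P hP h
    -- The scalar of `capelliThree` at this weight. As it is nonzero, P is a multiple of the
    -- Wronskian times `omegaThree P`, which is again of highest weight, with d lowered by one.
    have hne : ((d : ℂ) + 1) * ((q : ℂ) + (d + 1) + 1) * ((p : ℂ) + q + (d + 1) + 2) ≠ 0 :=
      mul_ne_zero (mul_ne_zero (by exact_mod_cast Nat.succ_ne_zero d)
        (by exact_mod_cast (by omega : q + (d + 1) + 1 ≠ 0)))
        (by exact_mod_cast (by omega : p + q + (d + 1) + 2 ≠ 0))
    have h1 := capelliThree hP h
    simp at h1
    have h2 : P = (((d : ℂ) + 1) * ((q : ℂ) + (d + 1) + 1) * ((p : ℂ) + q + (d + 1) + 2))⁻¹ •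
        (minorThree * omegaThree P) := by
      rw [h1, smul_smul, inv_mul_cancel₀ hne, one_smul]
    rw [h2]
    refine Submodule.smul_mem _ _ ?_
    have h4 := ih (P := omegaThree P) (by
      intro j
      have := hP.omegaThree j
      rw [this]
      fin_cases j <;> simp <;> ring_nf) h.omegaThree
    simp only [flagSpan] at h4 ⊢
    rw [pow_succ', mul_left_comm]
    exact Submodule.mul_mem_mul (Submodule.subset_span rfl) h4

/-! ### Leading forms for the order of multidegrees -/

lemma colex_lt_iff (a b : Fin 3 → ℕ) : toColex a < toColex b ↔
    a 2 < b 2 ∨ (a 2 = b 2 ∧ (a 1 < b 1 ∨ (a 1 = b 1 ∧ a 0 < b 0))) := by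
  constructor
  · rintro ⟨i, h1, h2⟩
    fin_cases i
    · exact Or.inr ⟨h1 2 (by decide), Or.inr ⟨h1 1 (by decide), h2⟩⟩
    · exact Or.inr ⟨h1 2 (by decide), Or.inl h2⟩
    · exact Or.inl h2
  · rintro (h | ⟨h, h' | ⟨h', h''⟩⟩)
    · exact ⟨2, fun j hj => absurd hj (by revert j; decide), h⟩
    · refine ⟨1, fun j hj => ?_, h'⟩
      have : j = 2 := by revert j; decide
      subst this
      exact h
    · refine ⟨0, fun j hj => ?_, h''⟩
      have : j = 1 ∨ j = 2 := by revert j; decide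
      rcases this with rfl | rfl
      · exact h'
      · exact h

lemma colex_le_iff (a b : Fin 3 → ℕ) : toColex a ≤ toColex b ↔ toColex a < toColex b ∨ a = b := by
  rw [le_iff_lt_or_eq]
  rfl

/-- The polynomials all of whose monomials have multidegree at most `l`. -/
def upTo (l : Fin 3 → ℕ) : Submodule ℂ JetPoly :=
  restrictSupport ℂ {s | multidegree s ≤ toColex l}

/-- The polynomials all of whose monomials have multidegree less than `l`. -/
def below (l : Fin 3 → ℕ) : Submodule ℂ JetPoly :=
  restrictSupport ℂ {s | multidegree s < toColex l}

lemma mem_upTo {l : Fin 3 → ℕ} {P : JetPoly} :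
    P ∈ upTo l ↔ ∀ s, coeff s P ≠ 0 → multidegree s ≤ toColex l := by
  rw [upTo, mem_restrictSupport_iff]
  simp [Set.subset_def]

lemma mem_below {l : Fin 3 → ℕ} {P : JetPoly} :
    P ∈ below l ↔ ∀ s, coeff s P ≠ 0 → multidegree s < toColex l := by
  rw [below, mem_restrictSupport_iff]
  simp [Set.subset_def]

lemma below_le_upTo (l : Fin 3 → ℕ) : below l ≤ upTo l :=
  fun _ h => mem_upTo.2 fun s hs => (mem_below.1 h s hs).le

lemma multidegree_eq (s : Fin 3 × Fin 3 →₀ ℕ) :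
    multidegree s = toColex (fun j => ∑ i, s (j, i)) := rfl

lemma multidegree_add (s t : Fin 3 × Fin 3 →₀ ℕ) :
    multidegree (s + t) = toColex (ofColex (multidegree s) + ofColex (multidegree t)) := by
  rw [multidegree_eq, multidegree_eq, multidegree_eq]
  congr 1
  ext j
  simp [Finset.sum_add_distrib]

lemma colex_add_lt {a b c d : Fin 3 → ℕ} (h : toColex a < toColex b) (h' : toColex c ≤ toColex d) :
    toColex (a + c) < toColex (b + d) := by
  rw [colex_le_iff] at h'
  rcases h' with h' | rfl
  · rw [colex_lt_iff] at *
    simp only [Pi.add_apply]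
    omega
  · rw [colex_lt_iff] at *
    simp only [Pi.add_apply]
    omega

/-- The order of multidegrees is strictly compatible with addition, so a product with one strictly
lower factor is strictly lower. -/
lemma below_mul_upTo (l l' : Fin 3 → ℕ) : below l * upTo l' ≤ below (l + l') := by
  rw [below, upTo, ← restrictSupport_add]
  refine restrictSupport_mono _ ?_
  rintro _ ⟨s, hs, t, ht, rfl⟩
  simp only [Set.mem_ofPred_eq, multidegree_add] at *
  exact colex_add_lt hs ht

lemma upTo_mul_below (l l' : Fin 3 → ℕ) : upTo l * below l' ≤ below (l + l') := by
  rw [mul_comm, add_comm]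
  exact below_mul_upTo _ _

/-- The multidegree `l` with integer entries. -/
def intDeg (l : Fin 3 → ℕ) : Fin 3 → ℤ := fun j => l j

lemma HasWeight.multidegree_eq {l : Fin 3 → ℕ} {P : JetPoly} (h : HasWeight (intDeg l) P)
    {s : Fin 3 × Fin 3 →₀ ℕ} (hs : coeff s P ≠ 0) : multidegree s = toColex l := by
  rw [_root_.multidegree_eq]
  congr 1
  ext j
  have h1 := h.degree_eq hs j
  rw [intDeg] at h1
  exact_mod_cast h1

lemma HasWeight.mem_upTo {l : Fin 3 → ℕ} {P : JetPoly} (h : HasWeight (intDeg l) P) :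
    P ∈ upTo l := _root_.mem_upTo.2 fun _ hs => (h.multidegree_eq hs).le

lemma HasWeight.mem_below {l l' : Fin 3 → ℕ} {P : JetPoly} (h : HasWeight (intDeg l) P)
    (hl : toColex l < toColex l') : P ∈ below l' :=
  _root_.mem_below.2 fun _ hs => (h.multidegree_eq hs).trans_lt hl

lemma HasWeight.mul {l l' : Fin 3 → ℤ} {P Q : JetPoly} (h : HasWeight l P) (h' : HasWeight l' Q) :
    HasWeight (l + l') (P * Q) :=
  hasWeight_of_isWeightedHomogeneous (h.isWeightedHomogeneous.mul h'.isWeightedHomogeneous)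

lemma HasWeight.add {l : Fin 3 → ℤ} {P Q : JetPoly} (h : HasWeight l P) (h' : HasWeight l Q) :
    HasWeight l (P + Q) := fun j => by rw [map_add, h j, h' j, smul_add]

lemma HasWeight.smul {l : Fin 3 → ℤ} {P : JetPoly} (h : HasWeight l P) (a : ℂ) :
    HasWeight l (a • P) := fun j => by rw [Derivation.map_smul, h j, smul_comm]

lemma hasWeight_zero (l : Fin 3 → ℤ) : HasWeight l 0 := fun j => by simp

/-- `P` is the part of multidegree `l` of `Q`, whose other monomials are of lower multidegree. -/
def LeadsTo (l : Fin 3 → ℕ) (P Q : JetPoly) : Prop := HasWeight (intDeg l) P ∧ Q - P ∈ below l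

namespace LeadsTo

variable {l l' : Fin 3 → ℕ} {P Q P' Q' : JetPoly}

lemma mem_upTo (h : LeadsTo l P Q) : Q ∈ upTo l := by
  have := add_mem (below_le_upTo l h.2) h.1.mem_upTo
  rwa [sub_add_cancel] at this

lemma mul (h : LeadsTo l P Q) (h' : LeadsTo l' P' Q') : LeadsTo (l + l') (P * P') (Q * Q') := by
  refine ⟨?_, ?_⟩
  · convert h.1.mul h'.1 using 1
    ext j
    simp [intDeg]
  · have h1 : Q * Q' - P * P' = (Q - P) * Q' + P * (Q' - P') := by ring
    rw [h1]
    exact add_mem (below_mul_upTo _ _ (Submodule.mul_mem_mul h.2 h'.mem_upTo))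
      (upTo_mul_below _ _ (Submodule.mul_mem_mul h.1.mem_upTo h'.2))

lemma add (h : LeadsTo l P Q) (h' : LeadsTo l P' Q') : LeadsTo l (P + P') (Q + Q') :=
  ⟨h.1.add h'.1, by simpa [add_sub_add_comm] using add_mem h.2 h'.2⟩

lemma smul (h : LeadsTo l P Q) (a : ℂ) : LeadsTo l (a • P) (a • Q) :=
  ⟨h.1.smul a, by simpa [smul_sub] using Submodule.smul_mem _ a h.2⟩

lemma zero (l : Fin 3 → ℕ) : LeadsTo l 0 0 := ⟨hasWeight_zero _, by simp⟩

lemma of_hasWeight (h : HasWeight (intDeg l) P) : LeadsTo l P P := ⟨h, by simp⟩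

lemma one : LeadsTo 0 1 1 := of_hasWeight fun j => by simp [intDeg]

/-- Hence Q determines its leading form, so passing to leading forms can be a linear map. -/
lemma comp_eq (h : LeadsTo l P Q) : comp (intDeg l) Q = P := by
  classical
  have h1 : comp (intDeg l) (Q - P) = 0 := by
    ext s
    rw [coeff_comp, coeff_zero, ite_eq_right_iff]
    intro hs
    by_contra hne
    have h2 := mem_below.1 h.2 s hne
    rw [_root_.multidegree_eq, colex_lt_iff] at h2
    have h3 : ∀ j, ∑ i, s (j, i) = l j := fun j => by
      have h4 := hs j
      rw [intDeg] at h4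
      exact_mod_cast h4
    rw [h3, h3, h3] at h2
    omega
  rw [map_sub, sub_eq_zero, h.1.comp_same] at h1
  exact h1

end LeadsTo

lemma leadsTo_comp {l : Fin 3 → ℕ} {Q : JetPoly} (h : Q ∈ upTo l) :
    LeadsTo l (comp (intDeg l) Q) Q := by
  classical
  refine ⟨hasWeight_comp _ _, mem_below.2 fun s hs => ?_⟩
  rw [coeff_sub, coeff_comp] at hs
  split_ifs at hs with h1
  · simp at hs
  · rw [sub_zero] at hs
    refine lt_of_le_of_ne (mem_upTo.1 h s hs) fun h2 => h1 fun j => ?_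
    have h3 := congrFun h2 j
    rw [intDeg]
    exact_mod_cast h3

/-- An element of `upTo l` whose component of multidegree `l` vanishes lies in `below l`. -/
lemma mem_below_of_comp_eq_zero {l : Fin 3 → ℕ} {Q : JetPoly} (h : Q ∈ upTo l)
    (h0 : comp (intDeg l) Q = 0) : Q ∈ below l := by
  have := (leadsTo_comp h).2
  rwa [h0, sub_zero] at this

lemma comp_eq_zero_of_mem_below {l : Fin 3 → ℕ} {Q : JetPoly} (h : Q ∈ below l) :
    comp (intDeg l) Q = 0 :=
  LeadsTo.comp_eq ⟨hasWeight_zero _, by simpa using h⟩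

/-- The degree in f''' is compared first, so a bound on the multidegree bounds it whatever the other
two degrees are. -/
lemma comp_eq_zero_of_mem_upTo {l : Fin 3 → ℕ} {l' : Fin 3 → ℤ} {Q : JetPoly} (h : Q ∈ upTo l)
    (hl : (l 2 : ℤ) < l' 2) : comp l' Q = 0 := by
  classical
  ext s
  rw [coeff_comp, coeff_zero, ite_eq_right_iff]
  intro hs
  by_contra hne
  have h2 := mem_upTo.1 h s hne
  rw [multidegree_eq, colex_le_iff, colex_lt_iff] at h2
  have h4 : ∑ i, s (2, i) ≤ l 2 := by
    rcases h2 with h2 | h2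
    · omega
    · exact (congrFun h2 2).le
  have h3 := hs 2
  have h5 : ((∑ i, s (2, i) : ℕ) : ℤ) ≤ l 2 := by exact_mod_cast h4
  push_cast at h5
  omega

/-! ### Invariant polynomials -/

/-- The action on `3`-jets of a change of parameter with derivatives `a, b, c` at `0`. -/
def reparamJet (a b c : ℂ) (x : Fin 3 × Fin 3 → ℂ) : Fin 3 × Fin 3 → ℂ := fun t =>
  (![a * x (0, t.2), a ^ 2 * x (1, t.2) + b * x (0, t.2),
    a ^ 3 * x (2, t.2) + 3 * a * b * x (1, t.2) + c * x (0, t.2)] : Fin 3 → ℂ) t.1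

/-- The polynomials that are multiplied by `φ' ^ m` under a change of parameter `φ`. -/
def invPoly (m : ℕ) : Submodule ℂ JetPoly where
  carrier := {p | ∀ a b c : ℂ, a ≠ 0 → ∀ x, eval (reparamJet a b c x) p = a ^ m * eval x p}
  zero_mem' := by simp
  add_mem' := fun hp hq a b c ha x => by rw [map_add, map_add, hp a b c ha, hq a b c ha, mul_add]
  smul_mem' := fun r p hp a b c ha x => by
    rw [smul_eval, smul_eval, hp a b c ha]; ring

lemma mul_mem_invPoly {m m' : ℕ} {p q : JetPoly} (hp : p ∈ invPoly m) (hq : q ∈ invPoly m') :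
    p * q ∈ invPoly (m + m') := fun a b c ha x => by
  rw [map_mul, map_mul, hp a b c ha, hq a b c ha]; ring

lemma one_mem_invPoly : (1 : JetPoly) ∈ invPoly 0 := fun a b c ha x => by simp

lemma hasDerivAt_eval_line (p : JetPoly) (x y : Fin 3 × Fin 3 → ℂ) :
    HasDerivAt (fun s : ℂ => eval (fun t => x t + s * y t) p)
      (∑ t, y t * eval x (pderiv t p)) 0 := by
  induction p using MvPolynomial.induction_on with
  | C a => simpa using hasDerivAt_const (0 : ℂ) a
  | add p q hp hq =>
    have h : (fun s : ℂ => eval (fun t => x t + s * y t) (p + q)) =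
        (fun s => eval (fun t => x t + s * y t) p) + fun s => eval (fun t => x t + s * y t) q := by
      ext s
      simp
    rw [h]
    refine (hp.add hq).congr_deriv ?_
    simp [mul_add, Finset.sum_add_distrib]
  | mul_X p t hp =>
    have h : (fun s : ℂ => eval (fun t => x t + s * y t) (p * X t)) =
        (fun s => eval (fun t => x t + s * y t) p) * fun s => x t + s * y t := by
      ext s
      simp
    rw [h]
    have h1 : HasDerivAt (fun s : ℂ => x t + s * y t) (y t) 0 := by
      simpa using ((hasDerivAt_id (0 : ℂ)).mul_const (y t)).const_add (x t)
    refine (hp.mul h1).congr_deriv ?_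
    simp only [Derivation.leibniz, smul_eq_mul, map_add, map_mul, eval_X, pderiv_X, mul_add,
      Finset.sum_add_distrib, zero_mul, add_zero]
    have h2 : ∑ i, y i * (eval x p * eval x ((Pi.single i 1 : Fin 3 × Fin 3 → JetPoly) t)) =
        eval x p * y t := by
      rw [Finset.sum_eq_single t]
      · simp [mul_comm]
      · intro b _ hb
        simp [hb.symm]
      · simp
    have h3 : ∑ i, y i * (x t * eval x (pderiv i p)) =
        (∑ i, y i * eval x (pderiv i p)) * x t := by
      rw [Finset.sum_mul]
      exact Finset.sum_congr rfl fun i _ => by ring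
    rw [h2, h3, add_comm]

/-- A change of parameter with φ' = 1, φ'' = 0, φ''' = s adds s f' to f'''. The derivative of the
invariance at s = 0 is this equation. -/
lemma polar_zero_two_of_mem_invPoly {m : ℕ} {p : JetPoly} (hp : p ∈ invPoly m) :
    polar 0 2 p = 0 := by
  refine MvPolynomial.funext fun x => ?_
  have h := hasDerivAt_eval_line p x (fun t => if t.1 = 2 then x (0, t.2) else 0)
  have h1 : ∀ s : ℂ, eval (fun t => x t + s * if t.1 = 2 then x (0, t.2) else 0) p = eval x p := by
    intro s
    have h2 := hp 1 0 s one_ne_zero x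
    rw [one_pow, one_mul] at h2
    rw [← h2]
    congr 2
    ext ⟨j, i⟩
    fin_cases j <;> simp [reparamJet]
  simp only [h1] at h
  have h3 := h.unique (hasDerivAt_const _ _)
  rw [map_zero, ← h3, polar_apply, map_sum, Fintype.sum_prod_type]
  simp [Fin.sum_univ_three]

/-- A change of parameter with φ' = 1, φ'' = s, φ''' = 0 adds s f' to f'' and 3 s f'' to f'''. The
derivative at s = 0 gives `polar 0 1 p + 3 polar 1 2 p = 0`. -/
lemma polar_zero_one_of_mem_invPoly {m : ℕ} {p : JetPoly} (hp : p ∈ invPoly m) :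
    polar 0 1 p = (-3 : ℂ) • polar 1 2 p := by
  refine MvPolynomial.funext fun x => ?_
  have h := hasDerivAt_eval_line p x (fun t => ![0, x (0, t.2), 3 * x (1, t.2)] t.1)
  have h1 : ∀ s : ℂ,
      eval (fun t => x t + s * (![0, x (0, t.2), 3 * x (1, t.2)] : Fin 3 → ℂ) t.1) p = eval x p := by
    intro s
    have h2 := hp 1 s 0 one_ne_zero x
    rw [one_pow, one_mul] at h2
    rw [← h2]
    congr 2
    ext ⟨j, i⟩
    fin_cases j <;> simp [reparamJet]
    ring
  simp only [h1] at h
  have h3 := h.unique (hasDerivAt_const _ _)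
  rw [polar_apply, polar_apply, smul_eval, map_sum, map_sum]
  rw [Fintype.sum_prod_type] at h3
  simp [Fin.sum_univ_three] at h3 ⊢
  linear_combination h3

/-- The dilation by 2 multiplies each monomial by 2 to the power of its weight, and also multiplies
p by 2^m; the weight is recovered since powers of 2 are distinct. This gives finite dimensionality
later. -/
lemma weight_eq_of_mem_invPoly {m : ℕ} {p : JetPoly} (hp : p ∈ invPoly m)
    {s : Fin 3 × Fin 3 →₀ ℕ} (hs : coeff s p ≠ 0) :
    Finsupp.weight (fun t : Fin 3 × Fin 3 => (t.1 : ℕ) + 1) s = m := by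
  let φ : JetPoly →ₐ[ℂ] JetPoly :=
    aeval fun t : Fin 3 × Fin 3 => C ((2 : ℂ) ^ ((t.1 : ℕ) + 1)) * X t
  have hφ : ∀ (q : JetPoly) (s), coeff s (φ q) =
      2 ^ (Finsupp.weight (fun t : Fin 3 × Fin 3 => (t.1 : ℕ) + 1) s) * coeff s q := by
    intro q s
    induction q using MvPolynomial.induction_on' with
    | monomial t a =>
      have h1 : φ (monomial t a) =
          C (2 ^ (Finsupp.weight (fun t : Fin 3 × Fin 3 => (t.1 : ℕ) + 1) t)) * monomial t a := by
        rw [aeval_monomial, monomial_eq, Finsupp.weight_apply, Finsupp.prod, Finsupp.prod,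
          Finsupp.sum]
        simp only [mul_pow, Finset.prod_mul_distrib, ← C_pow, ← map_prod C]
        simp only [← pow_mul, Finset.prod_pow_eq_pow_sum, smul_eq_mul, mul_comm, algebraMap_eq]
        ring
      rw [h1, coeff_C_mul, coeff_monomial]
      split_ifs with h
      · rw [h]
      · simp
    | add p q hp hq => simp only [map_add, coeff_add, hp, hq, mul_add]
  have h1 : φ p = C (2 ^ m) * p := by
    refine MvPolynomial.funext fun x => ?_
    have h2 := hp 2 0 0 two_ne_zero x
    rw [map_mul, eval_C, ← h2, ← coe_aeval_eq_eval, ← coe_aeval_eq_eval]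
    change ((aeval x).comp φ) p = _
    have h3 : (aeval x).comp φ = aeval (reparamJet 2 0 0 x) := by
      apply algHom_ext
      rintro ⟨j, i⟩
      fin_cases j <;> simp [φ, reparamJet]
    rw [h3]
    rfl
  have h2 := congrArg (coeff s) h1
  rw [hφ, coeff_C_mul] at h2
  have h3 := mul_right_cancel₀ hs h2
  exact Nat.pow_right_injective le_rfl (by exact_mod_cast h3)

/-- The leading forms of multidegree `l` of the invariant polynomials of degree `m`. -/
def leadForms (m : ℕ) (l : Fin 3 → ℕ) : Submodule ℂ JetPoly where
  carrier := {P | ∃ Q ∈ invPoly m, LeadsTo l P Q}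
  zero_mem' := ⟨0, zero_mem _, LeadsTo.zero l⟩
  add_mem' := by
    rintro P P' ⟨Q, hQ, h⟩ ⟨Q', hQ', h'⟩
    exact ⟨Q + Q', add_mem hQ hQ', h.add h'⟩
  smul_mem' := by
    rintro a P ⟨Q, hQ, h⟩
    exact ⟨a • Q, Submodule.smul_mem _ a hQ, h.smul a⟩

lemma leadForms_mul_le (m m' : ℕ) (l l' : Fin 3 → ℕ) :
    leadForms m l * leadForms m' l' ≤ leadForms (m + m') (l + l') := by
  rw [Submodule.mul_le]
  rintro P ⟨Q, hQ, h⟩ P' ⟨Q', hQ', h'⟩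
  exact ⟨Q * Q', mul_mem_invPoly hQ hQ', h.mul h'⟩

lemma mul_le_leadForms {S S' : Submodule ℂ JetPoly} {m m' : ℕ} {l l' : Fin 3 → ℕ}
    (h : S ≤ leadForms m l) (h' : S' ≤ leadForms m' l') :
    S * S' ≤ leadForms (m + m') (l + l') :=
  (mul_le_mul' h h').trans (leadForms_mul_le m m' l l')

lemma pow_le_leadForms {S : Submodule ℂ JetPoly} {m : ℕ} {l : Fin 3 → ℕ}
    (h : S ≤ leadForms m l) (n : ℕ) : S ^ n ≤ leadForms (n * m) (n • l) := by
  induction n with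
  | zero =>
    rw [pow_zero, Submodule.one_le, zero_mul, zero_smul]
    exact ⟨1, one_mem_invPoly, LeadsTo.one⟩
  | succ n ih =>
    rw [pow_succ, add_mul, one_mul, add_smul, one_smul]
    exact mul_le_leadForms ih h

lemma spanU_le_leadForms : spanU ≤ leadForms 1 ![1, 0, 0] := by
  rw [spanU, Submodule.span_le]
  rintro _ ⟨i, rfl⟩
  refine ⟨X (0, i), fun a b c _ x => by simp [reparamJet], LeadsTo.of_hasWeight fun j => ?_⟩
  fin_cases j <;> simp [intDeg]

lemma hasWeight_minorTwo (i j : Fin 3) : HasWeight (intDeg ![1, 1, 0]) (minorTwo i j) := by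
  intro k
  fin_cases k <;> simp [intDeg, minorTwo]
  all_goals ring

lemma spanM_le_leadForms : spanM ≤ leadForms 3 ![1, 1, 0] := by
  rw [spanM, Submodule.span_le]
  rintro _ ⟨⟨i, j⟩, rfl⟩
  refine ⟨minorTwo i j, fun a b c _ x => ?_, LeadsTo.of_hasWeight (hasWeight_minorTwo i j)⟩
  simp [minorTwo, reparamJet]
  ring

lemma spanD_le_leadForms : spanD ≤ leadForms 6 ![1, 1, 1] := by
  rw [spanD, Submodule.span_le]
  rintro _ rfl
  refine ⟨minorThree, fun a b c _ x => ?_, LeadsTo.of_hasWeight fun k => ?_⟩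
  · simp [minorThree, minorTwo, reparamJet]
    ring
  · fin_cases k <;> simp [intDeg, minorThree, minorTwo] <;> ring

/-- A change of parameter adds 3 φ'² φ'' f' ∧ f'' to φ'⁴ f' ∧ f''', so f' ∧ f''' alone is not
invariant. After multiplication by f'_k, the subtraction of 3 f''_k (f' ∧ f'') cancels this term,
because f''_k itself acquires φ'' f'_k. The correction has no f''' and is therefore lower. -/
lemma spanU_mul_spanN_le_leadForms : spanU * spanN ≤ leadForms 5 ![2, 0, 1] := by
  rw [spanU, spanN, Submodule.span_mul_span, Submodule.span_le]
  rintro _ ⟨_, ⟨k, rfl⟩, _, ⟨⟨i, j⟩, rfl⟩, rfl⟩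
  refine ⟨X (0, k) * minorTwo' i j - (3 : ℂ) • (X (1, k) * minorTwo i j),
    fun a b c _ x => ?_, ?_, ?_⟩
  · simp [minorTwo', minorTwo, reparamJet, smul_eval]
    ring
  · intro t
    fin_cases t <;> simp [intDeg, minorTwo']
    all_goals ring_nf
    rw [smul_eq_C_mul, map_ofNat C 2]
    ring
  · have h : HasWeight (intDeg ![1, 2, 0]) (X (1, k) * minorTwo i j) := by
      have h1 : HasWeight (intDeg ![0, 1, 0]) (X (1, k)) := by
        intro t
        fin_cases t <;> simp [intDeg]
      convert h1.mul (hasWeight_minorTwo i j) using 1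
      ext t
      fin_cases t <;> simp [intDeg]
    have h2 := Submodule.smul_mem _ (-3 : ℂ) (h.mem_below (l' := ![2, 0, 1]) (by
      rw [colex_lt_iff]; simp))
    convert h2 using 1
    simp

/-! ### Leading forms obtained by polarization -/

/-- The polarization operator `polar a b` as an endomorphism. -/
def polarEnd (a b : Fin 3) : Module.End ℂ JetPoly := (polar a b).toLinearMap

@[simp]
lemma polarEnd_apply (a b : Fin 3) (P : JetPoly) : polarEnd a b P = polar a b P := rfl

section Derivation

variable {D : Derivation ℂ JetPoly JetPoly} {S T T' : Submodule ℂ JetPoly}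

lemma derivation_mul_mem (hS : ∀ x ∈ S, D x = 0) (hT : ∀ x ∈ T, D x ∈ T') :
    ∀ x ∈ S * T, D x ∈ S * T' := by
  intro x hx
  induction hx using Submodule.mul_induction_on' with
  | mem_mul_mem a ha b hb =>
    rw [Derivation.leibniz, hS a ha, smul_zero, add_zero]
    exact Submodule.mul_mem_mul ha (hT b hb)
  | add x _ y _ hx hy => rw [map_add]; exact add_mem hx hy

lemma derivation_pow_eq_zero (hS : ∀ x ∈ S, D x = 0) (n : ℕ) : ∀ x ∈ S ^ n, D x = 0 := by
  induction n with
  | zero =>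
    intro x hx
    rw [pow_zero] at hx
    obtain ⟨a, rfl⟩ := Submodule.mem_one.1 hx
    exact D.map_algebraMap a
  | succ n ih =>
    intro x hx
    rw [pow_succ'] at hx
    have := derivation_mul_mem (T' := ⊥) hS (fun y hy => (Submodule.mem_bot ℂ).2 (ih y hy)) x hx
    simpa using this

lemma derivation_pow_succ_mem (hS : ∀ x ∈ S, D x ∈ T) (n : ℕ) :
    ∀ x ∈ S ^ (n + 1), D x ∈ T * S ^ n := by
  induction n with
  | zero => simpa using hS
  | succ n ih =>
    intro x hx
    rw [pow_succ'] at hx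
    induction hx using Submodule.mul_induction_on' with
    | mem_mul_mem a ha b hb =>
      rw [Derivation.leibniz, smul_eq_mul, smul_eq_mul]
      refine add_mem ?_ ?_
      · rw [pow_succ', mul_left_comm]
        exact Submodule.mul_mem_mul ha (ih b hb)
      · rw [mul_comm T]
        exact Submodule.mul_mem_mul hb (hS a ha)
    | add x _ y _ hx hy => rw [map_add]; exact add_mem hx hy

lemma derivation_span_eq_zero {ι : Type*} {g : ι → JetPoly} (h : ∀ i, D (g i) = 0) :
    ∀ x ∈ Submodule.span ℂ (Set.range g), D x = 0 := by
  intro x hx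
  have h1 : Submodule.span ℂ (Set.range g) ≤ LinearMap.ker D.toLinearMap := by
    rw [Submodule.span_le]
    rintro _ ⟨i, rfl⟩
    exact h i
  exact h1 hx

end Derivation

/-- As a derivation, `polar 2 1` kills f', f' ∧ f''' and the Wronskian (two of whose rows become
equal) and sends f' ∧ f'' to f' ∧ f'''. So c applications convert exactly c factors. -/
lemma polar_two_one_pow_mem {p q d c : ℕ} (hc : c ≤ q) {P : JetPoly} (hP : P ∈ flagSpan p q d) :
    ((polarEnd 2 1) ^ c) P ∈ spanU ^ p * spanD ^ d * (spanN ^ c * spanM ^ (q - c)) := by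
  have hU : ∀ x ∈ spanU, polar 2 1 x = 0 := derivation_span_eq_zero (by simp)
  have hN : ∀ x ∈ spanN, polar 2 1 x = 0 :=
    derivation_span_eq_zero (by simp [minorTwo'])
  have hD : ∀ x ∈ spanD, polar 2 1 x = 0 := by
    intro x hx
    obtain ⟨a, rfl⟩ := Submodule.mem_span_singleton.1 hx
    have : polar 2 1 minorThree = 0 := by
      simp [minorThree, minorTwo]
      ring
    rw [Derivation.map_smul, this, smul_zero]
  have hM : ∀ x ∈ spanM, polar 2 1 x ∈ spanN := by
    intro x hx
    induction hx using Submodule.span_induction with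
    | mem x hx =>
      obtain ⟨⟨i, j⟩, rfl⟩ := hx
      refine Submodule.subset_span ⟨(i, j), ?_⟩
      simp [minorTwo, minorTwo']
    | zero => simp
    | add x y _ _ hx hy => rw [map_add]; exact add_mem hx hy
    | smul a x _ hx => rw [Derivation.map_smul]; exact Submodule.smul_mem _ a hx
  have hUD : ∀ x ∈ spanU ^ p * spanD ^ d, polar 2 1 x = 0 := fun x hx => by
    simpa using derivation_mul_mem (T' := ⊥) (derivation_pow_eq_zero hU p)
      (fun y hy => (Submodule.mem_bot ℂ).2 (derivation_pow_eq_zero hD d y hy)) x hx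
  induction c with
  | zero =>
    simp only [pow_zero, Module.End.one_apply, one_mul, Nat.sub_zero]
    rwa [mul_right_comm]
  | succ c ih =>
    rw [pow_succ' (polarEnd 2 1), Module.End.mul_apply, polarEnd_apply]
    refine derivation_mul_mem hUD ?_ _ (ih (by omega))
    have h1 : spanN ^ (c + 1) * spanM ^ (q - (c + 1)) =
        spanN ^ c * (spanN * spanM ^ (q - (c + 1))) := by rw [pow_succ, mul_assoc]
    rw [h1]
    refine derivation_mul_mem (derivation_pow_eq_zero hN c) ?_
    have h2 : q - c = q - (c + 1) + 1 := by omega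
    rw [h2]
    exact derivation_pow_succ_mem hM _

lemma flagSpan_le_leadForms (p q d : ℕ) :
    flagSpan p q d ≤ leadForms (p + 3 * q + 6 * d) ![p + q + d, q + d, d] := by
  have h := mul_le_leadForms (mul_le_leadForms (pow_le_leadForms spanU_le_leadForms p)
    (pow_le_leadForms spanM_le_leadForms q)) (pow_le_leadForms spanD_le_leadForms d)
  convert h using 2
  · rfl
  · ring
  · ext j
    fin_cases j <;> simp

lemma hasWeight_of_mem_flagSpan {p q d : ℕ} {P : JetPoly} (h : P ∈ flagSpan p q d) :
    HasWeight (intDeg ![p + q + d, q + d, d]) P := by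
  obtain ⟨Q, _, hQ⟩ := flagSpan_le_leadForms p q d h
  exact hQ.1

/-- A raising operator replaces a vector by an earlier one, which creates a repeated vector in each
of f' ∧ f'' and f' ∧ f'' ∧ f''' or leaves the factor untouched by the derivation. -/
lemma isHighest_of_mem_flagSpan {p q d : ℕ} {P : JetPoly} (h : P ∈ flagSpan p q d) :
    IsHighest P := by
  have key : ∀ a b : Fin 3, (∀ i, polar a b (X (0, i)) = 0) →
      (∀ i j, polar a b (minorTwo i j) = 0) → polar a b minorThree = 0 → polar a b P = 0 := by
    intro a b h1 h2 h3
    have hU := derivation_pow_eq_zero (derivation_span_eq_zero h1) p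
    have hM := derivation_pow_eq_zero (derivation_span_eq_zero (D := polar a b)
      (g := fun t : Fin 3 × Fin 3 => minorTwo t.1 t.2) fun t => h2 _ _) q
    have hD := derivation_pow_eq_zero (derivation_span_eq_zero (D := polar a b)
      (g := fun _ : Unit => minorThree) fun _ => h3) d
    rw [Set.range_const] at hD
    have hUM : ∀ x ∈ spanU ^ p * spanM ^ q, polar a b x = 0 := fun x hx => by
      simpa using derivation_mul_mem (T' := ⊥) hU
        (fun y hy => (Submodule.mem_bot ℂ).2 (hM y hy)) x hx
    simpa using derivation_mul_mem (T' := ⊥) hUM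
      (fun y hy => (Submodule.mem_bot ℂ).2 (hD y hy)) P h
  refine ⟨key 0 1 ?_ ?_ ?_, key 0 2 ?_ ?_ ?_, key 1 2 ?_ ?_ ?_⟩ <;> try intro i
  all_goals try intro j
  all_goals simp [minorThree, minorTwo]
  all_goals ring

/-- Each of the c factors f' ∧ f''' is paired with a factor f' to form the leading form of an
invariant of degree 5. The pairing needs c ≤ p. -/
lemma polar_pow_mem_leadForms {p q d c : ℕ} (hp : c ≤ p) (hq : c ≤ q) {P : JetPoly}
    (hP : P ∈ flagSpan p q d) :
    ((polarEnd 2 1) ^ c) P ∈ leadForms (p + 3 * q + 6 * d + c)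
      ![p + q + d, q + d - c, d + c] := by
  have h := mul_le_leadForms (mul_le_leadForms (pow_le_leadForms spanU_mul_spanN_le_leadForms c)
    (pow_le_leadForms spanU_le_leadForms (p - c))) (mul_le_leadForms
      (pow_le_leadForms spanM_le_leadForms (q - c)) (pow_le_leadForms spanD_le_leadForms d))
  have h1 : spanU ^ p * spanD ^ d * (spanN ^ c * spanM ^ (q - c)) =
      (spanU * spanN) ^ c * spanU ^ (p - c) * (spanM ^ (q - c) * spanD ^ d) := by
    obtain ⟨p, rfl⟩ := Nat.exists_eq_add_of_le hp
    rw [Nat.add_sub_cancel_left, mul_pow, pow_add]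
    ring
  have h2 := h (h1 ▸ polar_two_one_pow_mem hq hP)
  convert h2 using 2
  · omega
  · ext j
    fin_cases j <;> simp <;> omega

/-! ### The decomposition of the leading forms -/

lemma polarEnd_pow_comp (a b : Fin 3) (k : ℕ) (l : Fin 3 → ℤ) (P : JetPoly) :
    ((polarEnd a b) ^ k) (comp l P) =
      comp (l + k • (Pi.single a 1 - Pi.single b 1)) (((polarEnd a b) ^ k) P) := by
  induction k with
  | zero => simp
  | succ k ih =>
    rw [pow_succ', Module.End.mul_apply, ih, polarEnd_apply, polar_comp, Module.End.mul_apply,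
      polarEnd_apply]
    congr 2
    rw [add_smul, one_smul]
    abel

lemma HasWeight.polarEnd_pow {l : Fin 3 → ℤ} {P : JetPoly} (h : HasWeight l P) (a b : Fin 3)
    (k : ℕ) : HasWeight (l + k • (Pi.single a 1 - Pi.single b 1)) (((polarEnd a b) ^ k) P) := by
  rw [← h.comp_same, polarEnd_pow_comp]
  exact hasWeight_comp _ _

lemma HasWeight.polarEnd_pow_eq_zero {l : Fin 3 → ℤ} {P : JetPoly} (h : HasWeight l P)
    {a b : Fin 3} (hab : a ≠ b) {k : ℕ} (hk : l b < k) : ((polarEnd a b) ^ k) P = 0 := by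
  rw [← h.comp_same, polarEnd_pow_comp, comp_eq_zero_of_neg (j := b)]
  simp [hab.symm]
  omega

lemma polar_zero_two_pow {P : JetPoly} (h : polar 0 2 P = 0) (k : ℕ) :
    polar 0 2 (((polarEnd 1 2) ^ k) P) = 0 := by
  induction k with
  | zero => simpa
  | succ k ih =>
    rw [pow_succ', Module.End.mul_apply, polarEnd_apply, polar_comm]
    simp [ih]

/-- The commutator of `polar 0 1` and `polar 1 2` is `polar 0 2`, which kills P and its iterates
under `polar 1 2`. -/
lemma polar_zero_one_pow {P : JetPoly} (h : polar 0 2 P = 0) (k : ℕ) :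
    polar 0 1 (((polarEnd 1 2) ^ k) P) = ((polarEnd 1 2) ^ k) (polar 0 1 P) := by
  induction k with
  | zero => simp
  | succ k ih =>
    rw [pow_succ', Module.End.mul_apply, Module.End.mul_apply, polarEnd_apply, polar_comm, ih]
    simp [polar_zero_two_pow h k]

lemma pow_polar_zero_one {P : JetPoly} (h : polar 0 2 P = 0) (k : ℕ) :
    polar 0 2 (((polarEnd 0 1) ^ k) P) = 0 ∧
      ((polarEnd 0 1) ^ k) (polar 1 2 P) = polar 1 2 (((polarEnd 0 1) ^ k) P) := by
  induction k with
  | zero => simpa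
  | succ k ih =>
    constructor
    · rw [pow_succ', Module.End.mul_apply, polarEnd_apply, polar_comm]
      simp [ih.1]
    · rw [pow_succ', Module.End.mul_apply, Module.End.mul_apply, ih.2, polarEnd_apply,
        polarEnd_apply, polar_comm]
      simp [ih.1]

/-- Taking components in `polar 0 1 p = -3 polar 1 2 p` links two multidegrees that differ by (-1,
2, -1). Iterating c times expresses the iterate of `polar 1 2` on one component through a component
further along this chain, where `sl₂`-theory for `polar 0 1` applies. -/
lemma comp_smul_shift {m : ℕ} {p : JetPoly} (hp : p ∈ invPoly m) (l : Fin 3 → ℤ) (c : ℕ) :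
    ((polarEnd 0 1) ^ c) (comp ![l 0 - c, l 1 + 2 * c, l 2 - c] p) =
      ((-3 : ℂ) ^ c) • ((polarEnd 1 2) ^ c) (comp l p) := by
  have h02 : ∀ l, polar 0 2 (comp l p) = 0 := fun l => by
    rw [polar_comp, polar_zero_two_of_mem_invPoly hp, map_zero]
  induction c with
  | zero =>
    have : ![l 0 - ((0 : ℕ) : ℤ), l 1 + 2 * ((0 : ℕ) : ℤ), l 2 - ((0 : ℕ) : ℤ)] = l := by
      ext j; fin_cases j <;> simp
    rw [this]
    simp
  | succ c ih =>
    have h1 : polar 0 1 (comp ![l 0 - (c + 1 : ℕ), l 1 + 2 * (c + 1 : ℕ), l 2 - (c + 1 : ℕ)] p) =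
        (-3 : ℂ) • polar 1 2 (comp ![l 0 - c, l 1 + 2 * c, l 2 - c] p) := by
      rw [polar_comp, polar_zero_one_of_mem_invPoly hp, map_smul, polar_comp]
      congr 3
      ext j
      fin_cases j <;> simp [Matrix.vecHead, Matrix.vecTail] <;> ring
    rw [pow_succ, Module.End.mul_apply, polarEnd_apply, h1, map_smul,
      (pow_polar_zero_one (h02 _) c).2, ih, Derivation.map_smul, smul_smul, ← pow_succ',
      pow_succ' (polarEnd 1 2), Module.End.mul_apply, polarEnd_apply]

/-! ### The `sl₂`-triples formed by polarizations -/

section Sl2Polar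

lemma polar_sl2_ef (a b : Fin 3) (x : JetPoly) :
    polarEnd a b (polarEnd b a x) =
      polarEnd b a (polarEnd a b x) + (polarEnd a a - polarEnd b b) x := by
  simp only [polarEnd_apply, LinearMap.sub_apply]
  rw [polar_comm]
  simp
  ring

lemma polar_sl2_he {a b : Fin 3} (hab : a ≠ b) (x : JetPoly) :
    (polarEnd a a - polarEnd b b) (polarEnd a b x) =
      polarEnd a b ((polarEnd a a - polarEnd b b) x) + (2 : ℂ) • polarEnd a b x := by
  simp only [polarEnd_apply, LinearMap.sub_apply]
  rw [polar_comm a a, polar_comm b b, map_sub]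
  simp only [hab.symm, if_true, if_false]
  module

lemma polar_sl2_hf {a b : Fin 3} (hab : a ≠ b) (x : JetPoly) :
    (polarEnd a a - polarEnd b b) (polarEnd b a x) =
      polarEnd b a ((polarEnd a a - polarEnd b b) x) - (2 : ℂ) • polarEnd b a x := by
  simp only [polarEnd_apply, LinearMap.sub_apply]
  rw [polar_comm a a, polar_comm b b, map_sub]
  simp only [hab, if_true, if_false]
  module

/-- For the triple with raising operator `polar a b`, P has weight -(l b - l a), and a raising
operator is injective up to the power l b - l a on such a weight. -/
lemma HasWeight.eq_zero_of_pow_eq_zero {l : Fin 3 → ℤ} {P : JetPoly} (h : HasWeight l P)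
    {a b : Fin 3} (hab : a ≠ b) {k : ℕ} (hk : (k : ℤ) ≤ l b - l a)
    (h0 : ((polarEnd a b) ^ k) P = 0) : P = 0 := by
  obtain ⟨n, hn⟩ := Int.eq_ofNat_of_zero_le (a := l b - l a) (by omega)
  -- Each `polar b a` lowers the degree in the vector a by one, so l a + 1 applications annihilate
  -- P; this is the nilpotency required.
  refine sl2_pow_e_injective (polar_sl2_ef a b) (polar_sl2_he hab) (polar_sl2_hf hab)
    ((l a).toNat + 1) n P ?_ ?_ ?_
  · rw [LinearMap.sub_apply, polarEnd_apply, polarEnd_apply, h a, h b, ← sub_smul]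
    congr 1
    have : (l b : ℂ) - l a = n := by exact_mod_cast hn
    linear_combination -this
  · obtain ⟨j, rfl⟩ := Nat.exists_eq_add_of_le (show k ≤ n by omega)
    rw [add_comm, pow_add, Module.End.mul_apply, h0, map_zero]
  · exact h.polarEnd_pow_eq_zero hab.symm (by push_cast; omega)

lemma exists_polarEnd_pow_pow {l : Fin 3 → ℤ} {P : JetPoly} (h : HasWeight l P)
    {a b : Fin 3} (hab : a ≠ b) (h0 : polar a b P = 0) {c : ℕ} (hc : (c : ℤ) ≤ l a - l b) :
    ∃ r : ℂ, r ≠ 0 ∧ ((polarEnd a b) ^ c) (((polarEnd b a) ^ c) P) = r • P := by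
  obtain ⟨n, hn⟩ := Int.eq_ofNat_of_zero_le (a := l a - l b) (by omega)
  refine sl2_pow_e_pow_f (polar_sl2_ef a b) (polar_sl2_hf hab) (q := n) ?_ h0 c (by omega)
  rw [LinearMap.sub_apply, polarEnd_apply, polarEnd_apply, h a, h b, ← sub_smul]
  congr 1
  exact_mod_cast hn

end Sl2Polar

/-- The condition on `c` for `Γ^(l₁, l₂ + c, l₃ - c)` to occur in `Gr^l`. -/
def Admissible (l : Fin 3 → ℕ) (c : ℕ) : Prop := c ≤ l 2 ∧ l 1 + 2 * c ≤ l 0 ∧ l 2 ≤ l 1 + c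

/-- Highest weight polynomials of weight `(l₁, l₂ + c, l₃ - c)`. -/
def flagPart (l : Fin 3 → ℕ) (c : ℕ) : Submodule ℂ JetPoly :=
  flagSpan (l 0 - l 1 - c) (l 1 + 2 * c - l 2) (l 2 - c)

lemma hasWeight_of_mem_flagPart {l : Fin 3 → ℕ} {c : ℕ} (h : Admissible l c) {P : JetPoly}
    (hP : P ∈ flagPart l c) : HasWeight ![l 0, l 1 + c, l 2 - c] P := by
  obtain ⟨h1, h2, h3⟩ := h
  convert hasWeight_of_mem_flagSpan hP using 1
  ext j
  fin_cases j <;> simp [intDeg] <;> omega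

lemma polar_pow_mem_leadForms_of_mem_flagPart {m : ℕ} {l : Fin 3 → ℕ}
    (hl : l 0 + 2 * l 1 + 3 * l 2 = m) {c : ℕ} (h : Admissible l c) {P : JetPoly}
    (hP : P ∈ flagPart l c) : ((polarEnd 2 1) ^ c) P ∈ leadForms m l := by
  obtain ⟨h1, h2, h3⟩ := h
  convert polar_pow_mem_leadForms (c := c) (by omega) (by omega) hP using 2
  · omega
  · ext j
    fin_cases j <;> simp <;> omega

/-! ### Leading forms as sums of lowered highest weight polynomials -/

section Decomposition

variable {m : ℕ} {l : Fin 3 → ℕ} {p : JetPoly}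

/-- By the invariance relation the result is -3 `polar 1 2` of the component of multidegree l + (1,
-2, 1). Its degree in f''' exceeds that of l, so this component of p is zero. -/
lemma polar_zero_one_comp (hp : p ∈ invPoly m) (hpl : p ∈ upTo l) :
    polar 0 1 (comp (intDeg l) p) = 0 := by
  rw [polar_comp, polar_zero_one_of_mem_invPoly hp, map_smul]
  have h := polar_comp 1 2 (intDeg l + Pi.single 0 1 - Pi.single 1 1 - Pi.single 1 1
    + Pi.single 2 1) p
  rw [show intDeg l + Pi.single 0 1 - Pi.single 1 1 - Pi.single 1 1 + Pi.single 2 1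
    + Pi.single 1 1 - Pi.single 2 1 = intDeg l + Pi.single 0 1 - Pi.single 1 1 by abel] at h
  rw [← h, comp_eq_zero_of_mem_upTo hpl (by simp [intDeg]), map_zero, smul_zero]

/-- The last nonzero iterate of `polar 1 2` on a leading form. -/
lemma admissible_of_pow_ne_zero (hp : p ∈ invPoly m) (hpl : p ∈ upTo l) {c : ℕ}
    (h0 : ((polarEnd 1 2) ^ c) (comp (intDeg l) p) ≠ 0)
    (h1 : ((polarEnd 1 2) ^ (c + 1)) (comp (intDeg l) p) = 0) :
    Admissible l c ∧ ((polarEnd 1 2) ^ c) (comp (intDeg l) p) ∈ flagPart l c := by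
  have hw := hasWeight_comp (intDeg l) p
  have h02 : polar 0 2 (comp (intDeg l) p) = 0 := by
    rw [polar_comp, polar_zero_two_of_mem_invPoly hp, map_zero]
  have hA : polar 0 1 (((polarEnd 1 2) ^ c) (comp (intDeg l) p)) = 0 := by
    rw [polar_zero_one_pow h02, polar_zero_one_comp hp hpl, map_zero]
  have hB : polar 1 2 (((polarEnd 1 2) ^ c) (comp (intDeg l) p)) = 0 := by
    rw [pow_succ', Module.End.mul_apply] at h1
    exact h1
  have hadm : Admissible l c := by
    refine ⟨?_, ?_, ?_⟩
    -- More than l₂ (indices from 0) applications of `polar 1 2` exhaust the degree in f'''.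
    · by_contra hc
      exact h0 (hw.polarEnd_pow_eq_zero (by decide) (by simp only [intDeg]; omega))
    -- By `comp_smul_shift`, `polar 0 1` to the power c maps a component of p to a nonzero multiple
    -- of the iterate, which `polar 0 1` kills. If l 0 < l 1 + 2c, the power c + 1 is injective on
    -- that component, so the component and then the iterate vanish.
    · by_contra hc
      have hq := hasWeight_comp ![intDeg l 0 - c, intDeg l 1 + 2 * c, intDeg l 2 - c] p
      have hs := comp_smul_shift hp (intDeg l) c
      have hz := hq.eq_zero_of_pow_eq_zero (a := 0) (b := 1) (by decide) (k := c + 1)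
        (by simp [intDeg]; omega) (by
          rw [pow_succ', Module.End.mul_apply, hs, map_smul, polarEnd_apply, hA, smul_zero])
      rw [hz, map_zero] at hs
      exact h0 ((smul_eq_zero.1 hs.symm).resolve_left (pow_ne_zero _ (by norm_num)))
    -- If l 2 > l 1 + c, the power c + 1 of `polar 1 2` is injective on the weight l, which
    -- contradicts the vanishing of the next iterate.
    · by_contra hc
      refine h0 ?_
      rw [hw.eq_zero_of_pow_eq_zero (a := 1) (b := 2) (by decide) (k := c + 1)
        (by simp only [intDeg]; push_cast; omega) h1, map_zero]
  refine ⟨hadm, mem_flagSpan_of_isHighest _ _ _ ?_ ⟨hA, polar_zero_two_pow h02 c, hB⟩⟩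
  obtain ⟨h2, h3, h4⟩ := hadm
  convert hw.polarEnd_pow 1 2 c using 1
  ext j
  fin_cases j <;> simp [intDeg] <;> omega

/-- Every leading form is a sum of polarizations of highest weight polynomials. -/
lemma exists_decomposition (hl : l 0 + 2 * l 1 + 3 * l 2 = m) {P : JetPoly}
    (hP : P ∈ leadForms m l) :
    ∃ f : ℕ → JetPoly, (∀ c, Admissible l c → f c ∈ flagPart l c) ∧
      (∀ c, ¬ Admissible l c → f c = 0) ∧
      P = ∑ c ∈ Finset.range (l 2 + 1), ((polarEnd 2 1) ^ c) (f c) := by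
  -- Induction on the power of `polar 1 2` that kills P, over all leading forms at once, because P
  -- is modified at each step.
  have key : ∀ (k : ℕ) (P : JetPoly), P ∈ leadForms m l → ((polarEnd 1 2) ^ k) P = 0 →
      ∃ f : ℕ → JetPoly, (∀ c, Admissible l c → f c ∈ flagPart l c) ∧
        (∀ c, ¬ Admissible l c → f c = 0) ∧
        P = ∑ c ∈ Finset.range (l 2 + 1), ((polarEnd 2 1) ^ c) (f c) := by
    intro k
    induction k with
    | zero =>
      intro P _ h
      exact ⟨0, fun c _ => zero_mem _, fun c _ => rfl, by simpa using h⟩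
    | succ k ih =>
      intro P hP h
      by_cases h0 : ((polarEnd 1 2) ^ k) P = 0
      · exact ih P hP h0
      obtain ⟨p, hp, hpl⟩ := hP
      have hcomp := hpl.comp_eq
      rw [← hcomp] at h0 h
      obtain ⟨hadm, hmem⟩ := admissible_of_pow_ne_zero hp hpl.mem_upTo h0 h
      rw [hcomp] at h0 h hmem
      obtain ⟨r, hr, hrP⟩ := exists_polarEnd_pow_pow (hasWeight_of_mem_flagPart hadm hmem)
        (a := 1) (b := 2) (by decide) (isHighest_of_mem_flagSpan hmem).2.2 (c := k)
        (by have := hadm.2.2; simp; omega)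
      set T := ((polarEnd 1 2) ^ k) P with hT
      have hlead := polar_pow_mem_leadForms_of_mem_flagPart hl hadm
        (Submodule.smul_mem _ r⁻¹ hmem)
      -- Lowering k times and then raising k times multiplies T by r, so the subtracted term has the
      -- same k-th iterate T as P. It is itself a leading form, hence the difference is one with a
      -- smaller nilpotency order.
      obtain ⟨f, hf1, hf2, hf3⟩ := ih (P - ((polarEnd 2 1) ^ k) (r⁻¹ • T))
        (sub_mem ⟨p, hp, hpl⟩ hlead) (by
          rw [map_sub, map_smul, map_smul, hrP, smul_smul, inv_mul_cancel₀ hr, one_smul, ← hT,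
            sub_self])
      refine ⟨f + Pi.single k (r⁻¹ • T), fun c hc => add_mem (hf1 c hc) ?_, fun c hc => ?_, ?_⟩
      · by_cases hck : c = k
        · subst hck
          simpa using Submodule.smul_mem _ r⁻¹ hmem
        · simp [hck]
      · have hck : c ≠ k := fun h => hc (h ▸ hadm)
        simp [hf2 c hc, hck]
      · have hk : k ∈ Finset.range (l 2 + 1) := Finset.mem_range.2 (by have := hadm.1; omega)
        have hs : ∑ c ∈ Finset.range (l 2 + 1),
            ((polarEnd 2 1) ^ c) ((Pi.single k (r⁻¹ • T) : ℕ → JetPoly) c) =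
              ((polarEnd 2 1) ^ k) (r⁻¹ • T) := by
          rw [Finset.sum_eq_single_of_mem k hk]
          · simp
          · intro b _ hb
            simp [hb]
        simp only [Pi.add_apply, map_add, Finset.sum_add_distrib]
        rw [hs, ← hf3, sub_add_cancel]
  obtain ⟨p, hp, hpl⟩ := hP
  exact key (l 2 + 1) P ⟨p, hp, hpl⟩
    (hpl.1.polarEnd_pow_eq_zero (by decide) (by simp [intDeg]))

/-- The sum of the polarizations of highest weight polynomials is direct. -/
lemma eq_zero_of_sum_polar_eq_zero {f : ℕ → JetPoly}
    (hf1 : ∀ c, Admissible l c → f c ∈ flagPart l c) (hf2 : ∀ c, ¬ Admissible l c → f c = 0)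
    {N : ℕ} (h : ∑ c ∈ Finset.range N, ((polarEnd 2 1) ^ c) (f c) = 0) : ∀ c < N, f c = 0 := by
  induction N with
  | zero => simp
  | succ N ih =>
    have hN : f N = 0 := by
      by_cases hadm : Admissible l N
      · have hw : ∀ c, Admissible l c → ∃ r : ℂ, r ≠ 0 ∧
            ((polarEnd 1 2) ^ c) (((polarEnd 2 1) ^ c) (f c)) = r • f c := fun c hc =>
          exists_polarEnd_pow_pow (hasWeight_of_mem_flagPart hc (hf1 c hc)) (by decide)
            (isHighest_of_mem_flagSpan (hf1 c hc)).2.2 (by have := hc.2.2; simp; omega)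
        -- Raising N times isolates the top term: for c < N, the first c raisings return a multiple
        -- of `f c`, and the next one kills it.
        have h1 := congrArg ((polarEnd 1 2) ^ N) h
        rw [map_zero, Finset.sum_range_succ, map_add, map_sum, Finset.sum_eq_zero, zero_add] at h1
        · obtain ⟨r, hr, hr'⟩ := hw N hadm
          rw [hr'] at h1
          exact (smul_eq_zero.1 h1).resolve_left hr
        · intro c hc
          rw [Finset.mem_range] at hc
          by_cases hcadm : Admissible l c
          · obtain ⟨r, hr, hr'⟩ := hw c hcadm
            obtain ⟨j, rfl⟩ := Nat.exists_eq_add_of_lt hc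
            rw [show c + j + 1 = j + 1 + c by ring, pow_add, Module.End.mul_apply, hr', map_smul,
              pow_succ, Module.End.mul_apply, polarEnd_apply,
              (isHighest_of_mem_flagSpan (hf1 c hcadm)).2.2, map_zero, smul_zero]
          · simp [hf2 c hcadm]
      · exact hf2 N hadm
    rw [Finset.sum_range_succ, hN, map_zero, add_zero] at h
    intro c hc
    rcases Nat.lt_succ_iff_lt_or_eq.1 hc with hc | rfl
    · exact ih h c hc
    · exact hN

end Decomposition

/-! ### Schur functors and highest weight polynomials -/

section SchurDiag

variable {lam : Fin 3 → ℕ}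

@[simp]
lemma permForm_apply {V : Type*} [AddCommGroup V] [Module ℂ V] (σ : Equiv.Perm (Cells lam))
    (M : CellForms lam V) (v : Cells lam → V) :
    permForm lam V σ M v = M fun c => v (σ c) := rfl

lemma mem_rowPerms {σ : Equiv.Perm (Cells lam)} : σ ∈ rowPerms lam ↔ ∀ c, (σ c).1 = c.1 := by
  simp [rowPerms]

/-- The restriction of a form to the arguments that are constant along the rows, as a polynomial
in the three arguments. -/
def diag (lam : Fin 3 → ℕ) : CellForms lam (Cn 3) →ₗ[ℂ] JetPoly where
  toFun M := ∑ κ : Cells lam → Fin 3,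
    M (fun c => Pi.single (κ c) 1) • ∏ c : Cells lam, X (c.1, κ c)
  map_add' M N := by simp [add_smul, Finset.sum_add_distrib]
  map_smul' a M := by simp [Finset.smul_sum, smul_smul]

lemma diag_apply (M : CellForms lam (Cn 3)) : diag lam M = ∑ κ : Cells lam → Fin 3,
    M (fun c => Pi.single (κ c) 1) • ∏ c : Cells lam, X (c.1, κ c) := rfl

lemma cellForms_eq_sum (M : CellForms lam (Cn 3)) (v : Cells lam → Cn 3) :
    M v = ∑ κ : Cells lam → Fin 3, M (fun c => Pi.single (κ c) 1) * ∏ c, v c (κ c) := by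
  have h : v = fun c => ∑ i, v c i • (Pi.single i 1 : Cn 3) := by
    ext c k
    simp [Finset.sum_apply, Pi.single_apply]
  conv_lhs => rw [h, MultilinearMap.map_sum]
  refine Finset.sum_congr rfl fun κ _ => ?_
  rw [MultilinearMap.map_smul_univ, smul_eq_mul, mul_comm]

lemma eval_diag (M : CellForms lam (Cn 3)) (x : Fin 3 × Fin 3 → ℂ) :
    eval x (diag lam M) = M fun c i => x (c.1, i) := by
  rw [cellForms_eq_sum, diag_apply, map_sum]
  refine Finset.sum_congr rfl fun κ _ => ?_
  rw [smul_eval, map_prod]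
  simp

/-- Both families take each value equally often, so bijections between corresponding fibres assemble
into a permutation. -/
lemma exists_perm_of_sum_single_eq {α β : Type*} [Fintype α] (g g' : α → β)
    (h : ∑ a, Finsupp.single (g a) 1 = ∑ a, (Finsupp.single (g' a) 1 : β →₀ ℕ)) :
    ∃ σ : Equiv.Perm α, ∀ a, g a = g' (σ a) := by
  classical
  have hcard : ∀ b, Fintype.card {a // g a = b} = Fintype.card {a // g' a = b} := by
    intro b
    have h1 := DFunLike.congr_fun h b
    simp only [Finsupp.coe_finsetSum, Finset.sum_apply, Finsupp.single_apply] at h1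
    rw [Fintype.card_subtype, Fintype.card_subtype, Finset.card_filter, Finset.card_filter]
    exact h1
  let e : ∀ b, {a // g a = b} ≃ {a // g' a = b} := fun b => Fintype.equivOfCardEq (hcard b)
  refine ⟨(Equiv.sigmaFiberEquiv g).symm.trans ((Equiv.sigmaCongrRight e).trans
    (Equiv.sigmaFiberEquiv g')), fun a => ?_⟩
  exact ((e (g a)) ⟨a, rfl⟩).2.symm

/-- A form that is symmetric along the rows is determined by its restriction to the arguments
that are constant along the rows. -/
lemma eq_zero_of_diag_eq_zero {M : CellForms lam (Cn 3)}
    (hM : ∀ σ ∈ rowPerms lam, permForm lam (Cn 3) σ M = M) (h : diag lam M = 0) : M = 0 := by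
  classical
  refine Module.Basis.ext_multilinear (fun _ => Pi.basisFun ℂ (Fin 3)) fun κ₀ => ?_
  simp only [Pi.basisFun_apply, zero_apply]
  have hmon : ∀ κ : Cells lam → Fin 3, (∏ c : Cells lam, X (c.1, κ c) : JetPoly) =
      monomial (∑ c : Cells lam, Finsupp.single (c.1, κ c) 1) 1 := fun κ => by
    rw [monomial_sum_one]
    rfl
  have h1 := congrArg (coeff (∑ c : Cells lam, Finsupp.single (c.1, κ₀ c) 1)) h
  rw [diag_apply, coeff_sum, coeff_zero] at h1
  -- Two index families with the same monomial differ by a permutation preserving rows, and M takes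
  -- the same value on them. The coefficient is thus M at κ₀ times a positive count.
  have h2 : ∀ κ : Cells lam → Fin 3,
      coeff (∑ c : Cells lam, Finsupp.single (c.1, κ₀ c) 1)
        (M (fun c => Pi.single (κ c) 1) • ∏ c : Cells lam, X (c.1, κ c) : JetPoly) =
      if ∑ c : Cells lam, Finsupp.single (c.1, κ c) 1 =
          ∑ c : Cells lam, (Finsupp.single (c.1, κ₀ c) 1 : Fin 3 × Fin 3 →₀ ℕ)
        then M (fun c => Pi.single (κ₀ c) 1) else 0 := by
    intro κ
    rw [coeff_smul, hmon, coeff_monomial]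
    split_ifs with hκ
    · obtain ⟨σ, hσ⟩ := exists_perm_of_sum_single_eq _ _ hκ
      have hrow : σ ∈ rowPerms lam := mem_rowPerms.2 fun c => (congrArg Prod.fst (hσ c)).symm
      rw [smul_eq_mul, mul_one]
      conv_rhs => rw [← hM σ hrow, permForm_apply]
      congr 1
      ext1 c
      rw [show κ c = κ₀ (σ c) from congrArg Prod.snd (hσ c)]
    · simp
  rw [Finset.sum_congr rfl fun κ _ => h2 κ, ← Finset.sum_filter, Finset.sum_const,
    nsmul_eq_mul] at h1
  refine (mul_eq_zero.1 h1).resolve_left ?_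
  rw [Nat.cast_eq_zero]
  exact Finset.card_ne_zero_of_mem (a := κ₀) (by simp)

/-- The outer factor of the Young symmetrizer is a sum over the group of row permutations, which
translation by σ only reorders. -/
lemma permForm_of_mem_schurDual {M : CellForms lam (Cn 3)} (hM : M ∈ SchurDual lam (Cn 3))
    {σ : Equiv.Perm (Cells lam)} (hσ : σ ∈ rowPerms lam) : permForm lam (Cn 3) σ M = M := by
  obtain ⟨N, rfl⟩ := hM
  rw [youngSymmetrizer, LinearMap.comp_apply]
  generalize (∑ σ ∈ colPerms lam, ((Equiv.Perm.sign σ : ℤ) : ℂ) • permForm lam (Cn 3) σ) N = G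
  rw [LinearMap.sum_apply, map_sum]
  refine Finset.sum_bij' (fun τ _ => σ * τ) (fun τ _ => σ⁻¹ * τ) ?_ ?_ ?_ ?_ ?_
  · intro τ hτ
    rw [mem_rowPerms] at *
    intro c
    rw [Equiv.Perm.mul_apply, hσ, hτ]
  · intro τ hτ
    rw [mem_rowPerms] at *
    intro c
    rw [Equiv.Perm.mul_apply, ← hτ c, ← hσ (σ⁻¹ (τ c)), ← Equiv.Perm.mul_apply, mul_inv_cancel,
      Equiv.Perm.one_apply]
  · intro τ _; simp
  · intro τ _; simp
  · intro τ _
    ext v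
    simp

lemma diag_injective_of_mem_schurDual {M : CellForms lam (Cn 3)} (hM : M ∈ SchurDual lam (Cn 3))
    (h : diag lam M = 0) : M = 0 :=
  eq_zero_of_diag_eq_zero (fun _ hσ => permForm_of_mem_schurDual hM hσ) h

/-- The alternation along the columns. -/
def colAlt (lam : Fin 3 → ℕ) : CellForms lam (Cn 3) →ₗ[ℂ] CellForms lam (Cn 3) :=
  ∑ σ ∈ colPerms lam, ((Equiv.Perm.sign σ : ℤ) : ℂ) • permForm lam (Cn 3) σ

/-- Row permutations do not move arguments that are constant along rows, so the symmetrization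
contributes only the order of the row group. -/
lemma diag_youngSymmetrizer (N : CellForms lam (Cn 3)) :
    diag lam (youngSymmetrizer lam (Cn 3) N) =
      ((rowPerms lam).card : ℂ) • diag lam (colAlt lam N) := by
  refine MvPolynomial.funext fun x => ?_
  rw [smul_eval, eval_diag, eval_diag]
  rw [youngSymmetrizer, LinearMap.comp_apply]
  change (∑ σ ∈ rowPerms lam, permForm lam (Cn 3) σ) (colAlt lam N) _ = _
  rw [LinearMap.sum_apply, sum_apply, ← nsmul_eq_mul, ← Finset.sum_const]
  refine Finset.sum_congr rfl fun σ hσ => ?_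
  rw [permForm_apply]
  simp only [mem_rowPerms.1 hσ]

/-- A product of coordinates, one for each cell. -/
def coordForm (lam : Fin 3 → ℕ) (K : ℕ → Fin 3 → Fin 3) : CellForms lam (Cn 3) :=
  (MultilinearMap.mkPiAlgebra ℂ (Cells lam) ℂ).compLinearMap
    fun c => LinearMap.proj (K c.2 c.1)

lemma coordForm_apply (K : ℕ → Fin 3 → Fin 3) (v : Cells lam → Cn 3) :
    coordForm lam K v = ∏ c : Cells lam, v c (K c.2 c.1) := by
  simp [coordForm]

lemma span_coordForm : Submodule.span ℂ (Set.range (coordForm lam)) = ⊤ := by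
  rw [eq_top_iff]
  intro M _
  -- The index function is defined on all pairs (column, row); the value 0 outside the diagram is
  -- never used.
  have h : M = ∑ κ : Cells lam → Fin 3, M (fun c => Pi.single (κ c) 1) •
      coordForm lam (fun j i => if h : j < lam i then κ ⟨i, ⟨j, h⟩⟩ else 0) := by
    refine MultilinearMap.ext fun v => ?_
    rw [cellForms_eq_sum, sum_apply]
    refine Finset.sum_congr rfl fun κ _ => ?_
    rw [smul_apply, coordForm_apply, smul_eq_mul]
    simp
  rw [h]
  exact Submodule.sum_mem _ fun κ _ =>
    Submodule.smul_mem _ _ (Submodule.subset_span (Set.mem_range_self _))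

/-- The matrix whose determinant is the alternation of a product of coordinates. -/
def colMatrix (lam : Fin 3 → ℕ) (K : ℕ → Fin 3 → Fin 3) : Matrix (Cells lam) (Cells lam) JetPoly :=
  fun c c' => if (c.2 : ℕ) = c'.2 then X (c.1, K c'.2 c'.1) else 0

/-- In the Leibniz expansion of the determinant, a permutation that does not preserve columns meets
a zero entry, so only the signed column permutations survive. -/
lemma diag_colAlt_coordForm (K : ℕ → Fin 3 → Fin 3) :
    diag lam (colAlt lam (coordForm lam K)) = (colMatrix lam K).det := by
  refine MvPolynomial.funext fun x => ?_
  rw [eval_diag, Matrix.det_apply, map_sum, colAlt, LinearMap.sum_apply, sum_apply]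
  rw [colPerms, Finset.sum_filter]
  refine Finset.sum_congr rfl fun σ _ => ?_
  rw [Units.smul_def, ← Int.cast_smul_eq_zsmul ℂ, smul_eval, map_prod]
  split_ifs with h
  · rw [LinearMap.smul_apply, smul_apply, permForm_apply, coordForm_apply,
      smul_eq_mul]
    congr 1
    refine Finset.prod_congr rfl fun c _ => ?_
    rw [colMatrix, if_pos (h c), eval_X]
  · push Not at h
    obtain ⟨c, hc⟩ := h
    rw [Finset.prod_eq_zero (Finset.mem_univ c), mul_zero]
    rw [colMatrix, if_neg hc, map_zero]

end SchurDiag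

/-! ### Column determinants and the image of the Schur functor -/

section SchurDiag

variable {lam : Fin 3 → ℕ}

/-- The matrix of coordinates `K 0, K 1, K 2` of the three vectors. -/
def coordMatrix (K : Fin 3 → Fin 3) : Matrix (Fin 3) (Fin 3) JetPoly := fun i i' => X (i, K i')

lemma det_coordMatrix_id : (coordMatrix id).det = minorThree := by
  rw [Matrix.det_fin_three]
  simp [coordMatrix, minorThree, minorTwo]
  ring

/-- A permutation of the coordinates gives plus or minus the Wronskian; a repeated coordinate gives
zero. -/
lemma det_coordMatrix_mem (K : Fin 3 → Fin 3) : (coordMatrix K).det ∈ spanD := by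
  by_cases hK : Function.Injective K
  · let σ : Equiv.Perm (Fin 3) := Equiv.ofBijective K (Finite.injective_iff_bijective.1 hK)
    have h : coordMatrix K = (coordMatrix id).submatrix id σ := by
      ext1 i i'
      rfl
    rw [h, Matrix.det_permute', det_coordMatrix_id, ← zsmul_eq_mul, ← Int.cast_smul_eq_zsmul ℂ]
    exact Submodule.smul_mem _ _ (Submodule.subset_span rfl)
  · rw [Function.Injective] at hK
    push Not at hK
    obtain ⟨a, b, hab, hne⟩ := hK
    rw [Matrix.det_zero_of_column_eq hne fun k => by simp [coordMatrix, hab]]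
    exact zero_mem _

/-- The matrix is block diagonal with one block for each column of the diagram: d columns of height
3, then q of height 2, then p of height 1. -/
lemma det_colMatrix {p q d : ℕ} (h0 : lam 0 = p + q + d) (h1 : lam 1 = q + d) (h2 : lam 2 = d)
    (K : ℕ → Fin 3 → Fin 3) :
    (colMatrix lam K).det = (∏ a ∈ Finset.range p, X (0, K (d + q + a) 0)) *
      (∏ a ∈ Finset.range q, minorTwo (K (d + a) 0) (K (d + a) 1)) *
      ∏ a ∈ Finset.range d, (coordMatrix (K a)).det := by
  have hB : (colMatrix lam K).BlockTriangular fun c => (c.2 : ℕ) := by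
    intro c c' h
    rw [colMatrix, if_neg h.ne']
  have himage : (Finset.univ.image fun c : Cells lam => (c.2 : ℕ)) = Finset.range (d + q + p) := by
    ext a
    simp only [Finset.mem_image, Finset.mem_univ, true_and, Finset.mem_range]
    constructor
    · rintro ⟨⟨i, j⟩, rfl⟩
      have := j.2
      fin_cases i <;> simp at * <;> omega
    · intro ha
      exact ⟨⟨0, ⟨a, by omega⟩⟩, rfl⟩
  rw [hB.det, himage, Finset.prod_range_add, Finset.prod_range_add, mul_comm,
    mul_comm (∏ a ∈ Finset.range d, _), ← mul_assoc]
  refine congrArg₂ (· * ·) (congrArg₂ (· * ·) ?_ ?_) ?_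
  · refine Finset.prod_congr rfl fun a ha => ?_
    rw [Finset.mem_range] at ha
    let e : Fin 1 ≃ {c : Cells lam // (c.2 : ℕ) = d + q + a} :=
      { toFun := fun _ => ⟨⟨0, ⟨d + q + a, by omega⟩⟩, rfl⟩
        invFun := fun _ => 0
        left_inv := fun i => (Fin.fin_one_eq_zero i).symm
        right_inv := by
          rintro ⟨⟨i, j⟩, hj⟩
          have hj' : d + q + a < lam i := hj ▸ j.2
          fin_cases i
          · simp at hj ⊢
            ext
            exact hj.symm
          · exact absurd hj' (by simp; omega)
          · exact absurd hj' (by simp; omega) }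
    rw [← Matrix.det_submatrix_equiv_self e, Matrix.det_fin_one]
    simp [colMatrix, Matrix.toSquareBlock_def, e]
  · refine Finset.prod_congr rfl fun a ha => ?_
    rw [Finset.mem_range] at ha
    let e : Fin 2 ≃ {c : Cells lam // (c.2 : ℕ) = d + a} :=
      { toFun := fun i => if i = 0 then ⟨⟨0, ⟨d + a, by omega⟩⟩, rfl⟩
          else ⟨⟨1, ⟨d + a, by omega⟩⟩, rfl⟩
        invFun := fun c => if c.1.1 = 0 then 0 else 1
        left_inv := fun i => by fin_cases i <;> simp
        right_inv := by
          rintro ⟨⟨i, j⟩, hj⟩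
          have hj' : d + a < lam i := hj ▸ j.2
          fin_cases i
          · simp at hj ⊢
            ext
            exact hj.symm
          · simp at hj ⊢
            ext
            exact hj.symm
          · exact absurd hj' (by simp; omega) }
    rw [← Matrix.det_submatrix_equiv_self e, Matrix.det_fin_two]
    simp [colMatrix, Matrix.toSquareBlock_def, e, minorTwo]
  · refine Finset.prod_congr rfl fun a ha => ?_
    rw [Finset.mem_range] at ha
    have hl : ∀ i, a < lam i := fun i => by fin_cases i <;> simp <;> omega
    let e : Fin 3 ≃ {c : Cells lam // (c.2 : ℕ) = a} :=
      { toFun := fun i => ⟨⟨i, ⟨a, hl i⟩⟩, rfl⟩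
        invFun := fun c => c.1.1
        left_inv := fun i => rfl
        right_inv := by
          rintro ⟨⟨i, j⟩, hj⟩
          simp at hj ⊢
          ext
          exact hj.symm }
    rw [← Matrix.det_submatrix_equiv_self e]
    congr 1
    ext1 i i'
    simp [colMatrix, Matrix.toSquareBlock_def, e, coordMatrix]

lemma prod_range_mem_pow {S : Submodule ℂ JetPoly} (g : ℕ → JetPoly) (hg : ∀ a, g a ∈ S) (n : ℕ) :
    ∏ a ∈ Finset.range n, g a ∈ S ^ n := by
  induction n with
  | zero => exact Submodule.mem_one.2 ⟨1, map_one _⟩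
  | succ n ih =>
    rw [Finset.prod_range_succ, pow_succ]
    exact Submodule.mul_mem_mul ih (hg n)

lemma span_range_pow_le {ι : Type*} (g : ι → JetPoly) (n : ℕ) [Nonempty ι] :
    Submodule.span ℂ (Set.range g) ^ n ≤
      Submodule.span ℂ (Set.range fun α : ℕ → ι => ∏ a ∈ Finset.range n, g (α a)) := by
  classical
  induction n with
  | zero =>
    rw [pow_zero, Submodule.one_le]
    exact Submodule.subset_span ⟨fun _ => Classical.arbitrary ι, by simp⟩
  | succ n ih =>
    rw [pow_succ]
    refine (mul_le_mul' ih le_rfl).trans ?_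
    rw [Submodule.span_mul_span, Submodule.span_le]
    rintro _ ⟨_, ⟨α, rfl⟩, _, ⟨i, rfl⟩, rfl⟩
    refine Submodule.subset_span ⟨Function.update α n i, ?_⟩
    simp only
    rw [Finset.prod_range_succ, Function.update_self]
    congr 1
    refine Finset.prod_congr rfl fun a ha => ?_
    rw [Function.update_of_ne (Finset.mem_range.1 ha).ne]

/-- The polynomials obtained from the Schur functor are the combinations of products of minors. -/
lemma map_diag_schurDual {p q d : ℕ} (h0 : lam 0 = p + q + d) (h1 : lam 1 = q + d)
    (h2 : lam 2 = d) : (SchurDual lam (Cn 3)).map (diag lam) = flagSpan p q d := by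
  have hrow : ((rowPerms lam).card : ℂ) ≠ 0 := by
    rw [Nat.cast_ne_zero]
    exact Finset.card_ne_zero_of_mem (a := 1) (mem_rowPerms.2 fun c => rfl)
  have hspan : (SchurDual lam (Cn 3)).map (diag lam) =
      Submodule.span ℂ (Set.range fun K => (colMatrix lam K).det) := by
    rw [SchurDual, LinearMap.range_eq_map, ← span_coordForm, Submodule.map_span, Submodule.map_span,
      ← Set.range_comp, ← Set.range_comp]
    apply le_antisymm <;> rw [Submodule.span_le] <;> rintro _ ⟨K, rfl⟩
    · simp only [Function.comp_apply]
      rw [diag_youngSymmetrizer, diag_colAlt_coordForm]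
      exact Submodule.smul_mem _ _ (Submodule.subset_span ⟨K, rfl⟩)
    · have h : (colMatrix lam K).det = ((rowPerms lam).card : ℂ)⁻¹ •
          diag lam (youngSymmetrizer lam (Cn 3) (coordForm lam K)) := by
        rw [diag_youngSymmetrizer, diag_colAlt_coordForm, smul_smul, inv_mul_cancel₀ hrow, one_smul]
      simp only
      rw [h]
      exact Submodule.smul_mem _ _ (Submodule.subset_span ⟨K, rfl⟩)
  rw [hspan]
  apply le_antisymm
  · rw [Submodule.span_le]
    rintro _ ⟨K, rfl⟩
    simp only
    rw [det_colMatrix h0 h1 h2]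
    exact Submodule.mul_mem_mul (Submodule.mul_mem_mul
      (prod_range_mem_pow _ (fun a => Submodule.subset_span (Set.mem_range_self (K (d + q + a) 0))) p)
      (prod_range_mem_pow _ (fun a => Submodule.subset_span
        (Set.mem_range_self (K (d + a) 0, K (d + a) 1))) q))
      (prod_range_mem_pow _ (fun a => det_coordMatrix_mem (K a)) d)
  · have hD : spanD ^ d = Submodule.span ℂ {minorThree ^ d} := by
      rw [spanD, Submodule.span_pow, Set.singleton_pow]
    have hU : spanU ^ p ≤ _ := span_range_pow_le (fun i : Fin 3 => (X (0, i) : JetPoly)) p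
    have hM : spanM ^ q ≤ _ :=
      span_range_pow_le (fun a : Fin 3 × Fin 3 => minorTwo a.1 a.2) q
    rw [flagSpan, hD]
    refine (mul_le_mul' (mul_le_mul' hU hM) le_rfl).trans ?_
    rw [Submodule.span_mul_span, Submodule.span_mul_span, Submodule.span_le]
    rintro _ ⟨_, ⟨_, ⟨α, rfl⟩, _, ⟨β, rfl⟩, rfl⟩, _, rfl, rfl⟩
    refine Submodule.subset_span ⟨fun a i => if a < d then i else if a < d + q then
      (if i = 0 then (β (a - d)).1 else (β (a - d)).2) else α (a - (d + q)), ?_⟩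
    simp only
    rw [det_colMatrix h0 h1 h2]
    refine congrArg₂ (· * ·) (congrArg₂ (· * ·) ?_ ?_) ?_
    · refine Finset.prod_congr rfl fun a _ => ?_
      rw [if_neg (by omega), if_neg (by omega), Nat.add_sub_cancel_left]
    · refine Finset.prod_congr rfl fun a ha => ?_
      rw [Finset.mem_range] at ha
      simp [ha]
    · refine Eq.trans ?_ ((Finset.prod_const minorThree).trans (by rw [Finset.card_range]))
      refine Finset.prod_congr rfl fun a ha => ?_
      rw [Finset.mem_range] at ha
      simp only [ha, if_true]
      exact det_coordMatrix_id

end SchurDiag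

/-! ### The sum of all leading forms -/

section Model

variable {m : ℕ}

lemma weightIndex_iff {l : Fin 3 → ℕ} :
    ∑ j : Fin 3, ((j : ℕ) + 1) * l j = m ↔ l 0 + 2 * l 1 + 3 * l 2 = m := by
  simp [Fin.sum_univ_three]

lemma schurIndex_facts (p : SchurIndex m) :
    p.1.2 0 + 2 * p.1.2 1 + 3 * p.1.2 2 + p.1.1 = m ∧ p.1.2 1 + p.1.1 ≤ p.1.2 0 ∧
      p.1.2 2 + p.1.1 ≤ p.1.2 1 := by
  obtain ⟨_, h1, h2⟩ := p.2
  have h3 := h2 0 1 (by decide)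
  have h4 := h2 1 2 (by decide)
  omega

/-- The multidegree of the leading forms of the copy of `Γ^lam` of index `p`. -/
def leadIndex (p : SchurIndex m) : WeightIndex 3 m :=
  ⟨![p.1.2 0, p.1.2 1 - p.1.1, p.1.2 2 + p.1.1], by
    obtain ⟨h1, h2, h3⟩ := schurIndex_facts p
    rw [weightIndex_iff]
    simp
    omega⟩

lemma admissible_leadIndex (p : SchurIndex m) : Admissible (leadIndex p).1 p.1.1 := by
  obtain ⟨h1, h2, h3⟩ := schurIndex_facts p
  refine ⟨?_, ?_, ?_⟩ <;> simp [leadIndex]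
  · omega
  · omega

lemma leadIndex_injective {p p' : SchurIndex m} (h : leadIndex p = leadIndex p')
    (h' : p.1.1 = p'.1.1) : p = p' := by
  obtain ⟨h1, h2, h3⟩ := schurIndex_facts p
  obtain ⟨h1', h2', h3'⟩ := schurIndex_facts p'
  have h0 := congrArg Subtype.val h
  have e0 := congrFun h0 0
  have e1 := congrFun h0 1
  have e2 := congrFun h0 2
  simp [leadIndex] at e0 e1 e2
  refine Subtype.ext (Prod.ext h' (_root_.funext fun j => ?_))
  fin_cases j <;> simp <;> omega

lemma exists_leadIndex_eq (l : WeightIndex 3 m) {c : ℕ} (hc : Admissible l.1 c) :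
    ∃ p : SchurIndex m, leadIndex p = l ∧ p.1.1 = c := by
  obtain ⟨h1, h2, h3⟩ := hc
  have hl := weightIndex_iff.1 l.2
  refine ⟨⟨(c, ![l.1 0, l.1 1 + c, l.1 2 - c]), ?_, ?_, ?_⟩, ?_, rfl⟩
  -- From l 0 ≥ l 1 + 2c and l 2 ≥ c one gets m ≥ 3 l 1 + 5c, so the bound γ ≤ m / 5 follows from
  -- the other conditions.
  · rw [le_div_iff₀ (by norm_num)]
    have : c * 5 ≤ m := by omega
    exact_mod_cast this
  · simp
    omega
  · intro i j hij
    fin_cases i <;> fin_cases j <;> simp at hij ⊢ <;> omega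
  · refine Subtype.ext (_root_.funext fun j => ?_)
    fin_cases j <;> simp [leadIndex]
    omega

lemma map_diag_eq_flagPart (p : SchurIndex m) :
    (SchurDual p.1.2 (Cn 3)).map (diag p.1.2) = flagPart (leadIndex p).1 p.1.1 := by
  obtain ⟨h1, h2, h3⟩ := schurIndex_facts p
  rw [flagPart]
  apply map_diag_schurDual <;> simp [leadIndex] <;> omega

/-- The leading form attached to an element of the copy of `Γ^lam` of index `p`. -/
def schurToLead (p : SchurIndex m) :
    SchurDual p.1.2 (Cn 3) →ₗ[ℂ] leadForms m (leadIndex p).1 :=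
  LinearMap.codRestrict _ (((polarEnd 2 1) ^ p.1.1) ∘ₗ diag p.1.2 ∘ₗ (SchurDual p.1.2 (Cn 3)).subtype)
    fun M => polar_pow_mem_leadForms_of_mem_flagPart (weightIndex_iff.1 (leadIndex p).2)
      (admissible_leadIndex p) (map_diag_eq_flagPart p ▸ Submodule.mem_map_of_mem M.2)

lemma coe_schurToLead (p : SchurIndex m) (M : SchurDual p.1.2 (Cn 3)) :
    (schurToLead p M : JetPoly) = ((polarEnd 2 1) ^ p.1.1) (diag p.1.2 M) := rfl

/-- The direct sum of the spaces of leading forms. -/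
abbrev LeadSum (m : ℕ) : Type := ⨁ l : WeightIndex 3 m, leadForms m l.1

/-- The map from the sum of the Schur functors to the sum of the leading forms. -/
def schurSumToLead (m : ℕ) :
    (⨁ p : SchurIndex m, SchurDual p.1.2 (Cn 3)) →ₗ[ℂ] LeadSum m :=
  DirectSum.toModule ℂ _ _ fun p =>
    DirectSum.lof ℂ (WeightIndex 3 m) (fun l => leadForms m l.1) (leadIndex p) ∘ₗ schurToLead p

lemma schurSumToLead_lof (p : SchurIndex m) (M : SchurDual p.1.2 (Cn 3)) :
    schurSumToLead m (DirectSum.lof ℂ _ _ p M) =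
      DirectSum.lof ℂ (WeightIndex 3 m) (fun l => leadForms m l.1) (leadIndex p)
        (schurToLead p M) := by
  rw [schurSumToLead, DirectSum.toModule_lof]
  rfl

lemma coe_lof_apply (l l' : WeightIndex 3 m) (P : leadForms m l.1) :
    ((DirectSum.lof ℂ (WeightIndex 3 m) (fun l => leadForms m l.1) l P) l' : JetPoly) =
      if l = l' then (P : JetPoly) else 0 := by
  split_ifs with h
  · subst h
    rw [DirectSum.lof_apply]
  · rw [DirectSum.lof_eq_of, DirectSum.of_eq_of_ne _ _ _ (Ne.symm h)]
    rfl

lemma coe_schurSumToLead_apply (x : ⨁ p : SchurIndex m, SchurDual p.1.2 (Cn 3))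
    [∀ (p : SchurIndex m) (M : SchurDual p.1.2 (Cn 3)), Decidable (M ≠ 0)]
    (l : WeightIndex 3 m) :
    (schurSumToLead m x l : JetPoly) = ∑ p ∈ DFinsupp.support x,
      if leadIndex p = l then ((polarEnd 2 1) ^ p.1.1) (diag p.1.2 (x p)) else 0 := by
  conv_lhs => rw [← DirectSum.sum_support_of x, map_sum, DFinsupp.finsetSum_apply]
  rw [AddSubmonoidClass.coe_finsetSum]
  refine Finset.sum_congr rfl fun p _ => ?_
  rw [← coe_schurToLead, ← coe_lof_apply, ← schurSumToLead_lof]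
  rfl

lemma eq_zero_of_schurSumToLead_eq_zero {x : ⨁ p : SchurIndex m, SchurDual p.1.2 (Cn 3)}
    (hx : schurSumToLead m x = 0) : x = 0 := by
  classical
  have hsum : ∀ l : WeightIndex 3 m, ∑ p ∈ DFinsupp.support x,
      (if leadIndex p = l then ((polarEnd 2 1) ^ p.1.1) (diag p.1.2 (x p)) else 0) = 0 := by
    intro l
    rw [← coe_schurSumToLead_apply, hx]
    rfl
  have hzero : ∀ p ∈ DFinsupp.support x, x p = 0 := by
    intro p₀ hp₀
    let l := leadIndex p₀
    -- Within one multidegree, the terms are regrouped by γ. Each sum has at most one nonzero term,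
    -- since multidegree and γ determine the index.
    let f : ℕ → JetPoly := fun c => ∑ p ∈ DFinsupp.support x,
      if leadIndex p = l ∧ p.1.1 = c then diag p.1.2 (x p) else 0
    have hf1 : ∀ c, Admissible l.1 c → f c ∈ flagPart l.1 c := by
      intro c _
      refine Submodule.sum_mem _ fun p _ => ?_
      split_ifs with h
      · rw [← h.1, ← h.2, ← map_diag_eq_flagPart]
        exact Submodule.mem_map_of_mem (x p).2
      · exact zero_mem _
    have hf2 : ∀ c, ¬ Admissible l.1 c → f c = 0 := by
      intro c hc
      refine Finset.sum_eq_zero fun p _ => if_neg fun h => hc ?_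
      rw [← h.1, ← h.2]
      exact admissible_leadIndex p
    have hf3 : ∑ c ∈ Finset.range (l.1 2 + 1), ((polarEnd 2 1) ^ c) (f c) = 0 := by
      rw [← hsum l]
      simp only [f, map_sum]
      rw [Finset.sum_comm]
      refine Finset.sum_congr rfl fun p _ => ?_
      by_cases hp : leadIndex p = l
      · rw [if_pos hp, Finset.sum_eq_single p.1.1]
        · simp [hp]
        · intro c _ hc
          rw [if_neg fun h => hc h.2.symm, map_zero]
        · intro hc
          exfalso
          apply hc
          have := (admissible_leadIndex p).1
          rw [hp] at this
          exact Finset.mem_range.2 (by omega)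
      · simp [hp]
    have hf := eq_zero_of_sum_polar_eq_zero hf1 hf2 hf3 p₀.1.1
      (by have : p₀.1.1 ≤ l.1 2 := (admissible_leadIndex p₀).1
          omega)
    have hf' : f p₀.1.1 = diag p₀.1.2 (x p₀) := by
      simp only [f]
      rw [Finset.sum_eq_single_of_mem p₀ hp₀]
      · simp [l]
      · intro p _ hp
        exact if_neg fun h => hp (leadIndex_injective h.1 h.2)
    rw [hf'] at hf
    exact Subtype.ext (diag_injective_of_mem_schurDual (x p₀).2 hf)
  refine DFinsupp.ext fun p => ?_
  by_cases hp : p ∈ DFinsupp.support x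
  · exact hzero p hp
  · exact DFinsupp.notMem_support_iff.1 hp

lemma schurSumToLead_injective (m : ℕ) : Function.Injective (schurSumToLead m) := by
  intro x y hxy
  have h : x + (-1 : ℂ) • y = 0 := eq_zero_of_schurSumToLead_eq_zero (by
    rw [map_add, map_smul, hxy]
    nth_rewrite 1 [← one_smul ℂ (schurSumToLead m y)]
    rw [← add_smul, add_neg_cancel, zero_smul])
  refine DFinsupp.ext fun p => ?_
  have hp : (x p : CellForms p.1.2 (Cn 3)) + (-1 : ℂ) • (y p : CellForms p.1.2 (Cn 3)) = 0 :=
    congrArg Subtype.val (DFunLike.congr_fun h p)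
  rw [neg_one_smul, add_neg_eq_zero] at hp
  exact Subtype.ext hp

lemma schurSumToLead_surjective (m : ℕ) : Function.Surjective (schurSumToLead m) := by
  classical
  rw [← LinearMap.range_eq_top, eq_top_iff]
  intro y _
  induction y using DirectSum.induction_on with
  | zero => exact zero_mem _
  | add y z hy hz => exact add_mem (hy trivial) (hz trivial)
  | of l P =>
    obtain ⟨f, hf1, hf2, hf3⟩ := exists_decomposition (weightIndex_iff.1 l.2) P.2
    have hmem : ∀ c, ∃ hc : ((polarEnd 2 1) ^ c) (f c) ∈ leadForms m l.1,
        DirectSum.lof ℂ (WeightIndex 3 m) (fun l => leadForms m l.1) l ⟨_, hc⟩ ∈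
          LinearMap.range (schurSumToLead m) := by
      intro c
      by_cases hc : Admissible l.1 c
      · refine ⟨polar_pow_mem_leadForms_of_mem_flagPart (weightIndex_iff.1 l.2) hc (hf1 c hc), ?_⟩
        obtain ⟨p, rfl, rfl⟩ := exists_leadIndex_eq l hc
        have h1 := hf1 _ hc
        rw [← map_diag_eq_flagPart] at h1
        obtain ⟨M, hM, hMf⟩ := h1
        refine ⟨DirectSum.lof ℂ _ _ p ⟨M, hM⟩, ?_⟩
        rw [schurSumToLead_lof]
        congr 1
        exact Subtype.ext (by rw [coe_schurToLead, hMf])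
      · refine ⟨by rw [hf2 c hc, map_zero]; exact zero_mem _, ?_⟩
        have h0 : (⟨((polarEnd 2 1) ^ c) (f c), by rw [hf2 c hc, map_zero]; exact zero_mem _⟩ :
            leadForms m l.1) = 0 := Subtype.ext (by
              change ((polarEnd 2 1) ^ c) (f c) = 0
              rw [hf2 c hc, map_zero])
        rw [h0, map_zero]
        exact zero_mem _
    choose h1 h2 using hmem
    have hP : P = ∑ c ∈ Finset.range (l.1 2 + 1), (⟨_, h1 c⟩ : leadForms m l.1) := by
      refine Subtype.ext ?_
      rw [hf3, AddSubmonoidClass.coe_finsetSum]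
    change DirectSum.lof ℂ (WeightIndex 3 m) (fun l => leadForms m l.1) l P ∈ _
    rw [hP, map_sum]
    exact Submodule.sum_mem _ fun c _ => h2 c

/-- The sum of the leading forms is the sum of the Schur functors. -/
def leadSumEquiv (m : ℕ) : LeadSum m ≃ₗ[ℂ] ⨁ p : SchurIndex m, SchurDual p.1.2 (Cn 3) :=
  (LinearEquiv.ofBijective (schurSumToLead m)
    ⟨schurSumToLead_injective m, schurSumToLead_surjective m⟩).symm

end Model

/-! ### Third order jets of composite maps -/

section Calculus

lemma iteratedDeriv_two_eq (f : ℂ → ℂ) : iteratedDeriv 2 f = deriv (deriv f) := by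
  rw [iteratedDeriv_succ', iteratedDeriv_one]

lemma iteratedDeriv_three_eq (f : ℂ → ℂ) : iteratedDeriv 3 f = deriv (deriv (deriv f)) := by
  rw [iteratedDeriv_succ', iteratedDeriv_two_eq]

/-- The partial derivative of a function on `ℂ³`. -/
def partialDeriv (a : Fin 3) (G : Cn 3 → ℂ) (z : Cn 3) : ℂ := fderiv ℂ G z (Pi.single a 1)

lemma analyticAt_partialDeriv {G : Cn 3 → ℂ} {z : Cn 3} (hG : AnalyticAt ℂ G z) (a : Fin 3) :
    AnalyticAt ℂ (partialDeriv a G) z :=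
  ((ContinuousLinearMap.apply ℂ ℂ (Pi.single a 1 : Cn 3)).analyticAt _).comp hG.fderiv

variable {h : ℂ → Cn 3} {z : Cn 3}

lemma analyticAt_coord {s : ℂ} (hh : AnalyticAt ℂ h s) (a : Fin 3) :
    AnalyticAt ℂ (fun t => h t a) s :=
  ((ContinuousLinearMap.proj (R := ℂ) (φ := fun _ : Fin 3 => ℂ) a).analyticAt _).comp hh

lemma deriv_comp_curve {G : Cn 3 → ℂ} {s : ℂ} (hG : AnalyticAt ℂ G (h s)) (hh : AnalyticAt ℂ h s) :
    deriv (fun t => G (h t)) s = ∑ a, partialDeriv a G (h s) * deriv (fun t => h t a) s := by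
  have h1 : HasDerivAt h (fun a => deriv (fun t => h t a) s) s :=
    hasDerivAt_pi.2 fun a => (analyticAt_coord hh a).differentiableAt.hasDerivAt
  have h2 := (hG.differentiableAt.hasFDerivAt.comp_hasDerivAt s h1).deriv
  rw [show (fun t => G (h t)) = G ∘ h from rfl, h2]
  conv_lhs => rw [pi_eq_sum_univ' (fun a => deriv (fun t => h t a) s)]
  rw [map_sum]
  refine Finset.sum_congr rfl fun a _ => ?_
  rw [map_smul, smul_eq_mul, mul_comm]
  rfl

lemma eventually_deriv_comp_curve {G : Cn 3 → ℂ} (hG : AnalyticAt ℂ G (h 0))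
    (hh : AnalyticAt ℂ h 0) : deriv (fun t => G (h t)) =ᶠ[𝓝 0]
      fun s => ∑ a, partialDeriv a G (h s) * deriv (fun t => h t a) s := by
  filter_upwards [hh.continuousAt.eventually hG.eventually_analyticAt, hh.eventually_analyticAt]
    with s h1 h2
  exact deriv_comp_curve h1 h2

lemma eventually_deriv_mul {f g : ℂ → ℂ} (hf : AnalyticAt ℂ f 0) (hg : AnalyticAt ℂ g 0) :
    deriv (fun s => f s * g s) =ᶠ[𝓝 0] fun s => deriv f s * g s + f s * deriv g s := by
  filter_upwards [hf.eventually_analyticAt, hg.eventually_analyticAt] with s h1 h2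
  exact deriv_fun_mul h1.differentiableAt h2.differentiableAt

lemma eventually_deriv_sum {ι : Type*} [Fintype ι] {f : ι → ℂ → ℂ}
    (hf : ∀ i, AnalyticAt ℂ (f i) 0) :
    deriv (fun s => ∑ i, f i s) =ᶠ[𝓝 0] fun s => ∑ i, deriv (f i) s := by
  have := Filter.eventually_all.2 fun i => (hf i).eventually_analyticAt
  filter_upwards [this] with s h1
  exact deriv_fun_sum fun i _ => (h1 i).differentiableAt

lemma eventually_jet_two_comp {G : Cn 3 → ℂ} (hG : AnalyticAt ℂ G (h 0))
    (hh : AnalyticAt ℂ h 0) : deriv (deriv (fun t => G (h t))) =ᶠ[𝓝 0] fun s =>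
      ∑ a, ((∑ b, partialDeriv b (partialDeriv a G) (h s) * deriv (fun t => h t b) s) *
        deriv (fun t => h t a) s + partialDeriv a G (h s) * deriv (deriv (fun t => h t a)) s) := by
  have hc := fun a => analyticAt_coord hh a
  have hP : ∀ a, AnalyticAt ℂ (fun s => partialDeriv a G (h s)) 0 := fun a =>
    (analyticAt_partialDeriv hG a).comp hh
  refine (eventually_deriv_comp_curve hG hh).deriv.trans ?_
  refine (eventually_deriv_sum fun a => (hP a).fun_mul (hc a).deriv).trans ?_
  have h1 := Filter.eventually_all.2 fun a => eventually_deriv_mul (hP a) (hc a).deriv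
  have h2 := Filter.eventually_all.2 fun a =>
    eventually_deriv_comp_curve (analyticAt_partialDeriv hG a) hh
  filter_upwards [h1, h2] with s h1 h2
  exact Finset.sum_congr rfl fun a _ => by rw [h1 a, h2 a]

/-- The chain rule to third order, with mixed partial derivatives kept in the order in which they
arise, so their symmetry is not needed. -/
lemma jet_three_comp {G : Cn 3 → ℂ} (hG : AnalyticAt ℂ G (h 0)) (hh : AnalyticAt ℂ h 0) :
    deriv (deriv (deriv (fun t => G (h t)))) 0 =
      ∑ a, ((∑ b, ((∑ c, partialDeriv c (partialDeriv b (partialDeriv a G)) (h 0) *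
          deriv (fun t => h t c) 0) * deriv (fun t => h t b) 0 +
          partialDeriv b (partialDeriv a G) (h 0) * deriv (deriv (fun t => h t b)) 0)) *
        deriv (fun t => h t a) 0 +
        (∑ b, partialDeriv b (partialDeriv a G) (h 0) * deriv (fun t => h t b) 0) *
        deriv (deriv (fun t => h t a)) 0 +
        ((∑ b, partialDeriv b (partialDeriv a G) (h 0) * deriv (fun t => h t b) 0) *
        deriv (deriv (fun t => h t a)) 0 +
        partialDeriv a G (h 0) * deriv (deriv (deriv (fun t => h t a))) 0)) := by
  have hc := fun a => analyticAt_coord hh a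
  have hP : ∀ a, AnalyticAt ℂ (fun s => partialDeriv a G (h s)) 0 := fun a =>
    (analyticAt_partialDeriv hG a).comp hh
  have hPP : ∀ a b, AnalyticAt ℂ (fun s => partialDeriv b (partialDeriv a G) (h s)) 0 :=
    fun a b => (analyticAt_partialDeriv (analyticAt_partialDeriv hG a) b).comp hh
  have hS : ∀ a, AnalyticAt ℂ (fun s => ∑ b, partialDeriv b (partialDeriv a G) (h s) *
      deriv (fun t => h t b) s) 0 := fun a =>
    Finset.analyticAt_fun_sum _ fun b _ => (hPP a b).fun_mul (hc b).deriv
  have h1 : ∀ a, DifferentiableAt ℂ (fun s => (∑ b, partialDeriv b (partialDeriv a G) (h s) *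
      deriv (fun t => h t b) s) * deriv (fun t => h t a) s) 0 := fun a =>
    ((hS a).fun_mul (hc a).deriv).differentiableAt
  have h2 : ∀ a, DifferentiableAt ℂ (fun s => partialDeriv a G (h s) *
      deriv (deriv (fun t => h t a)) s) 0 := fun a =>
    ((hP a).fun_mul (hc a).deriv.deriv).differentiableAt
  rw [(eventually_jet_two_comp hG hh).deriv_eq, deriv_fun_sum fun a _ => (h1 a).fun_add (h2 a)]
  refine Finset.sum_congr rfl fun a _ => ?_
  rw [deriv_fun_add (h1 a) (h2 a),
    deriv_fun_mul (hS a).differentiableAt (hc a).deriv.differentiableAt,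
    deriv_fun_mul (hP a).differentiableAt (hc a).deriv.deriv.differentiableAt,
    deriv_fun_sum fun b _ => ((hPP a b).fun_mul (hc b).deriv).differentiableAt,
    deriv_comp_curve (analyticAt_partialDeriv hG a) hh]
  congr 3
  refine Finset.sum_congr rfl fun b _ => ?_
  rw [deriv_fun_mul (hPP a b).differentiableAt (hc b).deriv.differentiableAt,
    deriv_comp_curve (analyticAt_partialDeriv (analyticAt_partialDeriv hG a) b) hh]

/-- Derivatives of `g ∘ φ` for `φ 0 = 0`. -/
lemma jets_reparam {g φ : ℂ → ℂ} (hg : AnalyticAt ℂ g 0) (hφ : AnalyticAt ℂ φ 0) (h0 : φ 0 = 0) :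
    deriv (fun t => g (φ t)) 0 = deriv φ 0 * deriv g 0 ∧
    deriv (deriv (fun t => g (φ t))) 0 =
      deriv φ 0 ^ 2 * deriv (deriv g) 0 + deriv (deriv φ) 0 * deriv g 0 ∧
    deriv (deriv (deriv (fun t => g (φ t)))) 0 =
      deriv φ 0 ^ 3 * deriv (deriv (deriv g)) 0
        + 3 * deriv φ 0 * deriv (deriv φ) 0 * deriv (deriv g) 0
        + deriv (deriv (deriv φ)) 0 * deriv g 0 := by
  have key : ∀ {g : ℂ → ℂ}, AnalyticAt ℂ g 0 →
      deriv (fun t => g (φ t)) =ᶠ[𝓝 0] fun s => deriv g (φ s) * deriv φ s := by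
    intro g hg
    rw [← h0] at hg
    filter_upwards [hφ.continuousAt.eventually hg.eventually_analyticAt, hφ.eventually_analyticAt]
      with s h1 h2
    exact deriv_comp s h1.differentiableAt h2.differentiableAt
  have hcomp : ∀ {g : ℂ → ℂ}, AnalyticAt ℂ g 0 → AnalyticAt ℂ (fun s => g (φ s)) 0 := by
    intro g hg
    rw [← h0] at hg
    exact hg.comp hφ
  have h2 : deriv (deriv (fun t => g (φ t))) =ᶠ[𝓝 0] fun s =>
      deriv (deriv g) (φ s) * deriv φ s * deriv φ s + deriv g (φ s) * deriv (deriv φ) s := by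
    refine (key hg).deriv.trans ((eventually_deriv_mul (hcomp hg.deriv) hφ.deriv).trans ?_)
    filter_upwards [key hg.deriv] with s hs
    rw [hs]
  refine ⟨?_, ?_, ?_⟩
  · refine (key hg).self_of_nhds.trans ?_
    simp only [h0]
    ring
  · refine h2.self_of_nhds.trans ?_
    simp only [h0]
    ring
  · have e1 : deriv (fun s => deriv g (φ s)) 0 = deriv (deriv g) 0 * deriv φ 0 :=
      (key hg.deriv).self_of_nhds.trans (by simp only [h0])
    have e2 : deriv (fun s => deriv (deriv g) (φ s)) 0 = deriv (deriv (deriv g)) 0 * deriv φ 0 :=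
      (key hg.deriv.deriv).self_of_nhds.trans (by simp only [h0])
    have a1 := hφ.deriv.differentiableAt
    have a2 := (hcomp hg.deriv.deriv).differentiableAt
    have a3 := (hcomp hg.deriv).differentiableAt
    have a4 := hφ.deriv.deriv.differentiableAt
    rw [h2.deriv_eq, deriv_fun_add ((a2.fun_mul a1).fun_mul a1) (a3.fun_mul a4),
      deriv_fun_mul (a2.fun_mul a1) a1, deriv_fun_mul a2 a1, deriv_fun_mul a3 a4, e1, e2, h0]
    ring

end Calculus

/-! ### The action of holomorphic maps on polynomials in jets -/

/-- The `3`-jet at `0` of a curve in `ℂ³`. -/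
def jet (h : ℂ → Cn 3) : Fin 3 × Fin 3 → ℂ :=
  fun ji => iteratedDeriv (ji.1 + 1) (fun t => h t ji.2) 0

/-- The substitution of a linear map into the three vectors. -/
def jetLin (A : Cn 3 →ₗ[ℂ] Cn 3) : JetPoly →ₐ[ℂ] JetPoly :=
  aeval fun t => ∑ a, C (A (Pi.single a 1) t.2) * X (t.1, a)

/-- The polynomial expression of the derivatives of `τ ∘ h` in those of `h`. -/
def jetPullVar (τ : Cn 3 → Cn 3) (z : Cn 3) (t : Fin 3 × Fin 3) : JetPoly :=
  (∑ a, C (partialDeriv a (fun y => τ y t.2) z) * X (t.1, a)) +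
  (![0, ∑ a, ∑ b, C (partialDeriv b (partialDeriv a fun y => τ y t.2) z) * (X (0, b) * X (0, a)),
    (∑ a, ∑ b, C (partialDeriv b (partialDeriv a fun y => τ y t.2) z) *
      (X (0, a) * X (1, b) + C 2 * (X (0, b) * X (1, a)))) +
    ∑ a, ∑ b, ∑ c, C (partialDeriv c (partialDeriv b (partialDeriv a fun y => τ y t.2)) z) *
      (X (0, c) * X (0, b) * X (0, a))] : Fin 3 → JetPoly) t.1

/-- The substitution of the derivatives of `τ ∘ h` into a polynomial. -/
def jetPull (τ : Cn 3 → Cn 3) (z : Cn 3) : JetPoly →ₐ[ℂ] JetPoly := aeval (jetPullVar τ z)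

lemma eval_jetPull {τ : Cn 3 → Cn 3} {h : ℂ → Cn 3} (hτ : AnalyticAt ℂ τ (h 0))
    (hh : AnalyticAt ℂ h 0) (q : JetPoly) :
    eval (jet h) (jetPull τ (h 0) q) = eval (jet fun t => τ (h t)) q := by
  have hvar : ∀ t, eval (jet h) (jetPullVar τ (h 0) t) = jet (fun t => τ (h t)) t := by
    rintro ⟨j, i⟩
    have hG : AnalyticAt ℂ (fun y => τ y i) (h 0) :=
      ((ContinuousLinearMap.proj (R := ℂ) (φ := fun _ : Fin 3 => ℂ) i).analyticAt _).comp hτ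
    fin_cases j
    · have h1 := deriv_comp_curve hG hh
      simp [jetPullVar, jet, h1]
    · have h1 := (eventually_jet_two_comp hG hh).self_of_nhds
      simp only [jetPullVar, jet, iteratedDeriv_two_eq, iteratedDeriv_one, map_add, map_sum,
        Fin.mk_one, Fin.isValue, Matrix.cons_val_one, Matrix.cons_val_zero, map_mul, eval_C, eval_X,
        Fin.val_one, Fin.val_zero, Nat.reduceAdd] at h1 ⊢
      rw [h1]
      simp only [Fin.sum_univ_three]
      ring
    · have h1 := jet_three_comp hG hh
      simp only [jetPullVar, jet, iteratedDeriv_two_eq, iteratedDeriv_one, iteratedDeriv_three_eq,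
        map_add, map_sum, Fin.reduceFinMk, Fin.isValue, Matrix.cons_val, map_mul, eval_C, eval_X,
        Fin.val_one, Fin.val_zero, Fin.val_two, Nat.reduceAdd] at h1 ⊢
      rw [h1]
      simp only [Fin.sum_univ_three]
      ring
  induction q using MvPolynomial.induction_on with
  | C a => simp [jetPull]
  | add p q hp hq => simp only [map_add, hp, hq]
  | mul_X p t hp =>
    simp only [map_mul, hp, eval_X]
    rw [jetPull, aeval_X, hvar]

/-! ### The leading part of a holomorphic substitution -/

lemma LeadsTo.pow {l : Fin 3 → ℕ} {P Q : JetPoly} (h : LeadsTo l P Q) (n : ℕ) :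
    LeadsTo (n • l) (P ^ n) (Q ^ n) := by
  induction n with
  | zero => simpa using LeadsTo.one
  | succ n ih =>
    rw [pow_succ, pow_succ, add_smul, one_smul]
    exact ih.mul h

lemma LeadsTo.prod {ι : Type*} (s : Finset ι) {l : ι → Fin 3 → ℕ} {P Q : ι → JetPoly}
    (h : ∀ i, LeadsTo (l i) (P i) (Q i)) :
    LeadsTo (∑ i ∈ s, l i) (∏ i ∈ s, P i) (∏ i ∈ s, Q i) := by
  classical
  induction s using Finset.induction_on with
  | empty => simpa using LeadsTo.one
  | insert a s ha ih =>
    rw [Finset.sum_insert ha, Finset.prod_insert ha, Finset.prod_insert ha]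
    exact (h a).mul ih

lemma LeadsTo.sum {ι : Type*} (s : Finset ι) {l : Fin 3 → ℕ} {P Q : ι → JetPoly}
    (h : ∀ i ∈ s, LeadsTo l (P i) (Q i)) :
    LeadsTo l (∑ i ∈ s, P i) (∑ i ∈ s, Q i) := by
  classical
  induction s using Finset.induction_on with
  | empty => simpa using LeadsTo.zero l
  | insert a s ha ih =>
    rw [Finset.sum_insert ha, Finset.sum_insert ha]
    exact (h a (Finset.mem_insert_self a s)).add
      (ih fun i hi => h i (Finset.mem_insert_of_mem hi))

lemma hasWeight_X (j i : Fin 3) : HasWeight (intDeg (Pi.single j 1)) (X (j, i)) := by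
  intro k
  rw [polar_X]
  by_cases h : j = k
  · subst h
    simp [intDeg]
  · simp [intDeg, h, Ne.symm h]

lemma C_mul_eq_smul' (a : ℂ) (P : JetPoly) : C a * P = a • P := (smul_eq_C_mul P a).symm

/-- The linear map underlying the leading part of `jetPull`. -/
def HasMatrix (τ : Cn 3 → Cn 3) (z : Cn 3) (A : Cn 3 →ₗ[ℂ] Cn 3) : Prop :=
  ∀ a i, partialDeriv a (fun y => τ y i) z = A (Pi.single a 1) i

/-- The terms with higher derivatives of τ are quadratic in f' for f'', and products of f' and f''
or cubic in f' for f'''. They lack the highest derivative, so they are lower whatever their total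
degree. -/
lemma leadsTo_jetPullVar {τ : Cn 3 → Cn 3} {z : Cn 3} {A : Cn 3 →ₗ[ℂ] Cn 3}
    (hA : HasMatrix τ z A) (t : Fin 3 × Fin 3) :
    LeadsTo (Pi.single t.1 1) (∑ a, C (A (Pi.single a 1) t.2) * X (t.1, a))
      (jetPullVar τ z t) := by
  obtain ⟨j, i⟩ := t
  have h1 : ∀ l : Fin 3 → ℕ, ∀ a b c d : Fin 3, ∀ r : ℂ,
      toColex (Pi.single a 1 + Pi.single c 1) < toColex l →
      C r * (X (a, b) * X (c, d)) ∈ below l := by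
    intro l a b c d r hl
    rw [C_mul_eq_smul']
    refine Submodule.smul_mem _ _ (HasWeight.mem_below ?_ hl)
    convert (hasWeight_X a b).mul (hasWeight_X c d) using 1
    ext k
    simp [intDeg]
  have h2 : ∀ l : Fin 3 → ℕ, ∀ a b c : Fin 3, ∀ r : ℂ,
      toColex (Pi.single 0 3) < toColex l →
      C r * (X (0, a) * X (0, b) * X (0, c)) ∈ below l := by
    intro l a b c r hl
    rw [C_mul_eq_smul']
    refine Submodule.smul_mem _ _ (HasWeight.mem_below ?_ hl)
    convert ((hasWeight_X 0 a).mul (hasWeight_X 0 b)).mul (hasWeight_X 0 c) using 1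
    ext k
    fin_cases k <;> simp [intDeg]
  refine ⟨?_, ?_⟩
  · refine (LeadsTo.sum _ (Q := fun a => C (A (Pi.single a 1) i) * X (j, a)) fun a _ => ?_).1
    rw [C_mul_eq_smul']
    exact (LeadsTo.of_hasWeight (hasWeight_X j a)).smul _
  · rw [jetPullVar]
    simp only [hA _ _]
    rw [add_sub_cancel_left]
    fin_cases j
    · simp
    · simp only [Fin.mk_one, Fin.isValue, Matrix.cons_val_one, Matrix.cons_val_zero]
      refine Submodule.sum_mem _ fun a _ => Submodule.sum_mem _ fun b _ => ?_
      exact h1 _ _ _ _ _ _ (by rw [colex_lt_iff]; simp)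
    · simp only [Fin.reduceFinMk, Fin.isValue, Matrix.cons_val]
      refine add_mem ?_ ?_
      · refine Submodule.sum_mem _ fun a _ => Submodule.sum_mem _ fun b _ => ?_
        rw [mul_add, ← mul_assoc (C _) (C 2), ← C_mul]
        exact add_mem (h1 _ _ _ _ _ _ (by rw [colex_lt_iff]; simp))
          (h1 _ _ _ _ _ _ (by rw [colex_lt_iff]; simp))
      · refine Submodule.sum_mem _ fun a _ => Submodule.sum_mem _ fun b _ =>
          Submodule.sum_mem _ fun c _ => h2 _ _ _ _ _ (by rw [colex_lt_iff]; simp)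

lemma leadsTo_jetPull_monomial {τ : Cn 3 → Cn 3} {z : Cn 3} {A : Cn 3 →ₗ[ℂ] Cn 3}
    (hA : HasMatrix τ z A) (s : Fin 3 × Fin 3 →₀ ℕ) (r : ℂ) :
    LeadsTo (fun j => ∑ i, s (j, i)) (jetLin A (monomial s r)) (jetPull τ z (monomial s r)) := by
  rw [jetLin, jetPull, aeval_monomial, aeval_monomial, ← Algebra.smul_def, ← Algebra.smul_def]
  refine LeadsTo.smul ?_ r
  rw [Finsupp.prod_fintype _ _ (by simp), Finsupp.prod_fintype _ _ (by simp)]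
  convert LeadsTo.prod Finset.univ fun t => (leadsTo_jetPullVar hA t).pow (s t) using 1
  rw [Fintype.sum_prod_type, Finset.sum_comm]
  ext j
  simp [Finset.sum_apply, Pi.single_apply]

lemma jetPull_mem_below {τ : Cn 3 → Cn 3} {z : Cn 3} {A : Cn 3 →ₗ[ℂ] Cn 3}
    (hA : HasMatrix τ z A) {l : Fin 3 → ℕ} {q : JetPoly} (hq : q ∈ below l) :
    jetPull τ z q ∈ below l := by
  rw [q.as_sum, map_sum]
  refine Submodule.sum_mem _ fun s hs => mem_below.2 fun t ht => ?_
  have h1 := mem_below.1 hq s (mem_support_iff.1 hs)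
  exact (mem_upTo.1 (leadsTo_jetPull_monomial hA s _).mem_upTo t ht).trans_lt h1

/-- On leading forms only the Jacobian matrix of τ acts, so the graded bundle is built from the
cotangent bundle. -/
lemma leadsTo_jetPull {τ : Cn 3 → Cn 3} {z : Cn 3} {A : Cn 3 →ₗ[ℂ] Cn 3}
    (hA : HasMatrix τ z A) {l : Fin 3 → ℕ} {P q : JetPoly} (h : LeadsTo l P q) :
    LeadsTo l (jetLin A P) (jetPull τ z q) := by
  have h1 : LeadsTo l (jetLin A P) (jetPull τ z P) := by
    rw [P.as_sum, map_sum, map_sum]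
    refine LeadsTo.sum _ fun s hs => ?_
    have h2 := h.1.multidegree_eq (mem_support_iff.1 hs)
    rw [multidegree_eq] at h2
    rw [← toColex_inj.1 h2]
    exact leadsTo_jetPull_monomial hA s _
  refine ⟨h1.1, ?_⟩
  have h2 := add_mem h1.2 (jetPull_mem_below hA h.2)
  convert h2 using 1
  rw [map_sub]
  ring

lemma jetPull_mem_upTo {τ : Cn 3 → Cn 3} {z : Cn 3} {A : Cn 3 →ₗ[ℂ] Cn 3}
    (hA : HasMatrix τ z A) {l : Fin 3 → ℕ} {q : JetPoly} (hq : q ∈ upTo l) :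
    jetPull τ z q ∈ upTo l := (leadsTo_jetPull hA (leadsTo_comp hq)).mem_upTo

lemma comp_jetPull {τ : Cn 3 → Cn 3} {z : Cn 3} {A : Cn 3 →ₗ[ℂ] Cn 3}
    (hA : HasMatrix τ z A) {l : Fin 3 → ℕ} {q : JetPoly} (hq : q ∈ upTo l) :
    comp (intDeg l) (jetPull τ z q) = jetLin A (comp (intDeg l) q) :=
  (leadsTo_jetPull hA (leadsTo_comp hq)).comp_eq

/-- Polarizations act on the index of the derivative and linear substitutions on the index of the
coordinate, so the two commute. -/
lemma polar_jetLin (A : Cn 3 →ₗ[ℂ] Cn 3) (a b : Fin 3) (P : JetPoly) :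
    polar a b (jetLin A P) = jetLin A (polar a b P) := by
  induction P using MvPolynomial.induction_on with
  | C r =>
    rw [← algebraMap_eq, AlgHom.commutes, Derivation.map_algebraMap, map_zero]
  | add P Q hP hQ => simp only [map_add, hP, hQ]
  | mul_X P t hP =>
    obtain ⟨j, i⟩ := t
    have hX : polar a b (jetLin A (X (j, i))) = jetLin A (polar a b (X (j, i))) := by
      rw [polar_X]
      split_ifs with h
      · subst h
        simp only [jetLin, aeval_X, map_sum, Derivation.leibniz, polar_X, if_true, smul_eq_mul]
        refine Finset.sum_congr rfl fun k _ => ?_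
        rw [← algebraMap_eq, Derivation.map_algebraMap]
        ring
      · simp only [jetLin, aeval_X, map_sum, Derivation.leibniz, polar_X, if_neg h, smul_eq_mul,
          map_zero]
        refine Finset.sum_eq_zero fun k _ => ?_
        rw [← algebraMap_eq, Derivation.map_algebraMap]
        ring
    rw [map_mul, Derivation.leibniz, hP, hX, Derivation.leibniz]
    simp only [smul_eq_mul, map_add, map_mul]

lemma polarEnd_pow_jetLin (A : Cn 3 →ₗ[ℂ] Cn 3) (a b : Fin 3) (k : ℕ) (P : JetPoly) :
    ((polarEnd a b) ^ k) (jetLin A P) = jetLin A (((polarEnd a b) ^ k) P) := by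
  induction k with
  | zero => simp
  | succ k ih =>
    rw [pow_succ', Module.End.mul_apply, ih, polarEnd_apply, polar_jetLin, Module.End.mul_apply,
      polarEnd_apply]

lemma eval_jetLin (A : Cn 3 →ₗ[ℂ] Cn 3) (x : Fin 3 × Fin 3 → ℂ) (P : JetPoly) :
    eval x (jetLin A P) = eval (fun t => A (fun i => x (t.1, i)) t.2) P := by
  induction P using MvPolynomial.induction_on with
  | C r => simp [jetLin]
  | add P Q hP hQ => simp only [map_add, hP, hQ]
  | mul_X P t hP =>
    rw [map_mul, map_mul, hP, map_mul, eval_X]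
    congr 1
    rw [jetLin, aeval_X, map_sum]
    conv_rhs => rw [pi_eq_sum_univ' (fun i => x (t.1, i)), map_sum, Finset.sum_apply]
    refine Finset.sum_congr rfl fun a _ => ?_
    rw [map_smul, Pi.smul_apply, smul_eq_mul, map_mul, eval_C, eval_X, mul_comm]

lemma diag_compLinearMap {lam : Fin 3 → ℕ} (A : Cn 3 →ₗ[ℂ] Cn 3) (M : CellForms lam (Cn 3)) :
    diag lam (M.compLinearMap fun _ => A) = jetLin A (diag lam M) := by
  refine MvPolynomial.funext fun x => ?_
  rw [eval_jetLin, eval_diag, eval_diag, MultilinearMap.compLinearMap_apply]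

/-! ### Jets of curves in charts -/

section Charts

variable {X : Type*} [TopologicalSpace X] [ChartedSpace (Cn 3) X]
  {x : X} {e : OpenPartialHomeomorph X (Cn 3)}

lemma jetCoord_eq_jet (f : HolCurve 3 x) : jetCoord 3 e f = jet fun t => e (f.toFun t) := rfl

lemma jet_congr {h h' : ℂ → Cn 3} (H : h =ᶠ[𝓝 0] h') : jet h = jet h' := by
  ext ⟨j, i⟩
  exact Filter.EventuallyEq.iteratedDeriv_eq _ (H.mono fun t ht => by simp only [ht])

/-- The polynomial curve in `ℂ³` with given `3`-jet. -/
def jetCurve (y : Fin 3 × Fin 3 → ℂ) (t : ℂ) : Cn 3 := fun i =>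
  y (0, i) * t + y (1, i) / 2 * t ^ 2 + y (2, i) / 6 * t ^ 3

lemma jetCurve_zero (y : Fin 3 × Fin 3 → ℂ) : jetCurve y 0 = 0 := by
  ext i
  simp [jetCurve]

lemma contDiff_jetCurve (y : Fin 3 × Fin 3 → ℂ) : ContDiff ℂ ω (jetCurve y) :=
  contDiff_pi.2 fun i => by unfold jetCurve; fun_prop

lemma jet_jetCurve (z : Cn 3) (y : Fin 3 × Fin 3 → ℂ) : jet (fun t => z + jetCurve y t) = y := by
  ext ⟨j, i⟩
  have h1 : deriv (fun t : ℂ => z i + (y (0, i) * t + y (1, i) / 2 * t ^ 2 + y (2, i) / 6 * t ^ 3)) =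
      fun t => y (0, i) + y (1, i) * t + y (2, i) / 2 * t ^ 2 := by
    ext t
    have : HasDerivAt (fun t : ℂ => z i + (y (0, i) * t + y (1, i) / 2 * t ^ 2 +
        y (2, i) / 6 * t ^ 3)) (y (0, i) * 1 + y (1, i) / 2 * (2 * t) + y (2, i) / 6 * (3 * t ^ 2)) t := by
      refine HasDerivAt.const_add _ (((hasDerivAt_id t).const_mul _ |>.add ?_).add ?_)
      · simpa using (hasDerivAt_pow 2 t).const_mul (y (1, i) / 2)
      · simpa using (hasDerivAt_pow 3 t).const_mul (y (2, i) / 6)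
    rw [this.deriv]
    ring
  have h2 : deriv (fun t : ℂ => y (0, i) + y (1, i) * t + y (2, i) / 2 * t ^ 2) =
      fun t => y (1, i) + y (2, i) * t := by
    ext t
    have : HasDerivAt (fun t : ℂ => y (0, i) + y (1, i) * t + y (2, i) / 2 * t ^ 2)
        (y (1, i) * 1 + y (2, i) / 2 * (2 * t)) t := by
      refine HasDerivAt.add (((hasDerivAt_id t).const_mul _).const_add _) ?_
      simpa using (hasDerivAt_pow 2 t).const_mul (y (2, i) / 2)
    rw [this.deriv]
    ring
  have h3 : deriv (fun t : ℂ => y (1, i) + y (2, i) * t) = fun _ => y (2, i) := by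
    ext t
    have : HasDerivAt (fun t : ℂ => y (1, i) + y (2, i) * t) (y (2, i) * 1) t :=
      ((hasDerivAt_id t).const_mul _).const_add _
    rw [this.deriv, mul_one]
  fin_cases j
  · simp [jet, jetCurve, h1]
  · simp [jet, jetCurve, iteratedDeriv_two_eq, h1, h2]
  · simp [jet, jetCurve, iteratedDeriv_three_eq, h1, h2, h3]

variable [IsManifold 𝓘(ℂ, Cn 3) ω X]

lemma contMDiffAt_chart (he : e ∈ atlas (Cn 3) X) (hx : x ∈ e.source) :
    ContMDiffAt 𝓘(ℂ, Cn 3) 𝓘(ℂ, Cn 3) ω e x :=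
  contMDiffAt_of_mem_maximalAtlas (IsManifold.subset_maximalAtlas he) hx

lemma contMDiffAt_chart_symm (he : e ∈ atlas (Cn 3) X) {z : Cn 3} (hz : z ∈ e.target) :
    ContMDiffAt 𝓘(ℂ, Cn 3) 𝓘(ℂ, Cn 3) ω e.symm z :=
  contMDiffAt_symm_of_mem_maximalAtlas (IsManifold.subset_maximalAtlas he) hz

lemma analyticAt_chart_curve (he : e ∈ atlas (Cn 3) X) (hx : x ∈ e.source) (f : HolCurve 3 x) :
    AnalyticAt ℂ (fun t => e (f.toFun t)) 0 := by
  refine ContDiffAt.analyticAt (contMDiffAt_iff_contDiffAt.1 ?_)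
  exact ContMDiffAt.comp_of_eq (contMDiffAt_chart he hx) f.hol f.map_zero

/-- The curve through `x` which in the chart `e` is polynomial with given `3`-jet. -/
def chartCurve (he : e ∈ atlas (Cn 3) X) (hx : x ∈ e.source) (y : Fin 3 × Fin 3 → ℂ) :
    HolCurve 3 x where
  toFun t := e.symm (e x + jetCurve y t)
  map_zero := by rw [jetCurve_zero, add_zero, e.left_inv hx]
  hol := ContMDiffAt.comp_of_eq (x := (0 : ℂ)) (contMDiffAt_chart_symm he (e.map_source hx))
    (contDiff_const.add (contDiff_jetCurve y)).contDiffAt.contMDiffAt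
    (by rw [jetCurve_zero, add_zero])

lemma jetCoord_chartCurve (he : e ∈ atlas (Cn 3) X) (hx : x ∈ e.source)
    (y : Fin 3 × Fin 3 → ℂ) : jetCoord 3 e (chartCurve he hx y) = y := by
  conv_rhs => rw [← jet_jetCurve (e x) y]
  rw [jetCoord_eq_jet]
  refine jet_congr ?_
  have hc : ContinuousAt (fun t => e x + jetCurve y t) 0 :=
    (contDiff_const.add (contDiff_jetCurve y)).continuous.continuousAt
  have : ∀ᶠ t in 𝓝 (0 : ℂ), e x + jetCurve y t ∈ e.target := hc.eventually_mem (by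
    rw [jetCurve_zero, add_zero]
    exact e.open_target.mem_nhds (e.map_source hx))
  filter_upwards [this] with t ht
  exact e.right_inv ht

/-- Every point of the jet space is the jet of a curve, so a polynomial is determined by its values
on curves. -/
lemma jetPoly_ext (he : e ∈ atlas (Cn 3) X) (hx : x ∈ e.source) {p q : JetPoly}
    (h : ∀ f : HolCurve 3 x, eval (jetCoord 3 e f) p = eval (jetCoord 3 e f) q) : p = q :=
  MvPolynomial.funext fun y => by
    rw [← jetCoord_chartCurve he hx y]
    exact h _

lemma jetCoord_reparam (he : e ∈ atlas (Cn 3) X) (hx : x ∈ e.source) (f : HolCurve 3 x)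
    (φ : Reparam) : jetCoord 3 e (f.reparam φ) =
      reparamJet (deriv φ.toFun 0) (deriv (deriv φ.toFun) 0) (deriv (deriv (deriv φ.toFun)) 0)
        (jetCoord 3 e f) := by
  ext ⟨j, i⟩
  obtain ⟨h1, h2, h3⟩ := jets_reparam
    (analyticAt_coord (analyticAt_chart_curve he hx f) i) φ.hol φ.map_zero
  fin_cases j
  · simpa [jetCoord, reparamJet, HolCurve.reparam] using h1
  · simpa [jetCoord, reparamJet, HolCurve.reparam, iteratedDeriv_two_eq] using h2
  · simpa [jetCoord, reparamJet, HolCurve.reparam, iteratedDeriv_two_eq,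
      iteratedDeriv_three_eq] using h3

/-- The expression of a map in charts. -/
def inCharts (e e' : OpenPartialHomeomorph X (Cn 3)) (ψ : X → X) : Cn 3 → Cn 3 :=
  fun z => e' (ψ (e.symm z))

variable {e' : OpenPartialHomeomorph X (Cn 3)} {ψ : X → X}

lemma analyticAt_inCharts (he : e ∈ atlas (Cn 3) X) (he' : e' ∈ atlas (Cn 3) X)
    (hx : x ∈ e.source) (hx' : ψ x ∈ e'.source)
    (hψ : ContMDiffAt 𝓘(ℂ, Cn 3) 𝓘(ℂ, Cn 3) ω ψ x) :
    AnalyticAt ℂ (inCharts e e' ψ) (e x) := by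
  refine ContDiffAt.analyticAt (contMDiffAt_iff_contDiffAt.1 ?_)
  have h1 : ContMDiffAt 𝓘(ℂ, Cn 3) 𝓘(ℂ, Cn 3) ω (fun y => e' (ψ y)) x :=
    (contMDiffAt_chart he' hx').comp x hψ
  exact ContMDiffAt.comp_of_eq (g := fun y => e' (ψ y)) h1
    (contMDiffAt_chart_symm he (e.map_source hx)) (e.left_inv hx)

lemma eval_jetCoord_map (he : e ∈ atlas (Cn 3) X) (he' : e' ∈ atlas (Cn 3) X)
    (hx : x ∈ e.source) (hx' : ψ x ∈ e'.source)
    (hψ : ContMDiffAt 𝓘(ℂ, Cn 3) 𝓘(ℂ, Cn 3) ω ψ x) (f : HolCurve 3 x) (q : JetPoly) :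
    eval (jetCoord 3 e' (f.map ψ hψ)) q =
      eval (jetCoord 3 e f) (jetPull (inCharts e e' ψ) (e x) q) := by
  have h0 : e (f.toFun 0) = e x := by rw [f.map_zero]
  have h1 := eval_jetPull (τ := inCharts e e' ψ) (h := fun t => e (f.toFun t))
    (by rw [h0]; exact analyticAt_inCharts he he' hx hx' hψ) (analyticAt_chart_curve he hx f) q
  rw [h0] at h1
  rw [jetCoord_eq_jet, jetCoord_eq_jet, h1]
  congr 2
  refine jet_congr ?_
  have hc : ContinuousAt f.toFun 0 := f.hol.continuousAt
  have : ∀ᶠ t in 𝓝 (0 : ℂ), f.toFun t ∈ e.source := hc.eventually_mem (by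
    rw [f.map_zero]
    exact e.open_source.mem_nhds hx)
  filter_upwards [this] with t ht
  simp [inCharts, HolCurve.map, e.left_inv ht]

lemma hasMatrix_fderiv {τ : Cn 3 → Cn 3} {z : Cn 3} (hτ : AnalyticAt ℂ τ z) :
    HasMatrix τ z (fderiv ℂ τ z).toLinearMap := by
  intro a i
  have h : HasFDerivAt (fun y => τ y i)
      ((ContinuousLinearMap.proj (R := ℂ) (φ := fun _ : Fin 3 => ℂ) i).comp (fderiv ℂ τ z)) z :=
    (ContinuousLinearMap.proj (R := ℂ) (φ := fun _ : Fin 3 => ℂ) i).hasFDerivAt.comp z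
      hτ.differentiableAt.hasFDerivAt
  rw [partialDeriv, h.fderiv]
  rfl

end Charts

/-! ### The graded fibre in a chart -/

section ChartIso

/-- A change of parameter with given derivatives. -/
def reparamOf (a b c : ℂ) (ha : a ≠ 0) : Reparam where
  toFun t := jetCurve (fun ji => ![a, b, c] ji.1) t 0
  map_zero := by rw [jetCurve_zero]; rfl
  hol := analyticAt_coord (contDiff_jetCurve _).contDiffAt.analyticAt 0
  deriv_ne := by
    have h := congrFun (jet_jetCurve 0 fun ji => ![a, b, c] ji.1) (0, 0)
    simp only [zero_add, jet, Fin.val_zero, iteratedDeriv_one, Matrix.cons_val_zero] at h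
    rw [h]
    exact ha

lemma deriv_reparamOf (a b c : ℂ) (ha : a ≠ 0) :
    deriv (reparamOf a b c ha).toFun 0 = a ∧ deriv (deriv (reparamOf a b c ha).toFun) 0 = b ∧
      deriv (deriv (deriv (reparamOf a b c ha).toFun)) 0 = c := by
  have h := jet_jetCurve 0 fun ji => ![a, b, c] ji.1
  refine ⟨?_, ?_, ?_⟩
  · simpa [jet, reparamOf] using congrFun h (0, 0)
  · simpa [jet, reparamOf, iteratedDeriv_two_eq] using congrFun h (1, 0)
  · simpa [jet, reparamOf, iteratedDeriv_three_eq] using congrFun h (2, 0)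

variable {X : Type*} [TopologicalSpace X] [ChartedSpace (Cn 3) X]

/-- The function of jets given in the chart `e` by a polynomial. -/
def evalJets (e : OpenPartialHomeomorph X (Cn 3)) (x : X) :
    JetPoly →ₗ[ℂ] (HolCurve 3 x → ℂ) where
  toFun p f := eval (jetCoord 3 e f) p
  map_add' p q := by ext f; simp
  map_smul' a p := by ext f; simp [smul_eval]

/-- The polynomial which gives a function of jets in the chart `e`. -/
def chartPoly (e : OpenPartialHomeomorph X (Cn 3)) (x : X) :
    (HolCurve 3 x → ℂ) →ₗ[ℂ] JetPoly := (evalJets e x).leftInverse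

variable [IsManifold 𝓘(ℂ, Cn 3) ω X] {x : X} {e : OpenPartialHomeomorph X (Cn 3)}

lemma chartPoly_evalJets (he : e ∈ atlas (Cn 3) X) (hx : x ∈ e.source) (p : JetPoly) :
    chartPoly e x (evalJets e x p) = p :=
  LinearMap.leftInverse_apply_of_inj (LinearMap.ker_eq_bot.2 fun _ _ h =>
    jetPoly_ext he hx fun f => congrFun h f) p

/-- When S is stable under changes of coordinates, belonging to S in one chart implies it in all.
Invariance on curves becomes a polynomial identity because every jet and every triple (φ', φ'',
φ''') with φ' ≠ 0 is realised. -/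
lemma inf_polyJets_eq_map (he : e ∈ atlas (Cn 3) X) (hx : x ∈ e.source) (m : ℕ)
    (S : Submodule ℂ JetPoly)
    (hS : ∀ τ z A, HasMatrix τ z A → ∀ q ∈ S, jetPull τ z q ∈ S) :
    invJets 3 m x ⊓ polyJets 3 S x = (invPoly m ⊓ S).map (evalJets e x) := by
  have hpoly : ∀ T : Submodule ℂ JetPoly,
      (∀ τ z A, HasMatrix τ z A → ∀ q ∈ T, jetPull τ z q ∈ T) → ∀ p ∈ T,
      evalJets e x p ∈ polyJets 3 T x := fun T hT p hp e' he' hx' =>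
    ⟨jetPull (inCharts e' e id) (e' x) p, hT _ _ _
      (hasMatrix_fderiv (analyticAt_inCharts he' he hx' hx contMDiffAt_id)) p hp,
      fun f => eval_jetCoord_map he' he hx' hx contMDiffAt_id f p⟩
  ext Q
  constructor
  · rintro ⟨⟨_, hQ⟩, hQ'⟩
    obtain ⟨p, hp, h⟩ := hQ' e he hx
    refine ⟨p, ⟨fun a b c ha y => ?_, hp⟩, _root_.funext fun f => (h f).symm⟩
    have h1 := hQ (reparamOf a b c ha) (chartCurve he hx y)
    obtain ⟨ha', hb', hc'⟩ := deriv_reparamOf a b c ha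
    rwa [h, h, jetCoord_reparam he hx, jetCoord_chartCurve, ha', hb', hc'] at h1
  · rintro ⟨p, ⟨hp, hp'⟩, rfl⟩
    have hinv : ∀ (φ : Reparam) (f : HolCurve 3 x),
        evalJets e x p (f.reparam φ) = deriv φ.toFun 0 ^ m * evalJets e x p f := fun φ f => by
      change eval _ p = _ * eval _ p
      rw [jetCoord_reparam he hx]
      exact hp _ _ _ φ.deriv_ne _
    refine ⟨⟨⟨hpoly ⊤ (by simp) p trivial, fun a f => ?_⟩, hinv⟩, hpoly S hS p hp'⟩
    rw [hinv]
    simp [dilation, deriv_const_mul_id']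

lemma filLE_eq_map (he : e ∈ atlas (Cn 3) X) (hx : x ∈ e.source) (m : ℕ) (l : Fin 3 → ℕ) :
    filLE 3 m l x = (invPoly m ⊓ upTo l).map (evalJets e x) :=
  inf_polyJets_eq_map he hx m (upTo l) fun _ _ _ hA _ => jetPull_mem_upTo hA

lemma filLT_eq_map (he : e ∈ atlas (Cn 3) X) (hx : x ∈ e.source) (m : ℕ) (l : Fin 3 → ℕ) :
    filLT 3 m l x = (invPoly m ⊓ below l).map (evalJets e x) :=
  inf_polyJets_eq_map he hx m (below l) fun _ _ _ hA _ => jetPull_mem_below hA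

lemma evalJets_chartPoly (he : e ∈ atlas (Cn 3) X) (hx : x ∈ e.source) {m : ℕ} {l : Fin 3 → ℕ}
    {Q : HolCurve 3 x → ℂ} (hQ : Q ∈ filLE 3 m l x) : evalJets e x (chartPoly e x Q) = Q := by
  rw [filLE_eq_map he hx] at hQ
  obtain ⟨p, _, rfl⟩ := hQ
  rw [chartPoly_evalJets he hx]

lemma chartPoly_mem (he : e ∈ atlas (Cn 3) X) (hx : x ∈ e.source) {m : ℕ} {l : Fin 3 → ℕ}
    {Q : HolCurve 3 x → ℂ} (hQ : Q ∈ filLE 3 m l x) :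
    chartPoly e x Q ∈ invPoly m ⊓ upTo l := by
  rw [filLE_eq_map he hx] at hQ
  obtain ⟨p, hp, rfl⟩ := hQ
  rwa [chartPoly_evalJets he hx]

/-- The leading form of multidegree `l` in the chart `e`. -/
def leadMap (he : e ∈ atlas (Cn 3) X) (hx : x ∈ e.source) (m : ℕ) (l : Fin 3 → ℕ) :
    filLE (n := 3) 3 m l x →ₗ[ℂ] leadForms m l :=
  LinearMap.codRestrict _ (comp (intDeg l) ∘ₗ chartPoly e x ∘ₗ (filLE 3 m l x).subtype) fun Q =>
    ⟨_, (chartPoly_mem he hx Q.2).1, leadsTo_comp (chartPoly_mem he hx Q.2).2⟩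

lemma coe_leadMap (he : e ∈ atlas (Cn 3) X) (hx : x ∈ e.source) {m : ℕ} {l : Fin 3 → ℕ}
    (Q : filLE (n := 3) 3 m l x) :
    (leadMap he hx m l Q : JetPoly) = comp (intDeg l) (chartPoly e x Q.1) := rfl

lemma leadMap_surjective (he : e ∈ atlas (Cn 3) X) (hx : x ∈ e.source) (m : ℕ)
    (l : Fin 3 → ℕ) : Function.Surjective (leadMap he hx m l) := by
  rintro ⟨P, q, hq, h⟩
  refine ⟨⟨evalJets e x q, ?_⟩, Subtype.ext ?_⟩
  · rw [filLE_eq_map he hx]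
    exact Submodule.mem_map_of_mem ⟨hq, h.mem_upTo⟩
  · rw [coe_leadMap, chartPoly_evalJets he hx, h.comp_eq]

lemma ker_leadMap (he : e ∈ atlas (Cn 3) X) (hx : x ∈ e.source) (m : ℕ) (l : Fin 3 → ℕ) :
    (filLT 3 m l x).submoduleOf (filLE 3 m l x) = LinearMap.ker (leadMap he hx m l) := by
  ext Q
  rw [LinearMap.mem_ker, Submodule.submoduleOf, Submodule.mem_comap, filLT_eq_map he hx]
  constructor
  · rintro ⟨p, ⟨_, hp⟩, h⟩
    have h' : evalJets e x p = Q.1 := h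
    refine Subtype.ext ?_
    rw [coe_leadMap, ← h', chartPoly_evalJets he hx, comp_eq_zero_of_mem_below hp]
    rfl
  · intro h
    have h' : comp (intDeg l) (chartPoly e x Q.1) = 0 := congrArg Subtype.val h
    have hm := chartPoly_mem he hx Q.2
    exact ⟨chartPoly e x Q.1, ⟨hm.1, mem_below_of_comp_eq_zero hm.2 h'⟩,
      evalJets_chartPoly he hx Q.2⟩

/-- The graded piece at `x` is the space of leading forms in the chart `e`. -/
def pieceEquiv (he : e ∈ atlas (Cn 3) X) (hx : x ∈ e.source) (m : ℕ) (l : Fin 3 → ℕ) :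
    GrPiece (n := 3) 3 m l x ≃ₗ[ℂ] leadForms m l :=
  (Submodule.quotEquivOfEq _ _ (ker_leadMap he hx m l)).trans
    ((leadMap he hx m l).quotKerEquivOfSurjective (leadMap_surjective he hx m l))

lemma pieceEquiv_mk (he : e ∈ atlas (Cn 3) X) (hx : x ∈ e.source) {m : ℕ} {l : Fin 3 → ℕ}
    (Q : filLE (n := 3) 3 m l x) :
    pieceEquiv he hx m l (Submodule.Quotient.mk Q) = leadMap he hx m l Q := rfl

/-- The graded fibre at `x` is the sum of the leading forms in the chart `e`. -/
def grEquiv (he : e ∈ atlas (Cn 3) X) (hx : x ∈ e.source) (m : ℕ) :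
    GrJets 3 3 m x ≃ₗ[ℂ] LeadSum m :=
  DFinsupp.mapRange.linearEquiv fun l : WeightIndex 3 m => pieceEquiv he hx m l.1

lemma grEquiv_apply (he : e ∈ atlas (Cn 3) X) (hx : x ∈ e.source) {m : ℕ}
    (s : GrJets 3 3 m x) (l : WeightIndex 3 m) :
    grEquiv he hx m s l = pieceEquiv he hx m l.1 (s l) := rfl

lemma grEquiv_grClass (he : e ∈ atlas (Cn 3) X) (hx : x ∈ e.source) {m : ℕ}
    (l : WeightIndex 3 m) (Q : filLE (n := 3) 3 m l.1 x) :
    grEquiv he hx m (grClass l Q) =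
      DirectSum.lof ℂ (WeightIndex 3 m) (fun l => leadForms m l.1) l (leadMap he hx m l.1 Q) := by
  rw [grClass, ← pieceEquiv_mk]
  exact DFinsupp.mapRange_single (hf := fun _ => map_zero _)

/-- The isomorphism with the sum of the Schur functors given by the chart `e`. -/
def chartIso (he : e ∈ atlas (Cn 3) X) (hx : x ∈ e.source) (m : ℕ) :
    GrJets 3 3 m x ≃ₗ[ℂ] ⨁ p : SchurIndex m, SchurDual p.1.2 (Cn 3) :=
  (grEquiv he hx m).trans (leadSumEquiv m)

lemma schurSumToLead_chartIso (he : e ∈ atlas (Cn 3) X) (hx : x ∈ e.source) {m : ℕ}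
    (s : GrJets 3 3 m x) : schurSumToLead m (chartIso he hx m s) = grEquiv he hx m s :=
  LinearEquiv.apply_symm_apply (LinearEquiv.ofBijective (schurSumToLead m)
    ⟨schurSumToLead_injective m, schurSumToLead_surjective m⟩) _

end ChartIso

/-! ### Pullback by holomorphic maps -/

section Pullback

variable {m : ℕ}

/-- Pullback by a linear map on the sum of the Schur functors. -/
def sumPullback (m : ℕ) (A : Cn 3 →ₗ[ℂ] Cn 3) :
    (⨁ p : SchurIndex m, SchurDual p.1.2 (Cn 3)) →ₗ[ℂ]
      ⨁ p : SchurIndex m, SchurDual p.1.2 (Cn 3) :=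
  DFinsupp.mapRange.linearMap fun p => schurPullback p.1.2 A

/-- Naturality: restriction to row-constant arguments and polarization both commute with linear
substitutions. -/
lemma coe_schurSumToLead_sumPullback (A : Cn 3 →ₗ[ℂ] Cn 3)
    (y : ⨁ p : SchurIndex m, SchurDual p.1.2 (Cn 3)) (l : WeightIndex 3 m) :
    (schurSumToLead m (sumPullback m A y) l : JetPoly) = jetLin A (schurSumToLead m y l) := by
  induction y using DirectSum.induction_on with
  | zero => simp only [map_zero]; exact (map_zero (jetLin A)).symm
  | add y z hy hz =>
    rw [map_add, map_add, map_add, DirectSum.add_apply, DirectSum.add_apply, Submodule.coe_add,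
      hy, hz, Submodule.coe_add, map_add]
  | of p M =>
    have h1 : sumPullback m A (DirectSum.of (fun p : SchurIndex m => SchurDual p.1.2 (Cn 3)) p M) =
        DirectSum.lof ℂ _ _ p (schurPullback p.1.2 A M) :=
      DFinsupp.mapRange_single (hf := fun _ => map_zero _)
    rw [h1, ← DirectSum.lof_eq_of ℂ, schurSumToLead_lof, schurSumToLead_lof, coe_lof_apply,
      coe_lof_apply, coe_schurToLead, coe_schurToLead]
    split_ifs
    · rw [← polarEnd_pow_jetLin, ← diag_compLinearMap]
      rfl
    · rw [map_zero]

variable {X : Type*} [TopologicalSpace X] [ChartedSpace (Cn 3) X] [IsManifold 𝓘(ℂ, Cn 3) ω X]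
  {x : X} {e e' : OpenPartialHomeomorph X (Cn 3)} {ψ : X → X}

lemma chartIso_eq_sumPullback (he : e ∈ atlas (Cn 3) X) (hx : x ∈ e.source) {x' : X}
    (he' : e' ∈ atlas (Cn 3) X) (hx' : x' ∈ e'.source) {A : Cn 3 →ₗ[ℂ] Cn 3}
    {s : GrJets 3 3 m x} {s' : GrJets 3 3 m x'}
    (h : ∀ l, (grEquiv he hx m s l : JetPoly) = jetLin A (grEquiv he' hx' m s' l)) :
    chartIso he hx m s = sumPullback m A (chartIso he' hx' m s') := by
  refine schurSumToLead_injective m (DFinsupp.ext fun l => Subtype.ext ?_)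
  rw [coe_schurSumToLead_sumPullback, schurSumToLead_chartIso, schurSumToLead_chartIso, h]

/-- Composition with ψ on the left commutes with a change of parameter on the right. -/
lemma jetPull_mem_invPoly (he : e ∈ atlas (Cn 3) X) (he' : e' ∈ atlas (Cn 3) X)
    (hx : x ∈ e.source) (hx' : ψ x ∈ e'.source)
    (hψ : ContMDiffAt 𝓘(ℂ, Cn 3) 𝓘(ℂ, Cn 3) ω ψ x) {p : JetPoly} (hp : p ∈ invPoly m) :
    jetPull (inCharts e e' ψ) (e x) p ∈ invPoly m := by
  intro a b c ha y
  obtain ⟨ha', hb', hc'⟩ := deriv_reparamOf a b c ha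
  have h1 := jetCoord_reparam he hx (chartCurve he hx y) (reparamOf a b c ha)
  have h2 := jetCoord_reparam he' hx' ((chartCurve he hx y).map ψ hψ) (reparamOf a b c ha)
  rw [ha', hb', hc'] at h1 h2
  have h3 := eval_jetCoord_map he he' hx hx' hψ ((chartCurve he hx y).reparam (reparamOf a b c ha)) p
  rw [h1, jetCoord_chartCurve] at h3
  have h4 := eval_jetCoord_map he he' hx hx' hψ (chartCurve he hx y) p
  rw [jetCoord_chartCurve] at h4
  rw [← h3, ← h4, ← hp a b c ha, ← h2]
  rfl

lemma map_evalJets (he : e ∈ atlas (Cn 3) X) (he' : e' ∈ atlas (Cn 3) X)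
    (hx : x ∈ e.source) (hx' : ψ x ∈ e'.source)
    (hψ : ContMDiffAt 𝓘(ℂ, Cn 3) 𝓘(ℂ, Cn 3) ω ψ x) (p : JetPoly) :
    (fun f : HolCurve 3 x => evalJets e' (ψ x) p (f.map ψ hψ)) =
      evalJets e x (jetPull (inCharts e e' ψ) (e x) p) :=
  _root_.funext fun f => eval_jetCoord_map he he' hx hx' hψ f p

lemma map_mem_filLE (he : e ∈ atlas (Cn 3) X) (he' : e' ∈ atlas (Cn 3) X)
    (hx : x ∈ e.source) (hx' : ψ x ∈ e'.source)
    (hψ : ContMDiffAt 𝓘(ℂ, Cn 3) 𝓘(ℂ, Cn 3) ω ψ x) {l : Fin 3 → ℕ} {Q : HolCurve 3 (ψ x) → ℂ}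
    (hQ : Q ∈ filLE 3 m l (ψ x)) : (fun f : HolCurve 3 x => Q (f.map ψ hψ)) ∈ filLE 3 m l x := by
  rw [filLE_eq_map he' hx'] at hQ
  obtain ⟨p, hp, rfl⟩ := hQ
  rw [map_evalJets he he' hx hx' hψ, filLE_eq_map he hx]
  exact Submodule.mem_map_of_mem ⟨jetPull_mem_invPoly he he' hx hx' hψ hp.1,
    jetPull_mem_upTo (hasMatrix_fderiv (analyticAt_inCharts he he' hx hx' hψ)) hp.2⟩

lemma coe_leadMap_map (he : e ∈ atlas (Cn 3) X) (he' : e' ∈ atlas (Cn 3) X)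
    (hx : x ∈ e.source) (hx' : ψ x ∈ e'.source)
    (hψ : ContMDiffAt 𝓘(ℂ, Cn 3) 𝓘(ℂ, Cn 3) ω ψ x) {A : Cn 3 →ₗ[ℂ] Cn 3}
    (hA : HasMatrix (inCharts e e' ψ) (e x) A) {l : Fin 3 → ℕ}
    (Q : filLE (n := 3) 3 m l (ψ x)) :
    (leadMap he hx m l ⟨_, map_mem_filLE he he' hx hx' hψ Q.2⟩ : JetPoly) =
      jetLin A (leadMap he' hx' m l Q) := by
  have h := map_evalJets he he' hx hx' hψ (chartPoly e' (ψ x) Q.1)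
  rw [evalJets_chartPoly he' hx' Q.2] at h
  rw [coe_leadMap, coe_leadMap]
  simp only
  rw [h, chartPoly_evalJets he hx, comp_jetPull hA (chartPoly_mem he' hx' Q.2).2]

lemma chartIso_map (he : e ∈ atlas (Cn 3) X) (he' : e' ∈ atlas (Cn 3) X)
    (hx : x ∈ e.source) (hx' : ψ x ∈ e'.source)
    (hψ : ContMDiffAt 𝓘(ℂ, Cn 3) 𝓘(ℂ, Cn 3) ω ψ x) {A : Cn 3 →ₗ[ℂ] Cn 3}
    (hA : HasMatrix (inCharts e e' ψ) (e x) A) (l : WeightIndex 3 m)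
    (Q : filLE (n := 3) 3 m l.1 (ψ x)) :
    chartIso he hx m (grClass l ⟨_, map_mem_filLE he he' hx hx' hψ Q.2⟩) =
      sumPullback m A (chartIso he' hx' m (grClass l Q)) := by
  refine chartIso_eq_sumPullback he hx he' hx' fun l' => ?_
  rw [grEquiv_grClass, grEquiv_grClass, coe_lof_apply, coe_lof_apply,
    coe_leadMap_map he he' hx hx' hψ hA]
  split_ifs
  · rfl
  · rw [map_zero]

lemma chartIso_change (he : e ∈ atlas (Cn 3) X) (he' : e' ∈ atlas (Cn 3) X)
    (hx : x ∈ e.source) (hx' : x ∈ e'.source) {A : Cn 3 →ₗ[ℂ] Cn 3}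
    (hA : HasMatrix (inCharts e e' id) (e x) A) (s : GrJets 3 3 m x) :
    chartIso he hx m s = sumPullback m A (chartIso he' hx' m s) := by
  refine chartIso_eq_sumPullback he hx he' hx' fun l => ?_
  rw [grEquiv_apply, grEquiv_apply]
  obtain ⟨Q, hQ⟩ := Submodule.Quotient.mk_surjective _ (s l)
  rw [← hQ, pieceEquiv_mk, pieceEquiv_mk]
  exact coe_leadMap_map he he' hx (ψ := id) hx' contMDiffAt_id hA Q

lemma hasMatrix_mfderiv (hψ : ContMDiffAt 𝓘(ℂ, Cn 3) 𝓘(ℂ, Cn 3) ω ψ x) :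
    HasMatrix (inCharts (chartAt (Cn 3) x) (chartAt (Cn 3) (ψ x)) ψ) (chartAt (Cn 3) x x)
      (mfderiv 𝓘(ℂ, Cn 3) 𝓘(ℂ, Cn 3) ψ x).toLinearMap := by
  have h := hasMatrix_fderiv (analyticAt_inCharts (chart_mem_atlas (Cn 3) x)
    (chart_mem_atlas (Cn 3) (ψ x)) (mem_chart_source _ x) (mem_chart_source _ (ψ x)) hψ)
  have h' : mfderiv 𝓘(ℂ, Cn 3) 𝓘(ℂ, Cn 3) ψ x =
      fderiv ℂ (inCharts (chartAt (Cn 3) x) (chartAt (Cn 3) (ψ x)) ψ) (chartAt (Cn 3) x x) := by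
    rw [(hψ.mdifferentiableAt (by simp)).mfderiv]
    simp only [mfld_simps, fderivWithin_univ]
    rfl
  rw [h']
  exact h

end Pullback

/-! ### Holomorphic families of vectors -/

section HolFam

variable {X : Type*} [TopologicalSpace X] [ChartedSpace (Cn 3) X] {W : Set X}

section Monoid

variable {M N : Type*} [AddCommMonoid M] [Module ℂ M] [AddCommMonoid N] [Module ℂ N]

/-- A map to a complex vector space is holomorphic if all its coordinates are. -/
def HolFam (W : Set X) (y : X → M) : Prop :=
  ∀ φ : M →ₗ[ℂ] ℂ, ContMDiffOn 𝓘(ℂ, Cn 3) 𝓘(ℂ, ℂ) ω (fun x => φ (y x)) W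

lemma HolFam.map {y : X → M} (h : HolFam W y) (T : M →ₗ[ℂ] N) : HolFam W fun x => T (y x) :=
  fun φ => h (φ ∘ₗ T)

lemma HolFam.mono {y : X → M} (h : HolFam W y) {W' : Set X} (hW : W' ⊆ W) : HolFam W' y :=
  fun φ => (h φ).mono hW

lemma HolFam.congr {y z : X → M} (h : HolFam W y) (hz : ∀ x ∈ W, z x = y x) : HolFam W z :=
  fun φ => (h φ).congr fun x hx => by rw [hz x hx]

end Monoid

variable {M : Type*} [AddCommGroup M] [Module ℂ M]

/-- In finite dimension, functionals that separate points span the dual space. -/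
lemma holFam_of_separating [FiniteDimensional ℂ M] {ι : Type*} {y : X → M} (φ : ι → M →ₗ[ℂ] ℂ)
    (hφ : ∀ v, (∀ i, φ i v = 0) → v = 0)
    (h : ∀ i, ContMDiffOn 𝓘(ℂ, Cn 3) 𝓘(ℂ, ℂ) ω (fun x => φ i (y x)) W) : HolFam W y := by
  intro ψ
  have hspan : Submodule.span ℂ (Set.range φ) = ⊤ := by
    have h1 : (Submodule.span ℂ (Set.range φ)).dualCoannihilator = ⊥ := by
      rw [eq_bot_iff]
      intro v hv
      rw [Submodule.mem_dualCoannihilator] at hv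
      exact hφ v fun i => hv _ (Submodule.subset_span ⟨i, rfl⟩)
    rw [← Subspace.dualCoannihilator_dualAnnihilator_eq (W := Submodule.span ℂ (Set.range φ)), h1,
      Submodule.dualAnnihilator_bot]
  have hψ : ψ ∈ Submodule.span ℂ (Set.range φ) := hspan ▸ Submodule.mem_top
  induction hψ using Submodule.span_induction with
  | mem ψ hψ =>
    obtain ⟨i, rfl⟩ := hψ
    exact h i
  | zero => exact contMDiffOn_const
  | add ψ ψ' _ _ h1 h2 => exact h1.add h2
  | smul a ψ _ h1 => exact contMDiffOn_const.mul h1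

lemma holFam_directSum {ι : Type*} [Finite ι] [DecidableEq ι] {V : ι → Type*}
    [∀ i, AddCommMonoid (V i)] [∀ i, Module ℂ (V i)] {y : X → ⨁ i, V i}
    (h : ∀ i, HolFam W fun x => y x i) : HolFam W y := by
  intro φ
  cases nonempty_fintype ι
  have h1 : (fun x => φ (y x)) = fun x => ∑ i, (φ ∘ₗ DirectSum.lof ℂ ι V i) (y x i) := by
    ext x
    conv_lhs => rw [← DirectSum.sum_univ_of (y x), map_sum]
    rfl
  rw [h1]
  exact contMDiffOn_finsetSum fun i _ => h i _

lemma contMDiffOn_eval {y : X → Fin 3 × Fin 3 → ℂ}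
    (hy : ∀ t, ContMDiffOn 𝓘(ℂ, Cn 3) 𝓘(ℂ, ℂ) ω (fun x => y x t) W) (p : JetPoly) :
    ContMDiffOn 𝓘(ℂ, Cn 3) 𝓘(ℂ, ℂ) ω (fun x => eval (y x) p) W := by
  induction p using MvPolynomial.induction_on with
  | C a => simpa using contMDiffOn_const
  | add p q hp hq => simp only [map_add]; exact hp.add hq
  | mul_X p t hp => simp only [map_mul, eval_X]; exact hp.mul (hy t)

lemma HolFam.eval [FiniteDimensional ℂ M] {P : X → M} (hP : HolFam W P) (T : M →ₗ[ℂ] JetPoly)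
    {y : X → Fin 3 × Fin 3 → ℂ}
    (hy : ∀ t, ContMDiffOn 𝓘(ℂ, Cn 3) 𝓘(ℂ, ℂ) ω (fun x => y x t) W) :
    ContMDiffOn 𝓘(ℂ, Cn 3) 𝓘(ℂ, ℂ) ω (fun x => eval (y x) (T (P x))) W := by
  let b := Module.finBasis ℂ M
  have h1 : (fun x => MvPolynomial.eval (y x) (T (P x))) =
      fun x => ∑ i, b.coord i (P x) * MvPolynomial.eval (y x) (T (b i)) := by
    ext x
    conv_lhs => rw [← b.sum_repr (P x), map_sum, map_sum]
    exact Finset.sum_congr rfl fun i _ => by rw [map_smul, smul_eval]; rfl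
  rw [h1]
  exact contMDiffOn_finsetSum fun i _ => (hP (b.coord i)).mul (contMDiffOn_eval hy _)

/-- The value of a form in `Γ^lam` on given vectors. -/
def evalForm {lam : Fin 3 → ℕ} (v : Cells lam → Cn 3) : SchurDual lam (Cn 3) →ₗ[ℂ] ℂ where
  toFun S := S.1 v
  map_add' _ _ := rfl
  map_smul' _ _ := rfl

lemma HolFam.apply {lam : Fin 3 → ℕ} {S : X → SchurDual lam (Cn 3)} (hS : HolFam W S)
    {w : Cells lam → X → Cn 3}
    (hw : ∀ c, ContMDiffOn 𝓘(ℂ, Cn 3) 𝓘(ℂ, Cn 3) ω (w c) W) :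
    ContMDiffOn 𝓘(ℂ, Cn 3) 𝓘(ℂ, ℂ) ω (fun x => (S x).1 fun c => w c x) W := by
  classical
  have h1 : (fun x => (S x).1 fun c => w c x) = fun x => ∑ κ : Cells lam → Fin 3,
      (S x).1 (fun c => Pi.single (κ c) 1) * ∏ c, w c x (κ c) :=
    _root_.funext fun x => cellForms_eq_sum _ _
  rw [h1]
  refine contMDiffOn_finsetSum fun κ _ => ContMDiffOn.mul ?_ (contMDiffOn_finsetProd fun c _ => ?_)
  · exact hS (evalForm (fun c => Pi.single (κ c) 1))
  · exact contMDiffOn_pi_space.1 (hw c) _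

end HolFam

/-! ### Finiteness -/

instance finiteDimensional_invPoly (m : ℕ) : FiniteDimensional ℂ (invPoly m) := by
  have h := weightedHomogeneousSubmodule_fg ℂ (fun t : Fin 3 × Fin 3 => (t.1 : ℕ) + 1) (by simp) m
  have : FiniteDimensional ℂ
    (weightedHomogeneousSubmodule ℂ (fun t : Fin 3 × Fin 3 => (t.1 : ℕ) + 1) m) :=
    Module.Finite.iff_fg.2 h
  exact Submodule.finiteDimensional_of_le fun p hp => (mem_weightedHomogeneousSubmodule ..).2
    fun s hs => weight_eq_of_mem_invPoly hp hs

instance (m : ℕ) (l : Fin 3 → ℕ) : FiniteDimensional ℂ ↥(invPoly m ⊓ upTo l) :=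
  Submodule.finiteDimensional_of_le inf_le_left

instance (m : ℕ) : Finite (WeightIndex 3 m) := by
  refine Finite.of_injective (β := Fin 3 → Fin (m + 1))
    (fun l j => ⟨l.1 j, ?_⟩) fun l l' h => Subtype.ext (_root_.funext fun j => ?_)
  · have := weightIndex_iff.1 l.2
    fin_cases j <;> simp <;> omega
  · exact congrArg Fin.val (congrFun h j)

instance (m : ℕ) : Finite (SchurIndex m) := by
  refine Finite.of_injective (β := WeightIndex 3 m × Fin (m + 1))
    (fun p => (leadIndex p, ⟨p.1.1, ?_⟩)) fun p p' h => ?_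
  · have := schurIndex_facts p
    omega
  · exact leadIndex_injective (congrArg Prod.fst h) (congrArg (fun q => (q.2 : ℕ)) h)

/-! ### Holomorphic families of curves -/

section Families

/-- The derivative in t is the total derivative in the direction (0, 1), which stays jointly
analytic. -/
lemma analyticAt_iteratedDeriv_snd {E : Type*} [NormedAddCommGroup E] [NormedSpace ℂ E]
    {G : E × ℂ → ℂ} {p : E × ℂ} (h : AnalyticAt ℂ G p) (n : ℕ) :
    AnalyticAt ℂ (fun q : E × ℂ => iteratedDeriv n (fun t => G (q.1, t)) q.2) p := by
  induction n with
  | zero => simpa using h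
  | succ n ih =>
    have h1 : AnalyticAt ℂ (fun q => fderiv ℂ (fun q : E × ℂ =>
        iteratedDeriv n (fun t => G (q.1, t)) q.2) q (0, 1)) p :=
      ((ContinuousLinearMap.apply ℂ ℂ ((0, 1) : E × ℂ)).analyticAt _).comp ih.fderiv
    refine h1.congr ?_
    filter_upwards [ih.eventually_analyticAt] with q hq
    have h2 : HasDerivAt (fun t : ℂ => (q.1, t)) ((0, 1) : E × ℂ) q.2 :=
      (hasDerivAt_const _ _).prodMk (hasDerivAt_id _)
    have h3 : HasFDerivAt (fun q : E × ℂ => iteratedDeriv n (fun t => G (q.1, t)) q.2) _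
      (q.1, q.2) := hq.differentiableAt.hasFDerivAt
    rw [iteratedDeriv_succ]
    exact (h3.comp_hasDerivAt q.2 h2).deriv.symm

variable {X : Type*} [TopologicalSpace X] [ChartedSpace (Cn 3) X] [IsManifold 𝓘(ℂ, Cn 3) ω X]
  {x : X} {e : OpenPartialHomeomorph X (Cn 3)}

/-- In a chart the family is jointly analytic in point and parameter, hence so are its parameter
derivatives, which are then restricted to t = 0. -/
lemma contMDiffAt_jetCoord (he : e ∈ atlas (Cn 3) X) (hx : x ∈ e.source)
    {c : ∀ x : X, HolCurve 3 x}
    (hc : ContMDiffAt (𝓘(ℂ, Cn 3).prod 𝓘(ℂ, ℂ)) 𝓘(ℂ, Cn 3) ω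
      (fun p : X × ℂ => (c p.1).toFun p.2) (x, 0)) (t : Fin 3 × Fin 3) :
    ContMDiffAt 𝓘(ℂ, Cn 3) 𝓘(ℂ, ℂ) ω (fun x => jetCoord 3 e (c x) t) x := by
  have h1 : ContMDiffAt (𝓘(ℂ, Cn 3).prod 𝓘(ℂ, ℂ)) 𝓘(ℂ, Cn 3) ω
      (fun p : X × ℂ => e ((c p.1).toFun p.2)) (x, 0) :=
    ContMDiffAt.comp_of_eq (contMDiffAt_chart he hx) hc (c x).map_zero
  have h2 : ContMDiffAt (𝓘(ℂ, Cn 3).prod 𝓘(ℂ, ℂ)) (𝓘(ℂ, Cn 3).prod 𝓘(ℂ, ℂ)) ω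
      (fun q : Cn 3 × ℂ => (e.symm q.1, q.2)) (e x, 0) :=
    (ContMDiffAt.comp (e x, (0 : ℂ)) (g := e.symm) (f := Prod.fst)
      (contMDiffAt_chart_symm he (e.map_source hx)) contMDiffAt_fst).prodMk contMDiffAt_snd
  have h3 : ContMDiffAt (𝓘(ℂ, Cn 3).prod 𝓘(ℂ, ℂ)) 𝓘(ℂ, Cn 3) ω
      (fun q : Cn 3 × ℂ => e ((c (e.symm q.1)).toFun q.2)) (e x, 0) :=
    ContMDiffAt.comp_of_eq (g := fun p : X × ℂ => e ((c p.1).toFun p.2)) h1 h2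
      (by rw [e.left_inv hx])
  rw [← modelWithCornersSelf_prod, chartedSpaceSelf_prod] at h3
  have h4 : AnalyticAt ℂ (fun q : Cn 3 × ℂ => e ((c (e.symm q.1)).toFun q.2) t.2) (e x, 0) :=
    ((ContinuousLinearMap.proj (R := ℂ) (φ := fun _ : Fin 3 => ℂ) t.2).analyticAt _).comp
      (contMDiffAt_iff_contDiffAt.1 h3).analyticAt
  have h5 := analyticAt_iteratedDeriv_snd h4 (t.1 + 1)
  have h6 : AnalyticAt ℂ (fun z : Cn 3 =>
      iteratedDeriv (t.1 + 1) (fun s => e ((c (e.symm z)).toFun s) t.2) 0) (e x) :=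
    h5.comp (f := fun z : Cn 3 => (z, (0 : ℂ))) (analyticAt_id.prod analyticAt_const)
  have h7 := h6.contDiffAt.contMDiffAt (n := ω) |>.comp x (contMDiffAt_chart he hx)
  refine h7.congr_of_eventuallyEq ?_
  filter_upwards [e.open_source.mem_nhds hx] with x' hx'
  exact congrArg (fun z => iteratedDeriv (t.1 + 1) (fun s => e ((c z).toFun s) t.2) 0)
    (e.left_inv hx').symm

lemma contMDiffAt_chartCurve_family (he : e ∈ atlas (Cn 3) X) (hx : x ∈ e.source)
    (y : Fin 3 × Fin 3 → ℂ) :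
    ContMDiffAt (𝓘(ℂ, Cn 3).prod 𝓘(ℂ, ℂ)) 𝓘(ℂ, Cn 3) ω
      (fun p : X × ℂ => e.symm (e p.1 + jetCurve y p.2)) (x, 0) := by
  have h1 : ContMDiffAt (𝓘(ℂ, Cn 3).prod 𝓘(ℂ, ℂ)) 𝓘(ℂ, Cn 3) ω
      (fun p : X × ℂ => e p.1) (x, 0) :=
    ContMDiffAt.comp (x, (0 : ℂ)) (g := e) (f := Prod.fst) (contMDiffAt_chart he hx)
      contMDiffAt_fst
  have h2 : ContMDiffAt (𝓘(ℂ, Cn 3).prod 𝓘(ℂ, ℂ)) 𝓘(ℂ, Cn 3) ω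
      (fun p : X × ℂ => jetCurve y p.2) (x, 0) :=
    ContMDiffAt.comp (x, (0 : ℂ)) (g := jetCurve y) (f := Prod.snd)
      (contDiff_jetCurve y).contDiffAt.contMDiffAt contMDiffAt_snd
  exact ContMDiffAt.comp_of_eq (g := e.symm) (contMDiffAt_chart_symm he (e.map_source hx))
    (h1.add h2) (by simp [jetCurve_zero])

end Families

/-! ### Holomorphic sections in charts -/

section Sections

variable {m : ℕ}

/-- The leading form of an invariant polynomial of multidegree at most `l`. -/
def leadOf (m : ℕ) (l : Fin 3 → ℕ) : ↥(invPoly m ⊓ upTo l) →ₗ[ℂ] leadForms m l :=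
  LinearMap.codRestrict _ (comp (intDeg l) ∘ₗ (invPoly m ⊓ upTo l).subtype) fun P =>
    ⟨_, P.2.1, leadsTo_comp P.2.2⟩

lemma leadOf_surjective (m : ℕ) (l : Fin 3 → ℕ) : Function.Surjective (leadOf m l) := by
  rintro ⟨P, q, hq, h⟩
  exact ⟨⟨q, hq, h.mem_upTo⟩, Subtype.ext h.comp_eq⟩

variable {X : Type*} [TopologicalSpace X] [ChartedSpace (Cn 3) X] [IsManifold 𝓘(ℂ, Cn 3) ω X]

open Classical in
/-- A section of the graded bundle, seen in the chart at `x₀`. -/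
def localLead (x₀ : X) (s : ∀ x : X, GrJets 3 3 m x) (x : X) : LeadSum m :=
  if h : x ∈ (chartAt (Cn 3) x₀).source then grEquiv (chart_mem_atlas (Cn 3) x₀) h m (s x) else 0

lemma localLead_of_mem {x₀ x : X} (s : ∀ x : X, GrJets 3 3 m x)
    (h : x ∈ (chartAt (Cn 3) x₀).source) :
    localLead x₀ s x = grEquiv (chart_mem_atlas (Cn 3) x₀) h m (s x) := dif_pos h

open Classical in
lemma holFam_localLead {x₀ : X} {s : ∀ x : X, GrJets 3 3 m x} {l : WeightIndex 3 m} {W : Set X}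
    (hW : IsOpen W) (hWe : W ⊆ (chartAt (Cn 3) x₀).source)
    {Q : ∀ x : X, filLE (n := 3) 3 m l.1 x}
    (hQ : IsHolJets W fun x => (Q x : HolCurve 3 x → ℂ))
    (hs : ∀ x ∈ W, s x l = Submodule.Quotient.mk (Q x)) :
    HolFam W fun x => localLead x₀ s x l := by
  have he := chart_mem_atlas (Cn 3) x₀
  let P : X → ↥(invPoly m ⊓ upTo l.1) := fun x =>
    if h : x ∈ (chartAt (Cn 3) x₀).source then
      ⟨chartPoly (chartAt (Cn 3) x₀) x (Q x), chartPoly_mem he h (Q x).2⟩ else 0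
  have hP : HolFam W P := by
    refine holFam_of_separating (ι := Fin 3 × Fin 3 → ℂ)
      (fun y => (aeval y).toLinearMap ∘ₗ (invPoly m ⊓ upTo l.1).subtype)
      (fun p hp => Subtype.ext (MvPolynomial.funext fun y => by simpa using hp y)) fun y => ?_
    -- The test family has constant jet y in the chart at x₀, so it evaluates the polynomial at y.
    -- Outside the chart an arbitrary curve is used, because a family must be defined on all of X.
    let c : ∀ x : X, HolCurve 3 x := fun x =>
      if h : x ∈ (chartAt (Cn 3) x₀).source then chartCurve he h y
      else chartCurve (chart_mem_atlas (Cn 3) x) (mem_chart_source (Cn 3) x) y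
    refine (hQ W subset_rfl hW c fun x hx => ?_).congr fun x hx => ?_
    · refine (contMDiffAt_chartCurve_family he (hWe hx) y).congr_of_eventuallyEq ?_
      filter_upwards [continuousAt_fst.preimage_mem_nhds
        ((chartAt (Cn 3) x₀).open_source.mem_nhds (hWe hx))] with q hq
      have hq' : q.1 ∈ (chartAt (Cn 3) x₀).source := hq
      simp only [c, dif_pos hq']
      rfl
    · have h1 : (P x : JetPoly) = chartPoly (chartAt (Cn 3) x₀) x (Q x) := by
        simp only [P, dif_pos (hWe hx)]
      have h2 : c x = chartCurve he (hWe hx) y := dif_pos (hWe hx)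
      have h3 := congrFun (evalJets_chartPoly he (hWe hx) (Q x).2) (c x)
      refine Eq.trans ?_ h3
      rw [h2]
      change aeval y (P x : JetPoly) = eval (jetCoord 3 _ _) _
      rw [jetCoord_chartCurve, h1]
      rfl
  refine (hP.map (leadOf m l.1)).congr fun x hx => Subtype.ext ?_
  rw [localLead_of_mem s (hWe hx), grEquiv_apply, hs x hx, pieceEquiv_mk, coe_leadMap]
  simp only [P, dif_pos (hWe hx)]
  rfl

open Classical in
lemma exists_isHolJets {x₀ : X} {s : ∀ x : X, GrJets 3 3 m x} {W : Set X}
    (hWe : W ⊆ (chartAt (Cn 3) x₀).source) (h : HolFam W (localLead x₀ s)) (l : WeightIndex 3 m) :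
    ∃ Q : ∀ x : X, filLE (n := 3) 3 m l.1 x,
      IsHolJets W (fun x => (Q x : HolCurve 3 x → ℂ)) ∧
        ∀ x ∈ W, s x l = Submodule.Quotient.mk (Q x) := by
  have he := chart_mem_atlas (Cn 3) x₀
  -- A linear right inverse, independent of the point, lifts leading forms to invariant polynomials
  -- and so preserves holomorphy.
  obtain ⟨σ, hσ⟩ := (leadOf m l.1).exists_rightInverse_of_surjective
    (LinearMap.range_eq_top.2 (leadOf_surjective m l.1))
  have hl : HolFam W fun x => localLead x₀ s x l :=
    h.map (DirectSum.component ℂ (WeightIndex 3 m) (fun l => leadForms m l.1) l)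
  let Q : ∀ x : X, filLE (n := 3) 3 m l.1 x := fun x =>
    if h : x ∈ (chartAt (Cn 3) x₀).source then
      ⟨evalJets (chartAt (Cn 3) x₀) x (σ (localLead x₀ s x l)), by
        rw [filLE_eq_map he h]
        exact Submodule.mem_map_of_mem (σ _).2⟩ else 0
  have hQ : ∀ x ∈ W, (Q x : HolCurve 3 x → ℂ) =
      evalJets (chartAt (Cn 3) x₀) x (σ (localLead x₀ s x l)) := fun x hx => by
    simp only [Q, dif_pos (hWe hx)]
  refine ⟨Q, fun W' hW' _ c hc => ?_, fun x hx => ?_⟩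
  · refine (((hl.mono hW').map σ).eval (invPoly m ⊓ upTo l.1).subtype
      (y := fun x => jetCoord 3 (chartAt (Cn 3) x₀) (c x)) fun t x hx =>
        (contMDiffAt_jetCoord he (hWe (hW' hx)) (hc x hx) t).contMDiffWithinAt).congr
      fun x hx => ?_
    exact congrFun (hQ x (hW' hx)) (c x)
  · refine (pieceEquiv he (hWe hx) m l.1).injective ?_
    rw [pieceEquiv_mk, ← grEquiv_apply, ← localLead_of_mem]
    refine Subtype.ext ?_
    rw [coe_leadMap, hQ x hx, chartPoly_evalJets he (hWe hx)]
    exact congrArg Subtype.val (LinearMap.congr_fun hσ (localLead x₀ s x l)).symm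

/-- A criterion in a fixed chart, to be matched with the one for Schur bundles. The neighbourhoods
of the separate components can be intersected as there are finitely many multidegrees. -/
lemma isHolGr_iff {U : Set X} (hU : IsOpen U) {s : ∀ x : X, GrJets 3 3 m x} :
    IsHolGr U s ↔ ∀ x₀ ∈ U, ∃ W ⊆ U, IsOpen W ∧ x₀ ∈ W ∧ W ⊆ (chartAt (Cn 3) x₀).source ∧
      HolFam W (localLead x₀ s) := by
  constructor
  · intro h x₀ hx₀
    choose W hWU hWo hxW Q hQ hs using fun l => h l x₀ hx₀
    refine ⟨U ∩ (chartAt (Cn 3) x₀).source ∩ ⋂ l, W l, fun x hx => hx.1.1,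
      (hU.inter (chartAt (Cn 3) x₀).open_source).inter (isOpen_iInter_of_finite hWo),
      ⟨⟨hx₀, mem_chart_source _ x₀⟩, Set.mem_iInter.2 hxW⟩, fun x hx => hx.1.2,
      holFam_directSum fun l => ?_⟩
    have h1 : U ∩ (chartAt (Cn 3) x₀).source ∩ ⋂ l, W l ⊆ W l := fun x hx =>
      Set.mem_iInter.1 hx.2 l
    exact holFam_localLead
      ((hU.inter (chartAt (Cn 3) x₀).open_source).inter (isOpen_iInter_of_finite hWo))
      (fun x hx => hx.1.2) (fun W' hW' => hQ l W' (hW'.trans h1)) fun x hx => hs l x (h1 hx)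
  · intro h l x₀ hx₀
    obtain ⟨W, hWU, hWo, hxW, hWe, hW⟩ := h x₀ hx₀
    exact ⟨W, hWU, hWo, hxW, exists_isHolJets hWe hW l⟩

/-- The isomorphism of the graded fibre at `x` with the sum of the Schur functors. -/
def fibreIso (m : ℕ) (x : X) :
    GrJets 3 3 m x ≃ₗ[ℂ] ⨁ p : SchurIndex m, SchurCotangent (n := 3) p.1.2 x :=
  chartIso (chart_mem_atlas (Cn 3) x) (mem_chart_source (Cn 3) x) m

lemma hasMatrix_tangentCoordChange {x x₀ : X} (hx : x ∈ (chartAt (Cn 3) x₀).source) :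
    HasMatrix (inCharts (chartAt (Cn 3) x) (chartAt (Cn 3) x₀) id) (chartAt (Cn 3) x x)
      (tangentCoordChange 𝓘(ℂ, Cn 3) x x₀ x).toLinearMap := by
  have h := hasMatrix_fderiv (analyticAt_inCharts (chart_mem_atlas (Cn 3) x)
    (chart_mem_atlas (Cn 3) x₀) (mem_chart_source _ x) (ψ := id) hx contMDiffAt_id)
  have h' : tangentCoordChange 𝓘(ℂ, Cn 3) x x₀ x =
      fderiv ℂ (inCharts (chartAt (Cn 3) x) (chartAt (Cn 3) x₀) id) (chartAt (Cn 3) x x) := by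
    rw [tangentCoordChange_def]
    simp only [mfld_simps, fderivWithin_univ]
    rfl
  rw [h']
  exact h

/-- `fibreIso` uses the preferred chart at each x, which need not vary continuously with x. Passing
to the fixed chart at x₀ costs only the tangent coordinate change, which depends holomorphically on
x. -/
lemma fibreIso_apply {x x₀ : X} (hx : x ∈ (chartAt (Cn 3) x₀).source)
    (s : ∀ x : X, GrJets 3 3 m x) (p : SchurIndex m) (v : Cells p.1.2 → Cn 3) :
    (fibreIso m x (s x) p).1 v = (leadSumEquiv m (localLead x₀ s x) p).1
      fun c => tangentCoordChange 𝓘(ℂ, Cn 3) x x₀ x (v c) := by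
  have h := chartIso_change (chart_mem_atlas (Cn 3) x) (chart_mem_atlas (Cn 3) x₀)
    (mem_chart_source (Cn 3) x) hx (hasMatrix_tangentCoordChange hx) (s x)
  rw [localLead_of_mem s hx]
  change (chartIso (chart_mem_atlas (Cn 3) x) (mem_chart_source (Cn 3) x) m (s x) p).1 v = _
  rw [h]
  rfl

lemma isHolSchur_fibreIso_iff {U : Set X} (hU : IsOpen U) {s : ∀ x : X, GrJets 3 3 m x} :
    (∀ p : SchurIndex m, IsHolSchur U fun x => fibreIso m x (s x) p) ↔
      ∀ x₀ ∈ U, ∃ W ⊆ U, IsOpen W ∧ x₀ ∈ W ∧ W ⊆ (chartAt (Cn 3) x₀).source ∧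
        HolFam W (localLead x₀ s) := by
  constructor
  · intro h x₀ hx₀
    have hWo := hU.inter (chartAt (Cn 3) x₀).open_source
    refine ⟨U ∩ (chartAt (Cn 3) x₀).source, Set.inter_subset_left, hWo,
      ⟨hx₀, mem_chart_source _ x₀⟩, Set.inter_subset_right, ?_⟩
    suffices HolFam (U ∩ (chartAt (Cn 3) x₀).source) fun x => leadSumEquiv m (localLead x₀ s x) from
      (this.map (leadSumEquiv m).symm.toLinearMap).congr fun x _ => by simp
    refine holFam_directSum fun p => ?_
    refine holFam_of_separating (ι := Cells p.1.2 → Fin 3)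
      (fun κ => evalForm fun c => Pi.single (κ c) 1) (fun S hS => Subtype.ext ?_) fun κ => ?_
    · refine MultilinearMap.ext fun v => ?_
      rw [cellForms_eq_sum]
      exact Finset.sum_eq_zero fun κ _ => by
        rw [show S.1 (fun c => Pi.single (κ c) 1) = 0 from hS κ, zero_mul]
    · have hinv : ∀ x ∈ (chartAt (Cn 3) x₀).source, ∀ w : Cn 3,
          tangentCoordChange 𝓘(ℂ, Cn 3) x x₀ x (tangentCoordChange 𝓘(ℂ, Cn 3) x₀ x x w) = w :=
        fun x hx w => by
          rw [tangentCoordChange_comp, tangentCoordChange_self] <;> simp [hx]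
      -- Vector fields that are constant in the chart at x₀: evaluation on them reads off the
      -- components of the form in that chart.
      let v : Cells p.1.2 → ∀ x : X, TangentSpace 𝓘(ℂ, Cn 3) x := fun c x =>
        tangentCoordChange 𝓘(ℂ, Cn 3) x₀ x x (Pi.single (κ c) 1)
      refine (h p _ Set.inter_subset_left hWo v fun c => ?_).congr fun x hx => ?_
      · refine (Bundle.Trivialization.contMDiffOn_section_iff
          (trivializationAt (Cn 3) (TangentSpace 𝓘(ℂ, Cn 3)) x₀) hWo
          Set.inter_subset_right).2 ?_
        refine (contMDiffOn_const (c := (Pi.single (κ c) 1 : Cn 3))).congr fun x hx => ?_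
        exact hinv x hx.2 _
      · refine ((fibreIso_apply hx.2 s p fun c => v c x).trans ?_).symm
        simp only [v, hinv x hx.2]
        rfl
  · intro h p W' hW' hW'o v hv x₀ hx₀
    obtain ⟨W, hWU, hWo, hxW, hWe, hW⟩ := h x₀ (hW' hx₀)
    have ho := hW'o.inter hWo
    have h1 : HolFam (W' ∩ W) fun x => leadSumEquiv m (localLead x₀ s x) p :=
      (hW.mono Set.inter_subset_right).map
        (DirectSum.component ℂ (SchurIndex m) (fun p => SchurDual p.1.2 (Cn 3)) p ∘ₗ
          (leadSumEquiv m).toLinearMap)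
    have h2 := h1.apply (w := fun c x => tangentCoordChange 𝓘(ℂ, Cn 3) x x₀ x (v c x)) fun c =>
      (Bundle.Trivialization.contMDiffOn_section_iff
        (trivializationAt (Cn 3) (TangentSpace 𝓘(ℂ, Cn 3)) x₀) ho
        fun x hx => hWe hx.2).1 ((hv c).mono Set.inter_subset_left)
    have h3 := h2.congr (f₁ := fun x => (fibreIso m x (s x) p).1 fun c => v c x) fun x hx =>
      fibreIso_apply (hWe hx.2) s p fun c => v c x
    exact (h3.contMDiffAt (ho.mem_nhds ⟨hx₀, hxW⟩)).contMDiffWithinAt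

end Sections

end

theorem mainTheorem4 {X : Type*} [TopologicalSpace X] [ChartedSpace (Cn 3) X]
    [IsManifold 𝓘(ℂ, Cn 3) ω X] (m : ℕ) :
    (∃ Φ : ∀ x : X, GrJets 3 3 m x ≃ₗ[ℂ]
        ⨁ p : SchurIndex m, SchurCotangent (n := 3) p.1.2 x,
      -- `Φ` is an isomorphism of holomorphic bundles
      (∀ U : Set X, IsOpen U → ∀ s : ∀ x : X, GrJets 3 3 m x,
        IsHolGr U s ↔ ∀ p : SchurIndex m, IsHolSchur U fun x => Φ x (s x) p) ∧
      -- `Φ` commutes with pullback by germs of biholomorphic maps; in particular `Φ x` is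
      -- equivariant under the general linear group of the tangent space at `x`
      (∀ (x : X) (ψ : X → X) (hψ : ContMDiffAt 𝓘(ℂ, Cn 3) 𝓘(ℂ, Cn 3) ω ψ x),
        Function.Bijective (mfderiv 𝓘(ℂ, Cn 3) 𝓘(ℂ, Cn 3) ψ x) →
        ∀ (l : WeightIndex 3 m) (Q : filLE (n := 3) 3 m l.1 (ψ x)),
          ∃ hQ : (fun f : HolCurve 3 x => Q.1 (f.map ψ hψ)) ∈ filLE 3 m l.1 x,
            ∀ p : SchurIndex m,
              Φ x (grClass l ⟨_, hQ⟩) p =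
                schurPullback p.1.2 (mfderiv 𝓘(ℂ, Cn 3) 𝓘(ℂ, Cn 3) ψ x).toLinearMap
                  (Φ (ψ x) (grClass l Q) p))) ∧
    -- every Schur functor occurs at most once
    Function.Injective fun p : SchurIndex m => p.1.2 := by
  refine ⟨⟨fibreIso m, fun U hU s => (isHolGr_iff hU).trans (isHolSchur_fibreIso_iff hU).symm,
    fun x ψ hψ _ l Q => ⟨map_mem_filLE (chart_mem_atlas (Cn 3) x) (chart_mem_atlas (Cn 3) (ψ x))
      (mem_chart_source _ x) (mem_chart_source _ (ψ x)) hψ Q.2, fun p => ?_⟩⟩, fun p p' h => ?_⟩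
  · exact DFunLike.congr_fun (chartIso_map (chart_mem_atlas (Cn 3) x)
      (chart_mem_atlas (Cn 3) (ψ x)) (mem_chart_source _ x) (mem_chart_source _ (ψ x)) hψ
      (hasMatrix_mfderiv hψ) l Q) p
  -- γ is recovered from λ as m - (λ₁ + 2 λ₂ + 3 λ₃).
  · have h' : p.1.2 = p'.1.2 := h
    have h1 := schurIndex_facts p
    have h2 := schurIndex_facts p'
    rw [h'] at h1
    exact Subtype.ext (Prod.ext (by omega) h')
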